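/- Let $I$ be a Stable Roommates instance with a positive even number $n$ of agents $a_1,\dots,a_n$: every agent has a complete strict preference list over all other agents, extended by itself in the last place. A permutation $\Pi$ of the agents is a \emph{stable partition} of $I$ if (T1) for every agent $a$, either $\Pi(a)=\Pi^{-1}(a)$ or $a$ strictly prefers $\Pi(a)$ to $\Pi^{-1}(a)$, and (T2) there are no two distinct agents $a,b$ such that $a$ strictly prefers $b$ to $\Pi^{-1}(a)$ and $b$ strictly prefers $a$ to $\Pi^{-1}(b)$. The \emph{stable cycles} $SC(I)$ of $I$ are the cycles (fixed points are cycles of length $1$) of all stable partitions of $I$. Let $n_2$ be the number of agents that lie in stable cycles of odd length, and let $n_1=n-n_2$. \textbf{Theorem.} There is an algorithm (one program for a unit-cost random access machine with words of $O(\log n)$ bits) that, given the number $n$ of agents and the preference lists of $I$, outputs all stable cycles of $I$, each exactly once, in time $O(n_1^2(n^2+n_1))$ if $n_1>0$ and in time $O(n^2)$ if $n_1=0$; in particular the time is $O(n^4)$. The implied constants are absolute. -/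

import Mathlib

/-! ### Stable Roommates instances, stable partitions, stable cycles -/

/-- A Stable Roommates instance with agents `0, …, n - 1` and complete strict preferences:
`rank i j` is the position (`0` is best) of agent `j` in the preference list of agent `i`,
where every list is extended by its owner in the last position. -/
structure SRInstance (n : ℕ) where
  rank : Fin n → Equiv.Perm (Fin n)
  self_last : ∀ i j, rank i j ≤ rank i i

namespace SRInstance

variable {n : ℕ}

/-- `I.Prefers i j k`: agent `i` strictly prefers `j` to `k`. -/
def Prefers (I : SRInstance n) (i j k : Fin n) : Prop :=
  I.rank i j < I.rank i k

/-- A permutation `p` of the agents (`p a` is the successor and `p⁻¹ a` the predecessor of `a`)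
is a stable partition if every agent weakly prefers its successor to its predecessor (T1), and
no two distinct agents strictly prefer each other to their predecessors (T2). -/
def IsStablePartition (I : SRInstance n) (p : Equiv.Perm (Fin n)) : Prop :=
  (∀ i, p i = p⁻¹ i ∨ I.Prefers i (p i) (p⁻¹ i)) ∧
  ¬ ∃ i j, i ≠ j ∧ I.Prefers i j (p⁻¹ i) ∧ I.Prefers j i (p⁻¹ j)

/-- `C` is one of the cycles of the permutation `p`. Fixed points are cycles of length one. -/
def IsCycleOf (C : Cycle (Fin n)) (p : Equiv.Perm (Fin n)) : Prop :=
  C ≠ Cycle.nil ∧ C.Nodup ∧ C.Chain (fun a b => p a = b)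

/-- The set `SC(I)` of stable cycles: the cycles of all stable partitions. -/
def SC (I : SRInstance n) : Set (Cycle (Fin n)) :=
  {C | ∃ p : Equiv.Perm (Fin n), I.IsStablePartition p ∧ IsCycleOf C p}

/-- The agents that lie in stable cycles of odd length. -/
def oddAgents (I : SRInstance n) : Set (Fin n) :=
  {a | ∃ C ∈ I.SC, Odd C.length ∧ a ∈ C}

/-- The number of agents in stable cycles of odd length. -/
noncomputable def n₂ (I : SRInstance n) : ℕ := I.oddAgents.ncard

/-- The number of agents that are not in stable cycles of odd length. -/
noncomputable def n₁ (I : SRInstance n) : ℕ := n - I.n₂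

end SRInstance

/-! ### Random access machine

Programs of a small imperative language over finitely many variables and arrays of natural
numbers (both named by natural numbers), with one unit of time for every elementary operation.
There is no step that does more than a bounded amount of work on machine words: the semantics is
parametrised by `W`, and a program gets stuck when it stores or prints a number that is not below
`W`, or stores at an address that is not below `W`. -/

namespace RAM

structure State where
  /-- contents of the variables -/
  var : ℕ → ℕ
  /-- `arr a i` is the content of cell `i` of array `a` -/
  arr : ℕ → ℕ → ℕ
  /-- what has been printed so far, first item first -/
  out : List ℕ

inductive Expr where
  | lit (k : ℕ)
  | var (x : ℕ)
  | read (a : ℕ) (i : Expr)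
  | add (e f : Expr)
  | sub (e f : Expr)
  | mul (e f : Expr)
  | lt (e f : Expr)
  | eq (e f : Expr)

namespace Expr

/-- The value of an expression. Subtraction is truncated, comparisons return `1` or `0`. -/
def eval (s : State) : Expr → ℕ
  | lit k => k
  | var x => s.var x
  | read a i => s.arr a (i.eval s)
  | add e f => e.eval s + f.eval s
  | sub e f => e.eval s - f.eval s
  | mul e f => e.eval s * f.eval s
  | lt e f => if e.eval s < f.eval s then 1 else 0
  | eq e f => if e.eval s = f.eval s then 1 else 0

/-- The time to evaluate an expression: one unit for every operation in it. -/
def cost : Expr → ℕ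
  | lit _ => 1
  | var _ => 1
  | read _ i => i.cost + 1
  | add e f => e.cost + f.cost + 1
  | sub e f => e.cost + f.cost + 1
  | mul e f => e.cost + f.cost + 1
  | lt e f => e.cost + f.cost + 1
  | eq e f => e.cost + f.cost + 1

end Expr

inductive Program where
  | skip
  /-- `x := e` -/
  | assign (x : ℕ) (e : Expr)
  /-- `a[i] := e` -/
  | store (a : ℕ) (i e : Expr)
  /-- append the value of `e` to the output -/
  | print (e : Expr)
  | seq (P Q : Program)
  /-- if `e ≠ 0` then `P` else `Q` -/
  | ite (e : Expr) (P Q : Program)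
  /-- while `e ≠ 0` do `P` -/
  | loop (e : Expr) (P : Program)

/-- `Exec W P s t s'`: started in state `s`, with word bound `W`, the program `P` terminates in
state `s'` after exactly `t` units of time. -/
inductive Exec (W : ℕ) : Program → State → ℕ → State → Prop
  | skip (s : State) : Exec W .skip s 1 s
  | assign (s : State) (x : ℕ) (e : Expr) (he : e.eval s < W) :
      Exec W (.assign x e) s (e.cost + 1)
        { s with var := Function.update s.var x (e.eval s) }
  | store (s : State) (a : ℕ) (i e : Expr) (hi : i.eval s < W) (he : e.eval s < W) :
      Exec W (.store a i e) s (i.cost + e.cost + 1)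
        { s with arr := Function.update s.arr a
                          (Function.update (s.arr a) (i.eval s) (e.eval s)) }
  | print (s : State) (e : Expr) (he : e.eval s < W) :
      Exec W (.print e) s (e.cost + 1) { s with out := s.out ++ [e.eval s] }
  | seq {P Q : Program} {s s' s'' : State} {t t' : ℕ}
      (hP : Exec W P s t s') (hQ : Exec W Q s' t' s'') :
      Exec W (.seq P Q) s (t + t') s''
  | ite_true {e : Expr} {P Q : Program} {s s' : State} {t : ℕ}
      (he : e.eval s ≠ 0) (hP : Exec W P s t s') :
      Exec W (.ite e P Q) s (e.cost + 1 + t) s'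
  | ite_false {e : Expr} {P Q : Program} {s s' : State} {t : ℕ}
      (he : e.eval s = 0) (hQ : Exec W Q s t s') :
      Exec W (.ite e P Q) s (e.cost + 1 + t) s'
  | loop_true {e : Expr} {P : Program} {s s' s'' : State} {t t' : ℕ}
      (he : e.eval s ≠ 0) (hP : Exec W P s t s') (hL : Exec W (.loop e P) s' t' s'') :
      Exec W (.loop e P) s (e.cost + 1 + t + t') s''
  | loop_false {e : Expr} {P : Program} {s : State} (he : e.eval s = 0) :
      Exec W (.loop e P) s (e.cost + 1) s

/-- The machine is deterministic: final state and running time are determined by the input. -/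
theorem Exec.unique {W : ℕ} {P : Program} {s s₁ s₂ : State} {t₁ t₂ : ℕ}
    (h₁ : Exec W P s t₁ s₁) (h₂ : Exec W P s t₂ s₂) : t₁ = t₂ ∧ s₁ = s₂ := by
  induction h₁ generalizing t₂ s₂ with
  | skip | assign | store | print => cases h₂; exact ⟨rfl, rfl⟩
  | seq _ _ ih ih' =>
    cases h₂ with
    | seq hP hQ =>
      obtain ⟨rfl, rfl⟩ := ih hP
      obtain ⟨rfl, rfl⟩ := ih' hQ
      exact ⟨rfl, rfl⟩
  | ite_true he _ ih =>
    cases h₂ with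
    | ite_true _ hP => obtain ⟨rfl, rfl⟩ := ih hP; exact ⟨rfl, rfl⟩
    | ite_false he' _ => exact absurd he' he
  | ite_false he _ ih =>
    cases h₂ with
    | ite_true he' _ => exact absurd he he'
    | ite_false _ hQ => obtain ⟨rfl, rfl⟩ := ih hQ; exact ⟨rfl, rfl⟩
  | loop_true he _ _ ih ih' =>
    cases h₂ with
    | loop_true _ hP hL =>
      obtain ⟨rfl, rfl⟩ := ih hP
      obtain ⟨rfl, rfl⟩ := ih' hL
      exact ⟨rfl, rfl⟩
    | loop_false he' => exact absurd he' he
  | loop_false he =>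
    cases h₂ with
    | loop_true he' _ _ => exact absurd he he'
    | loop_false _ => exact ⟨rfl, rfl⟩

end RAM

/-! ### Input and output -/

namespace SRInstance

variable {n : ℕ}

/-- The preference lists, row by row: cell `i * n + k` holds the agent in position `k` of the
list of agent `i`. All other cells are `0`. -/
def prefTable (I : SRInstance n) (m : ℕ) : ℕ :=
  if h : m / n < n ∧ m % n < n then (I.rank ⟨m / n, h.1⟩).symm ⟨m % n, h.2⟩ else 0

/-- The initial state: variable `0` holds the number of agents, array `0` the preference lists,
everything else is `0`, and nothing has been printed. -/
def initState (I : SRInstance n) : RAM.State where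
  var x := if x = 0 then n else 0
  arr a m := if a = 0 then I.prefTable m else 0
  out := []

/-- A list of cycles as it is printed: each cycle as its length followed by its agents in cyclic
order (beginning with any of them). -/
def encodeCycles (L : List (List (Fin n))) : List ℕ :=
  L.flatMap fun l => l.length :: l.map Fin.val

/-- `out` lists all stable cycles of `I`, each of them exactly once, and nothing else. -/
def ListsStableCycles (I : SRInstance n) (out : List ℕ) : Prop :=
  ∃ L : List (List (Fin n)), out = encodeCycles L ∧
    (L.map fun l => (l : Cycle (Fin n))).Nodup ∧
    ∀ C : Cycle (Fin n), C ∈ (L.map fun l => (l : Cycle (Fin n))) ↔ C ∈ I.SC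

end SRInstance

/-!
A stable partition has a successor and a predecessor for every agent. The program rests on how two
stable partitions can differ, on a quadratic test of whether prescribed cycles occur together in a
stable partition, and on a quadratic algorithm that finds one stable partition.

**Comparison.** Let `p` and `q` be stable partitions, and look at the agents that prefer their
predecessor in `q` to the one in `p`. Stability gives an injective map of this set into itself,
which is therefore onto; it follows that the successor of an agent in `q` never lies strictly
between its successor and its predecessor in `p` (`pred_le_of_succ_lt`). Hence all stable
partitions have the same odd cycles (`eq_on_odd_cycle`), which can be read off any one of them, and
`n₁` is the number of agents on its even cycles. An even cycle splits into transpositions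
(`exists_transposition`), so neighbours on it are partners in a stable pair, that is, they form a
stable cycle of length two. By the comparison there is no further partner strictly between the
successor and the predecessor of an agent on an even cycle longer than two, so that there the
successor is the next better partner after the predecessor (`IsStablePartition.isNext`). Such a
cycle can be traced from its least agent and the agent after that: there are at most `n₁ ^ 2`
candidates for transpositions, and as many for longer even cycles.

**Test.** Given some cycles, stability prescribes for every other agent a threshold, the best agent
on the cycles that prefers it to its own predecessor. Move the good neighbours (those next to the
agent on a given cycle, or off the cycles and above each other's thresholds) to the front of all
lists. Every stable partition of the resulting instance decides alike whether the cycles extend to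
a stable partition of the original one (`compatible_iff`).

**Solution.** The algorithm of Irving and Tan finds a stable partition. A sequence of proposals
produces a prestable permutation, in which every agent has a first and a last possible neighbour
(`ProposalInv.exists_prestable`). As long as an agent has a list with further entries, a search
path from it ends in a rotation. The elimination of this rotation gives a prestable permutation
again (`IsPrestable.mul_rotation`), since the obstruction to it would propagate back to the start
of the path, which has a long list (`not_isBad_of_path`). When all lists are short, the permutation
is stable (`IsPrestable.isStablePartition`). The part of the path in front of the rotation is kept.
For every agent a pointer into its list moves towards the second entry of the reduced list and
never goes back, so all searches together take time `O(n ^ 2)` (`solveProg_spec`).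

**Time.** One solution, the odd cycles and the tables take time `O(n ^ 2)`. A pair of agents on
even cycles causes at most two tests and the tracing of one cycle, each in time `O(n ^ 2)`; pairs
of other agents cost `O(1)`. This makes `O(n₁ ^ 2 * n ^ 2 + n ^ 2)`. All numbers that occur are
below `n ^ 3`. The claims about programs are stated with the predicate `wp`, which asserts
termination along with a property of the final state and the running time; in loops, the time is
paid for by a potential that depends on the state.
-/

/-! ### A program logic for the random access machine -/

namespace RAM

namespace State

/-- The state after `x := v`. -/
def setVar (s : State) (x v : ℕ) : State :=
  { s with var := Function.update s.var x v }

/-- The state after `a[i] := v`. -/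
def setArr (s : State) (a i v : ℕ) : State :=
  { s with arr := Function.update s.arr a (Function.update (s.arr a) i v) }

/-- The state after printing `v`. -/
def emit (s : State) (v : ℕ) : State :=
  { s with out := s.out ++ [v] }

@[simp] theorem setVar_var (s : State) (x v y : ℕ) :
    (s.setVar x v).var y = if y = x then v else s.var y := by
  simp [setVar, Function.update_apply]

@[simp] theorem setVar_arr (s : State) (x v : ℕ) : (s.setVar x v).arr = s.arr := rfl

@[simp] theorem setVar_out (s : State) (x v : ℕ) : (s.setVar x v).out = s.out := rfl

@[simp] theorem setArr_var (s : State) (a i v : ℕ) : (s.setArr a i v).var = s.var := rfl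

@[simp] theorem setArr_arr (s : State) (a i v b : ℕ) :
    (s.setArr a i v).arr b = if b = a then Function.update (s.arr a) i v else s.arr b := by
  simp only [setArr, Function.update_apply]

@[simp] theorem setArr_out (s : State) (a i v : ℕ) : (s.setArr a i v).out = s.out := rfl

@[simp] theorem emit_var (s : State) (v : ℕ) : (s.emit v).var = s.var := rfl

@[simp] theorem emit_arr (s : State) (v : ℕ) : (s.emit v).arr = s.arr := rfl

@[simp] theorem emit_out (s : State) (v : ℕ) : (s.emit v).out = s.out ++ [v] := rfl

end State

namespace Expr

instance : Add Expr := ⟨add⟩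
instance : Sub Expr := ⟨sub⟩
instance : Mul Expr := ⟨mul⟩
instance (k : ℕ) : OfNat Expr k := ⟨lit k⟩

variable (s : State) (e f : Expr)

@[simp] theorem eval_add : (e + f).eval s = e.eval s + f.eval s := rfl
@[simp] theorem eval_sub : (e - f).eval s = e.eval s - f.eval s := rfl
@[simp] theorem eval_mul : (e * f).eval s = e.eval s * f.eval s := rfl
@[simp] theorem eval_zero : (0 : Expr).eval s = 0 := rfl
@[simp] theorem eval_one : (1 : Expr).eval s = 1 := rfl
@[simp] theorem eval_var (x : ℕ) : (var x).eval s = s.var x := rfl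
@[simp] theorem eval_read (a : ℕ) : (read a e).eval s = s.arr a (e.eval s) := rfl
@[simp] theorem eval_lt : (lt e f).eval s = if e.eval s < f.eval s then 1 else 0 := rfl
@[simp] theorem eval_eq : (eq e f).eval s = if e.eval s = f.eval s then 1 else 0 := rfl
@[simp] theorem cost_add : (e + f).cost = e.cost + f.cost + 1 := rfl
@[simp] theorem cost_sub : (e - f).cost = e.cost + f.cost + 1 := rfl
@[simp] theorem cost_mul : (e * f).cost = e.cost + f.cost + 1 := rfl
@[simp] theorem cost_zero : (0 : Expr).cost = 1 := rfl
@[simp] theorem cost_one : (1 : Expr).cost = 1 := rfl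
@[simp] theorem cost_var (x : ℕ) : (var x).cost = 1 := rfl
@[simp] theorem cost_read (a : ℕ) : (read a e).cost = e.cost + 1 := rfl
@[simp] theorem cost_lt : (lt e f).cost = e.cost + f.cost + 1 := rfl
@[simp] theorem cost_eq : (eq e f).cost = e.cost + f.cost + 1 := rfl

/-- The index of row `e`, column `f` of a table with as many columns as variable `0` says. -/
def idx (e f : Expr) : Expr := e * var 0 + f

@[simp] theorem eval_idx : (idx e f).eval s = e.eval s * s.var 0 + f.eval s := rfl
@[simp] theorem cost_idx : (idx e f).cost = e.cost + f.cost + 3 := by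
  simp only [idx, cost_add, cost_mul, cost_var]; ring

end Expr

namespace Program

/-- The variables that a program may change. -/
def writtenVars : Program → List ℕ
  | skip => []
  | assign x _ => [x]
  | store _ _ _ => []
  | print _ => []
  | seq P Q => P.writtenVars ++ Q.writtenVars
  | ite _ P Q => P.writtenVars ++ Q.writtenVars
  | loop _ P => P.writtenVars

/-- The arrays that a program may change. -/
def writtenArrs : Program → List ℕ
  | skip => []
  | assign _ _ => []
  | store a _ _ => [a]
  | print _ => []
  | seq P Q => P.writtenArrs ++ Q.writtenArrs
  | ite _ P Q => P.writtenArrs ++ Q.writtenArrs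
  | loop _ P => P.writtenArrs

/-- Whether a program contains a print instruction. -/
def prints : Program → Bool
  | skip => false
  | assign _ _ => false
  | store _ _ _ => false
  | print _ => true
  | seq P Q => P.prints || Q.prints
  | ite _ P Q => P.prints || Q.prints
  | loop _ P => P.prints

/-- `for x := 0, …, y - 1 do P`, where `y` is a variable. -/
def forLoop (x y : ℕ) (P : Program) : Program :=
  seq (assign x 0) (loop (.lt (.var x) (.var y)) (seq P (assign x (.var x + 1))))

end Program

/-- `s` and `s'` agree on everything that `P` contains no instruction to change. -/
structure Frame (P : Program) (s s' : State) : Prop where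
  var : ∀ x, x ∉ P.writtenVars → s'.var x = s.var x
  arr : ∀ a, a ∉ P.writtenArrs → s'.arr a = s.arr a
  out : P.prints = false → s'.out = s.out

theorem Frame.refl (P : Program) (s : State) : Frame P s s :=
  ⟨fun _ _ => rfl, fun _ _ => rfl, fun _ => rfl⟩

theorem Frame.trans {P : Program} {s s' s'' : State} (h : Frame P s s') (h' : Frame P s' s'') :
    Frame P s s'' :=
  ⟨fun x hx => (h'.var x hx).trans (h.var x hx), fun a ha => (h'.arr a ha).trans (h.arr a ha),
    fun ho => (h'.out ho).trans (h.out ho)⟩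

theorem Frame.of_subset {P Q : Program} {s s' : State} (h : Frame P s s')
    (hv : ∀ x ∈ P.writtenVars, x ∈ Q.writtenVars) (ha : ∀ a ∈ P.writtenArrs, a ∈ Q.writtenArrs)
    (ho : Q.prints = false → P.prints = false) : Frame Q s s' :=
  ⟨fun x hx => h.var x fun h' => hx (hv x h'), fun a hx => h.arr a fun h' => hx (ha a h'),
    fun h' => h.out (ho h')⟩

/-- A program changes only what occurs on the left of its assignments. -/
theorem Exec.frame {W : ℕ} {P : Program} {s s' : State} {t : ℕ} (h : Exec W P s t s') :
    Frame P s s' := by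
  induction h with
  | skip s => exact Frame.refl _ _
  | assign s x e he =>
    refine ⟨fun y hy => ?_, fun _ _ => rfl, fun _ => rfl⟩
    simp only [Program.writtenVars, List.mem_singleton] at hy
    simp [hy]
  | store s a i e hi he =>
    refine ⟨fun _ _ => rfl, fun b hb => ?_, fun _ => rfl⟩
    simp only [Program.writtenArrs, List.mem_singleton] at hb
    simp only [Function.update_apply, hb, if_false]
  | print s e he =>
    refine ⟨fun _ _ => rfl, fun _ _ => rfl, fun h => ?_⟩
    simp [Program.prints] at h
  | seq _ _ ih ih' =>
    refine Frame.trans (Frame.of_subset ih ?_ ?_ ?_) (Frame.of_subset ih' ?_ ?_ ?_) <;>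
      simp +contextual [Program.writtenVars, Program.writtenArrs, Program.prints]
  | ite_true _ _ ih =>
    refine Frame.of_subset ih ?_ ?_ ?_ <;>
      simp +contextual [Program.writtenVars, Program.writtenArrs, Program.prints]
  | ite_false _ _ ih =>
    refine Frame.of_subset ih ?_ ?_ ?_ <;>
      simp +contextual [Program.writtenVars, Program.writtenArrs, Program.prints]
  | loop_true _ _ _ ih ih' =>
    refine Frame.trans (Frame.of_subset ih ?_ ?_ ?_) ih' <;>
      simp +contextual [Program.writtenVars, Program.writtenArrs, Program.prints]
  | loop_false => exact Frame.refl _ _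

/-- Started in `s`, the program `P` terminates in a state and after a time that satisfy `Q`. -/
def wp (W : ℕ) (P : Program) (Q : State → ℕ → Prop) (s : State) : Prop :=
  ∃ t s', Exec W P s t s' ∧ Q s' t

variable {W : ℕ} {P P' : Program} {s : State} {e i : Expr} {Q R : State → ℕ → Prop}

/-- Consequence rule. What the program does not write may be used as well. -/
theorem wp_mono (h : wp W P Q s) (hQR : ∀ s' t, Frame P s s' → Q s' t → R s' t) :
    wp W P R s := by
  obtain ⟨t, s', hE, hQ⟩ := h
  exact ⟨t, s', hE, hQR s' t hE.frame hQ⟩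

theorem wp_skip (h : Q s 1) : wp W .skip Q s := ⟨_, _, .skip s, h⟩

theorem wp_assign {x : ℕ} (he : e.eval s < W) (h : Q (s.setVar x (e.eval s)) (e.cost + 1)) :
    wp W (.assign x e) Q s := ⟨_, _, .assign s x e he, h⟩

theorem wp_store {a : ℕ} (hi : i.eval s < W) (he : e.eval s < W)
    (h : Q (s.setArr a (i.eval s) (e.eval s)) (i.cost + e.cost + 1)) :
    wp W (.store a i e) Q s := ⟨_, _, .store s a i e hi he, h⟩

theorem wp_print (he : e.eval s < W) (h : Q (s.emit (e.eval s)) (e.cost + 1)) :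
    wp W (.print e) Q s := ⟨_, _, .print s e he, h⟩

theorem wp_seq (h : wp W P (fun s₁ t₁ => wp W P' (fun s₂ t₂ => Q s₂ (t₁ + t₂)) s₁) s) :
    wp W (.seq P P') Q s := by
  obtain ⟨t, s', hE, t', s'', hE', hQ⟩ := h
  exact ⟨_, _, .seq hE hE', hQ⟩

theorem wp_ite (h : e.eval s ≠ 0 → wp W P (fun s' t => Q s' (e.cost + 1 + t)) s)
    (h' : e.eval s = 0 → wp W P' (fun s' t => Q s' (e.cost + 1 + t)) s) :
    wp W (.ite e P P') Q s := by
  by_cases he : e.eval s = 0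
  · obtain ⟨t, s', hE, hQ⟩ := h' he
    exact ⟨_, _, .ite_false he hE, hQ⟩
  · obtain ⟨t, s', hE, hQ⟩ := h he
    exact ⟨_, _, .ite_true he hE, hQ⟩

/-- The rule for loops: an invariant `Inv` and a potential `Φ`, which pays for the running time
and so yields termination as well. -/
theorem wp_loop (Inv : State → Prop) (Φ : State → ℕ) (h0 : Inv s)
    (hstep : ∀ s', Frame (.loop e P) s s' → Inv s' → e.eval s' ≠ 0 →
      wp W P (fun s'' t => Inv s'' ∧ t + (e.cost + 1) + Φ s'' ≤ Φ s') s') :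
    wp W (.loop e P) (fun s' t => Inv s' ∧ Frame (.loop e P) s s' ∧ e.eval s' = 0 ∧
      t + Φ s' ≤ Φ s + (e.cost + 1)) s := by
  suffices H : ∀ m s', Φ s' = m → Frame (.loop e P) s s' → Inv s' →
      wp W (.loop e P) (fun s'' t => Inv s'' ∧ Frame (.loop e P) s s'' ∧ e.eval s'' = 0 ∧
        t + Φ s'' ≤ Φ s' + (e.cost + 1)) s' from H _ s rfl (Frame.refl _ _) h0
  intro m
  induction m using Nat.strong_induction_on with
  | _ m ih =>
    intro s' hm hF hI
    by_cases he : e.eval s' = 0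
    · exact ⟨_, _, .loop_false he, hI, hF, he, by omega⟩
    · obtain ⟨t, s₁, hE, hI₁, ht⟩ := hstep s' hF hI he
      have hF₁ : Frame (.loop e P) s s₁ := hF.trans (hE.frame.of_subset (by
        simp [Program.writtenVars]) (by simp [Program.writtenArrs]) (by simp [Program.prints]))
      obtain ⟨t₂, s₂, hE₂, hI₂, hF₂, he₂, ht₂⟩ := ih (Φ s₁) (by omega) s₁ rfl hF₁ hI₁
      exact ⟨_, _, .loop_true he hE hE₂, hI₂, hF₂, he₂, by omega⟩

/-- The rule for bounded iteration with a potential `Φ`; the `k`-th iteration may also spend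
`T k` units of time that the potential does not pay for. -/
theorem wp_forLoop_potential {x y N : ℕ} (Inv : ℕ → State → Prop) (Φ : ℕ → State → ℕ)
    (T : ℕ → ℕ) (hx : x ∉ P.writtenVars) (hy : y ∉ P.writtenVars) (hxy : y ≠ x)
    (hN : s.var y = N) (hW : N < W) (h0 : Inv 0 (s.setVar x 0))
    (hstep : ∀ k s', k < N → Frame (.forLoop x y P) s s' → s'.var x = k → Inv k s' →
      wp W P (fun s'' t => Inv (k + 1) (s''.setVar x (k + 1)) ∧
        t + Φ (k + 1) (s''.setVar x (k + 1)) ≤ Φ k s' + T k) s') :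
    wp W (.forLoop x y P) (fun s' t => Inv N s' ∧ Frame (.forLoop x y P) s s' ∧
      t + Φ N s' ≤ Φ 0 (s.setVar x 0) + ∑ k ∈ Finset.range N, (T k + 8) + 6) s := by
  refine wp_mono (Q := fun s' t => Inv N s' ∧
      t + Φ N s' ≤ Φ 0 (s.setVar x 0) + ∑ k ∈ Finset.range N, (T k + 8) + 6) ?_
    fun s' t hF h => ⟨h.1, hF, h.2⟩
  have hfy : ∀ s', Frame (.forLoop x y P) s s' → s'.var y = N := fun s' hF => by
    rw [hF.var y, hN]
    simp [Program.forLoop, Program.writtenVars, hy, hxy]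
  refine wp_seq (wp_assign (by simp; omega) ?_)
  simp only [Expr.eval_zero, Expr.cost_zero]
  have hF0 : Frame (.forLoop x y P) s (s.setVar x 0) :=
    ⟨fun z hz => by
      have : z ≠ x := by rintro rfl; simp [Program.forLoop, Program.writtenVars] at hz
      simp [this], fun _ _ => rfl, fun _ => rfl⟩
  refine wp_mono (wp_loop (fun s' => s'.var x ≤ N ∧ Inv (s'.var x) s')
    (fun s' => Φ (s'.var x) s' + ∑ k ∈ Finset.Ico (s'.var x) N, (T k + 8))
    (by simpa using h0) ?_) ?_
  · rintro s' hF ⟨hk, hI⟩ he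
    have hF' : Frame (.forLoop x y P) s s' := hF0.trans (hF.of_subset
      (by intro z; simp [Program.forLoop, Program.writtenVars]; tauto)
      (by simp [Program.forLoop, Program.writtenArrs])
      (by simp [Program.forLoop, Program.prints]))
    have hk' : s'.var x < N := by
      simp [hfy s' hF'] at he; exact he
    refine wp_seq (wp_mono (hstep _ s' hk' hF' rfl hI) ?_)
    rintro s₁ t₁ hF₁ ⟨hI₁, ht₁⟩
    have hx₁ : s₁.var x = s'.var x := hF₁.var x hx
    refine wp_assign (by simp [hx₁]; omega) ?_
    simp only [Expr.eval_add, Expr.eval_var, Expr.eval_one, hx₁, State.setVar_var, if_true,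
      Expr.cost_lt, Expr.cost_var, Expr.cost_add, Expr.cost_one]
    refine ⟨⟨hk', hI₁⟩, ?_⟩
    rw [Finset.sum_eq_sum_Ico_succ_bot hk']
    omega
  · rintro s' t hF ⟨⟨hk, hI⟩, -, he, ht⟩
    have hF' : Frame (.forLoop x y P) s s' := hF0.trans (hF.of_subset
      (by intro z; simp [Program.forLoop, Program.writtenVars]; tauto)
      (by simp [Program.forLoop, Program.writtenArrs])
      (by simp [Program.forLoop, Program.prints]))
    have hk' : s'.var x = N := by
      simp [hfy s' hF'] at he; omega
    rw [hk'] at hI ht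
    refine ⟨hI, ?_⟩
    simp only [Finset.Ico_self, Finset.sum_empty, State.setVar_var, if_true,
      Finset.range_eq_Ico, Expr.cost_lt, Expr.cost_var] at ht ⊢
    omega

/-- The rule for bounded iteration with a bound `T k` on the time of the `k`-th iteration. -/
theorem wp_forLoop {x y N : ℕ} (Inv : ℕ → State → Prop) (T : ℕ → ℕ)
    (hx : x ∉ P.writtenVars) (hy : y ∉ P.writtenVars) (hxy : y ≠ x)
    (hN : s.var y = N) (hW : N < W) (h0 : Inv 0 (s.setVar x 0))
    (hstep : ∀ k s', k < N → Frame (.forLoop x y P) s s' → s'.var x = k → Inv k s' →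
      wp W P (fun s'' t => Inv (k + 1) (s''.setVar x (k + 1)) ∧ t ≤ T k) s') :
    wp W (.forLoop x y P) (fun s' t => Inv N s' ∧ Frame (.forLoop x y P) s s' ∧
      t ≤ ∑ k ∈ Finset.range N, (T k + 8) + 6) s := by
  refine wp_mono (wp_forLoop_potential Inv (fun _ _ => 0) T hx hy hxy hN hW h0 ?_) ?_
  · intro k s' hk hF hxk hI
    exact wp_mono (hstep k s' hk hF hxk hI) fun s'' t _ h => ⟨h.1, by simpa using h.2⟩
  · rintro s' t _ ⟨hI, hF, ht⟩
    exact ⟨hI, hF, by simpa using ht⟩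

/-- The rule for bounded iteration with a uniform bound on the time of one iteration. -/
theorem wp_forLoop_const {x y N : ℕ} (Inv : ℕ → State → Prop) (T : ℕ)
    (hx : x ∉ P.writtenVars) (hy : y ∉ P.writtenVars) (hxy : y ≠ x)
    (hN : s.var y = N) (hW : N < W) (h0 : Inv 0 (s.setVar x 0))
    (hstep : ∀ k s', k < N → Frame (.forLoop x y P) s s' → s'.var x = k → Inv k s' →
      wp W P (fun s'' t => Inv (k + 1) (s''.setVar x (k + 1)) ∧ t ≤ T) s') :
    wp W (.forLoop x y P) (fun s' t => Inv N s' ∧ Frame (.forLoop x y P) s s' ∧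
      t ≤ N * (T + 8) + 6) s := by
  refine wp_mono (wp_forLoop Inv (fun _ => T) hx hy hxy hN hW h0 hstep) ?_
  rintro s' t _ ⟨hI, hF, ht⟩
  exact ⟨hI, hF, by simpa using ht⟩

end RAM

/-! ### Comparison of two stable partitions -/

namespace SRInstance

variable {n : ℕ} (I : SRInstance n)

/-- The position of `j` in the preference list of `i`, as a natural number. -/
def rk (i j : Fin n) : ℕ := (I.rank i j).val

theorem rk_lt (i j : Fin n) : I.rk i j < n := (I.rank i j).isLt

variable {I}

theorem rk_inj {i j k : Fin n} : I.rk i j = I.rk i k ↔ j = k := by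
  simp [rk, Fin.val_inj]

theorem rk_self (i : Fin n) : I.rk i i = n - 1 := by
  have hn : 0 < n := i.pos
  obtain ⟨j, hj⟩ := (I.rank i).surjective ⟨n - 1, by omega⟩
  have h := I.self_last i j
  rw [hj, Fin.le_def] at h
  have := I.rk_lt i i
  simp only [rk] at *
  omega

theorem rk_le_self (i j : Fin n) : I.rk i j ≤ I.rk i i := by
  have := I.rk_lt i j
  rw [rk_self]; omega

theorem rk_lt_self {i j : Fin n} (h : j ≠ i) : I.rk i j < I.rk i i :=
  lt_of_le_of_ne (rk_le_self i j) fun h' => h (rk_inj.1 h')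

/-- A stable partition in terms of positions. In the second condition the two agents need not be
distinct, because every agent is in the last place of its own list. -/
theorem isStablePartition_iff {p : Equiv.Perm (Fin n)} :
    I.IsStablePartition p ↔ (∀ i, I.rk i (p i) ≤ I.rk i (p⁻¹ i)) ∧
      ∀ i j, I.rk i j < I.rk i (p⁻¹ i) → I.rk j (p⁻¹ j) ≤ I.rk j i := by
  unfold IsStablePartition Prefers
  refine and_congr (forall_congr' fun i => ?_) ?_
  · rw [le_iff_lt_or_eq, rk_inj, or_comm]; rfl
  · push Not
    constructor
    · intro h i j hij
      by_cases hne : i = j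
      · subst hne
        exact absurd hij (not_lt.2 (rk_le_self _ _))
      · exact not_lt.1 fun h' => absurd (show I.rank j i < I.rank j (p⁻¹ j) from h')
          (not_lt.2 (h i j hne hij))
    · intro h i j _ hij
      exact h i j hij

/-- The agents that prefer their predecessor in `q` to their predecessor in `p`. -/
def predImproves (I : SRInstance n) (p q : Equiv.Perm (Fin n)) : Set (Fin n) :=
  {c | I.rk c (q⁻¹ c) < I.rk c (p⁻¹ c)}

namespace IsStablePartition

variable {p q : Equiv.Perm (Fin n)}

theorem succ_le (hp : I.IsStablePartition p) (i : Fin n) : I.rk i (p i) ≤ I.rk i (p⁻¹ i) :=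
  (isStablePartition_iff.1 hp).1 i

theorem not_block (hp : I.IsStablePartition p) {i j : Fin n} (h : I.rk i j < I.rk i (p⁻¹ i)) :
    I.rk j (p⁻¹ j) ≤ I.rk j i :=
  (isStablePartition_iff.1 hp).2 i j h

/-- If `v` prefers its successor in `p` to the one in `q`, then stability of `q` makes that agent
prefer its predecessor in `q` to `v`. -/
theorem predImproves_of_succ_lt (hq : I.IsStablePartition q) {v : Fin n}
    (h : I.rk v (p v) < I.rk v (q v)) : p v ∈ I.predImproves p q := by
  have h1 := hq.not_block (lt_of_lt_of_le h (hq.succ_le v))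
  have hv : p⁻¹ (p v) = v := by simp
  show I.rk (p v) (q⁻¹ (p v)) < I.rk (p v) (p⁻¹ (p v))
  rw [hv]
  refine lt_of_le_of_ne h1 fun he => ?_
  rw [rk_inj, Equiv.Perm.inv_eq_iff_eq] at he
  rw [← he] at h
  exact lt_irrefl _ h

/-- If `c` prefers its predecessor `v` in `q` to its predecessor in `p`, then stability of `p`
makes `v` prefer both neighbours in `p` to `c`. -/
theorem of_mem_predImproves (hp : I.IsStablePartition p) {c : Fin n}
    (hc : c ∈ I.predImproves p q) : I.rk (q⁻¹ c) (p⁻¹ (q⁻¹ c)) ≤ I.rk (q⁻¹ c) c ∧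
      I.rk (q⁻¹ c) (p (q⁻¹ c)) < I.rk (q⁻¹ c) c := by
  have h1 := hp.not_block hc
  refine ⟨h1, lt_of_le_of_ne ((hp.succ_le _).trans h1) fun he => ?_⟩
  rw [rk_inj, ← Equiv.Perm.eq_inv_iff_eq] at he
  unfold predImproves at hc
  rw [Set.mem_ofPred_eq, he] at hc
  exact lt_irrefl _ hc

/-- From an agent of the set, one goes back in `q` and forward in `p`. -/
theorem mapsTo_predImproves (hp : I.IsStablePartition p) (hq : I.IsStablePartition q) :
    Set.MapsTo (fun c => p (q⁻¹ c)) (I.predImproves p q) (I.predImproves p q) := fun c hc =>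
  hq.predImproves_of_succ_lt (by simpa using (hp.of_mem_predImproves hc).2)

/-- An injective map of a finite set into itself is onto: this is what replaces the counting of
agents that gain and agents that lose. -/
theorem exists_preimage_predImproves (hp : I.IsStablePartition p) (hq : I.IsStablePartition q)
    {w : Fin n} (hw : w ∈ I.predImproves p q) : p⁻¹ w = q⁻¹ (q (p⁻¹ w)) ∧
      q (p⁻¹ w) ∈ I.predImproves p q := by
  have hs : Set.SurjOn (fun c => p (q⁻¹ c)) (I.predImproves p q) (I.predImproves p q) := by
    have hf : (I.predImproves p q).Finite := Set.toFinite _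
    exact (Set.Finite.injOn_iff_bijOn_of_mapsTo hf (hp.mapsTo_predImproves hq)).1
      (fun a _ b _ h => by simpa using h) |>.surjOn
  obtain ⟨c, hc, rfl⟩ := hs hw
  simpa using hc

/-- No agent's successor in `q` lies strictly between its successor and its predecessor
in `p`. -/
theorem pred_le_of_succ_lt (hp : I.IsStablePartition p) (hq : I.IsStablePartition q) {v : Fin n}
    (h : I.rk v (p v) < I.rk v (q v)) : I.rk v (p⁻¹ v) ≤ I.rk v (q v) := by
  have h1 := (hp.exists_preimage_predImproves hq (hq.predImproves_of_succ_lt h)).2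
  simpa using (hp.of_mem_predImproves h1).1

theorem mem_predImproves_iff (hp : I.IsStablePartition p) (hq : I.IsStablePartition q)
    {v : Fin n} : p v ∈ I.predImproves p q ↔ I.rk v (p v) < I.rk v (q v) := by
  refine ⟨fun h => ?_, hq.predImproves_of_succ_lt⟩
  have h1 := (hp.exists_preimage_predImproves hq h).2
  simpa using (hp.of_mem_predImproves h1).2

theorem mem_predImproves_iff' (hp : I.IsStablePartition p) (hq : I.IsStablePartition q)
    {v : Fin n} : q v ∈ I.predImproves p q ↔ I.rk v (p v) < I.rk v (q v) := by
  constructor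
  · intro h
    simpa using (hp.of_mem_predImproves h).2
  · intro h
    simpa using (hp.exists_preimage_predImproves hq (hq.predImproves_of_succ_lt h)).2

theorem not_succ_lt_of_mem_predImproves (hp : I.IsStablePartition p) (hq : I.IsStablePartition q)
    {v : Fin n} (hv : v ∈ I.predImproves p q) : ¬ I.rk v (p v) < I.rk v (q v) := fun h => by
  have h1 := hp.pred_le_of_succ_lt hq h
  have h2 := hq.succ_le v
  have h3 : I.rk v (q⁻¹ v) < I.rk v (p⁻¹ v) := hv
  omega

/-- All stable partitions have the same fixed points. -/
theorem eq_of_fixed (hp : I.IsStablePartition p) (hq : I.IsStablePartition q) {x : Fin n}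
    (hx : p x = x) : q x = x := by
  by_contra hne
  have hx' : p⁻¹ x = x := by rw [Equiv.Perm.inv_eq_iff_eq, hx]
  have h1 : x ∈ I.predImproves p q := by
    show I.rk x (q⁻¹ x) < I.rk x (p⁻¹ x)
    rw [hx']
    exact rk_lt_self fun h => hne (by rw [Equiv.Perm.inv_eq_iff_eq] at h; exact h.symm)
  have h2 := (hp.mem_predImproves_iff hq (v := x)).1 (by rwa [hx])
  rw [hx] at h2
  exact absurd h2 (not_lt.2 (rk_le_self _ _))

/-- Let `p` and `q` agree on the successor `p z` of `z`, but not on the predecessor. Following the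
cycle of `p` from `z` up to the next place where `q` departs from it shows that this is at `p z`
already, and that `q` exchanges `z` and `p z`. -/
theorem exchange_of_succ_eq (hp : I.IsStablePartition p) (hq : I.IsStablePartition q) {z : Fin n}
    (hc : ∀ k : ℕ, p ((p ^ k) z) ≠ p⁻¹ ((p ^ k) z)) (h1 : q z = p z) (h2 : q⁻¹ z ≠ p⁻¹ z) :
    q (p z) = z ∧ I.rk (p z) (p (p z)) < I.rk (p z) (q (p z)) := by
  classical
  have hex : ∃ k : ℕ, q ((p ^ k) z) ≠ p ((p ^ k) z) := by
    have hm : 0 < orderOf p := orderOf_pos p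
    refine ⟨orderOf p - 1, fun h => h2 ?_⟩
    have h3 : (p ^ (orderOf p - 1)) z = p⁻¹ z := by
      rw [Equiv.Perm.eq_inv_iff_eq, ← Equiv.Perm.mul_apply, ← pow_succ',
        Nat.sub_add_cancel hm, pow_orderOf_eq_one, Equiv.Perm.one_apply]
    have h4 : p (p⁻¹ z) = z := by simp
    rw [h3, h4] at h
    rw [Equiv.Perm.inv_eq_iff_eq, h]
  obtain ⟨k, hk, hmin⟩ : ∃ k : ℕ, q ((p ^ k) z) ≠ p ((p ^ k) z) ∧
      ∀ m < k, q ((p ^ m) z) = p ((p ^ m) z) :=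
    ⟨Nat.find hex, Nat.find_spec hex, fun m hm => not_not.1 (Nat.find_min hex hm)⟩
  have hk0 : k ≠ 0 := by rintro rfl; exact hk h1
  obtain ⟨m, rfl⟩ := Nat.exists_eq_succ_of_ne_zero hk0
  rw [Nat.succ_eq_add_one, pow_succ', Equiv.Perm.mul_apply] at hk
  set y := (p ^ m) z with hy
  have hqy : q y = p y := hmin m (Nat.lt_succ_self m)
  have hpw : p⁻¹ (p y) = y := by simp
  have hqw : q⁻¹ (p y) = y := by rw [← hqy]; simp
  have hcw : p (p y) ≠ y := by
    have := hc (m + 1)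
    rwa [pow_succ', Equiv.Perm.mul_apply, ← hy, hpw] at this
  rcases lt_trichotomy (I.rk (p y) (p (p y))) (I.rk (p y) (q (p y))) with h | h | h
  · have h3 := hp.pred_le_of_succ_lt hq h
    have h4 := hq.succ_le (p y)
    rw [hpw] at h3
    rw [hqw] at h4
    have h5 : q (p y) = y := rk_inj.1 (le_antisymm h4 h3)
    rcases Nat.eq_zero_or_pos m with rfl | hm
    · simp only [pow_zero, Equiv.Perm.one_apply] at hy
      rw [hy] at h5 h
      exact ⟨h5, h⟩
    · exfalso
      obtain ⟨l, rfl⟩ := Nat.exists_eq_succ_of_ne_zero hm.ne'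
      have h6 := hmin l (by omega)
      rw [Nat.succ_eq_add_one, pow_succ', Equiv.Perm.mul_apply] at hy
      rw [← hy] at h6
      have h7 : p y = (p ^ l) z := q.injective (h5.trans h6.symm)
      exact hcw (by rw [h7, ← hy])
  · exact absurd (rk_inj.1 h).symm hk
  · exfalso
    have h3 := hq.pred_le_of_succ_lt hp h
    have h4 := hp.succ_le (p y)
    rw [hqw] at h3
    rw [hpw] at h4
    exact hcw (rk_inj.1 (le_antisymm h4 h3))

/-- All stable partitions have the same odd cycles. -/
theorem eq_on_odd_cycle (hp : I.IsStablePartition p) (hq : I.IsStablePartition q) {x : Fin n}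
    {m : ℕ} (hm : Odd m) (hx : (p ^ m) x = x) : q x = p x := by
  by_cases hc : ∃ k : ℕ, p ((p ^ k) x) = p⁻¹ ((p ^ k) x)
  · -- An odd power and the second power fix a point of the cycle, so `p` fixes it.
    obtain ⟨k, hk⟩ := hc
    have h2 : (p ^ 2) x = x := by
      rw [Equiv.Perm.eq_inv_iff_eq, ← Equiv.Perm.mul_apply, ← Equiv.Perm.mul_apply,
        ← pow_two, ← pow_add, Nat.add_comm, pow_add, Equiv.Perm.mul_apply] at hk
      exact (p ^ k).injective hk
    have h1 : p x = x := by
      obtain ⟨j, rfl⟩ := hm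
      have h3 : ∀ j : ℕ, (p ^ (2 * j)) x = x := fun j => by
        induction j with
        | zero => simp
        | succ j ih => rw [Nat.mul_succ, pow_add, Equiv.Perm.mul_apply, h2, ih]
      rw [pow_succ', Equiv.Perm.mul_apply, h3] at hx
      exact hx
    rw [h1]
    exact hp.eq_of_fixed hq h1
  · push Not at hc
    have hcz : ∀ z, (∃ k : ℕ, z = (p ^ k) x) → ∀ k : ℕ, p ((p ^ k) z) ≠ p⁻¹ ((p ^ k) z) := by
      rintro _ ⟨l, rfl⟩ k
      rw [← Equiv.Perm.mul_apply (p ^ k), ← pow_add]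
      exact hc _
    -- An agent that is worse off with its `q`-predecessor cannot keep its successor.
    have hworse : ∀ z, (∃ k : ℕ, z = (p ^ k) x) → I.rk z (p⁻¹ z) < I.rk z (q⁻¹ z) →
        q z ≠ p z := by
      intro z hz h1 h2
      have h3 : q⁻¹ z ≠ p⁻¹ z := fun h => by rw [h] at h1; exact lt_irrefl _ h1
      have h4 := (hp.exchange_of_succ_eq hq (hcz z hz) h2 h3).1
      rw [← Equiv.Perm.eq_inv_iff_eq] at h4
      rw [← h4] at h1
      exact absurd (hp.succ_le z) (not_le.2 h1)
    have hstep : ∀ k : ℕ, (p ^ k) x ∈ I.predImproves p q →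
        (p ^ (k + 1)) x ∉ I.predImproves p q := by
      intro k hk h
      rw [pow_succ', Equiv.Perm.mul_apply, hp.mem_predImproves_iff hq] at h
      exact hp.not_succ_lt_of_mem_predImproves hq hk h
    have hq' : ∀ z, z ∈ I.predImproves q p ↔ I.rk z (p⁻¹ z) < I.rk z (q⁻¹ z) := fun z => Iff.rfl
    -- A gain passes on to the agent two steps ahead on the cycle.
    have hstep2 : ∀ k : ℕ, (p ^ k) x ∈ I.predImproves p q →
        (p ^ (k + 2)) x ∈ I.predImproves p q := by
      intro k hk
      have hz : ∃ l : ℕ, (p ^ k) x = (p ^ l) x := ⟨k, rfl⟩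
      have hz' : ∃ l : ℕ, p ((p ^ k) x) = (p ^ l) x :=
        ⟨k + 1, by rw [pow_succ', Equiv.Perm.mul_apply]⟩
      rw [pow_succ', pow_succ', Equiv.Perm.mul_apply, Equiv.Perm.mul_apply,
        hp.mem_predImproves_iff hq]
      set u := (p ^ k) x with hu
      rcases lt_trichotomy (I.rk u (p u)) (I.rk u (q u)) with h | h | h
      · exact absurd h (hp.not_succ_lt_of_mem_predImproves hq hk)
      · have h1 : q u = p u := (rk_inj.1 h).symm
        have h2 : q⁻¹ u ≠ p⁻¹ u := fun h => by
          have h3 : I.rk u (q⁻¹ u) < I.rk u (p⁻¹ u) := hk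
          rw [h] at h3
          exact lt_irrefl _ h3
        exact (hp.exchange_of_succ_eq hq (hcz u hz) h1 h2).2
      · have h1 : p u ∈ I.predImproves q p := (hq.mem_predImproves_iff' hp).2 h
        rcases lt_trichotomy (I.rk (p u) (p (p u))) (I.rk (p u) (q (p u))) with h2 | h2 | h2
        · exact h2
        · exact absurd (rk_inj.1 h2).symm (hworse _ hz' ((hq' _).1 h1))
        · exact absurd h2 (hq.not_succ_lt_of_mem_predImproves hp h1)
    -- On a cycle of odd length, steps by two also reach the agent one step ahead.
    have hnot : ∀ k : ℕ, (p ^ k) x ∉ I.predImproves p q := by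
      intro k hk
      obtain ⟨j, rfl⟩ := hm
      have h1 : ∀ i : ℕ, (p ^ (k + 2 * i)) x ∈ I.predImproves p q := fun i => by
        induction i with
        | zero => simpa using hk
        | succ i ih => exact hstep2 _ ih
      refine hstep k hk ?_
      have h2 := h1 (j + 1)
      have h3 : k + 2 * (j + 1) = k + 1 + (2 * j + 1) := by ring
      rwa [h3, pow_add, Equiv.Perm.mul_apply, hx] at h2
    have hS : ∀ k : ℕ, ¬ I.rk ((p ^ k) x) (p ((p ^ k) x)) < I.rk ((p ^ k) x) (q ((p ^ k) x)) := by
      intro k h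
      refine hnot (k + 1) ?_
      rw [pow_succ', Equiv.Perm.mul_apply]
      exact (hp.mem_predImproves_iff hq).2 h
    -- The agents of the cycle could now only be worse off with `q`.
    have hnot' : ∀ k : ℕ, (p ^ k) x ∉ I.predImproves q p := by
      intro k hk
      refine hworse _ ⟨k, rfl⟩ ((hq' _).1 hk)
        ((rk_inj (I := I) (i := (p ^ k) x)).1 (le_antisymm ?_ ?_))
      · exact not_lt.1 (hS k)
      · exact not_lt.1 (hq.not_succ_lt_of_mem_predImproves hp hk)
    have h1 := hS 0
    have h2 := hnot' 1
    rw [pow_one, hq.mem_predImproves_iff' hp] at h2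
    simp only [pow_zero, Equiv.Perm.one_apply] at h1
    exact rk_inj.1 (le_antisymm (not_lt.1 h1) (not_lt.1 h2))

end IsStablePartition

end SRInstance

/-! ### Splitting even cycles into transpositions -/

namespace SRInstance

variable {n : ℕ} {I : SRInstance n}

namespace IsStablePartition

variable {p q : Equiv.Perm (Fin n)}

open Classical in
/-- A cycle of even length may be replaced by the transpositions of every other pair of
neighbours: nobody gets a worse predecessor. -/
theorem exists_transposition (hp : I.IsStablePartition p) {x : Fin n}
    (hx : ∀ k : ℤ, (p ^ k) x = x → Even k) :
    ∃ q, I.IsStablePartition q ∧ q x = p x ∧ q (p x) = x := by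
  -- The agents at even distance from `x`; `q` swaps each of them with its successor.
  set A : Fin n → Prop := fun z => ∃ k : ℤ, (p ^ (2 * k)) x = z with hA
  have hpi : ∀ z, p (p⁻¹ z) = z := fun z => by simp
  have hip : ∀ z, p⁻¹ (p z) = z := fun z => by simp
  have hdown : ∀ z, A z → A (p⁻¹ (p⁻¹ z)) := by
    rintro _ ⟨k, rfl⟩
    refine ⟨k - 1, ?_⟩
    rw [← Equiv.Perm.mul_apply, ← Equiv.Perm.mul_apply]
    congr 1
    group
  have hodd : ∀ z, A z → ¬ A (p⁻¹ z) := by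
    rintro _ ⟨k, rfl⟩ ⟨l, hl⟩
    rw [← Equiv.Perm.mul_apply] at hl
    have h1 : (p ^ (2 * k - 1 - 2 * l)) x = x := by
      have h2 : p ^ (2 * k - 1 - 2 * l) = (p ^ (2 * l))⁻¹ * (p⁻¹ * p ^ (2 * k)) := by group
      rw [h2, Equiv.Perm.mul_apply, ← hl, Equiv.Perm.inv_eq_iff_eq]
    obtain ⟨j, hj⟩ := hx _ h1
    omega
  let q : Equiv.Perm (Fin n) :=
    { toFun := fun z => if A (p⁻¹ z) then p⁻¹ z else p z
      invFun := fun z => if A z then p z else p⁻¹ z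
      left_inv := fun z => by
        by_cases h : A (p⁻¹ z)
        · simp only [h, if_true, hpi]
        · have h' : ¬ A (p z) := fun h' => h (by have := hdown _ h'; rwa [hip] at this)
          simp only [h, if_false, h', hip]
      right_inv := fun z => by
        by_cases h : A z
        · simp only [h, if_true, hip]
        · have h' : ¬ A (p⁻¹ (p⁻¹ z)) := fun h' => h (by
            obtain ⟨k, hk⟩ := h'
            refine ⟨k + 1, ?_⟩
            have h2 : p ^ (2 * (k + 1)) = p * (p * p ^ (2 * k)) := by group
            rw [h2, Equiv.Perm.mul_apply, Equiv.Perm.mul_apply, hk, hpi, hpi])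
          simp only [h, if_false, h', hpi] }
  have hq : ∀ z, q z = if A (p⁻¹ z) then p⁻¹ z else p z := fun z => rfl
  have hqi : ∀ z, q⁻¹ z = if A z then p z else p⁻¹ z := fun z => rfl
  have hle : ∀ z, I.rk z (q⁻¹ z) ≤ I.rk z (p⁻¹ z) := by
    intro z
    rw [hqi]
    split_ifs
    · exact hp.succ_le z
    · exact le_rfl
  have hAx : A x := ⟨0, by simp⟩
  refine ⟨q, isStablePartition_iff.2 ⟨fun z => ?_, fun i j h => ?_⟩, ?_, ?_⟩
  · rw [hq, hqi]
    by_cases h : A z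
    · simp only [h, hodd z h, if_true, if_false, le_refl]
    · by_cases h' : A (p⁻¹ z)
      · simp only [h, h', if_true, if_false, le_refl]
      · simp only [h, h', if_false]
        exact hp.succ_le z
  · exact (hle j).trans (hp.not_block (lt_of_lt_of_le h (hle i)))
  · rw [hq, if_neg (hodd x hAx)]
  · rw [hq, hip, if_pos hAx]

end IsStablePartition

/-! ### Deciding whether given cycles are part of a stable partition -/

/-- `rankOfKey key` sorts the agents by the values of the injective function `key`. -/
noncomputable def rankOfKey (key : Fin n → ℕ) (hk : Function.Injective key) :
    Equiv.Perm (Fin n) :=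
  Equiv.ofBijective
    (fun j => ⟨(Finset.univ.filter fun j' => key j' < key j).card, by
      have h : (Finset.univ.filter fun j' => key j' < key j) ⊂ Finset.univ := by
        refine Finset.filter_ssubset.2 ⟨j, Finset.mem_univ _, lt_irrefl _⟩
      simpa using Finset.card_lt_card h⟩)
    (Finite.injective_iff_bijective.1 (by
      intro j k h
      have hlt : ∀ j k, key j < key k →
          (Finset.univ.filter fun j' => key j' < key j).card <
            (Finset.univ.filter fun j' => key j' < key k).card := by
        intro j k hjk
        refine Finset.card_lt_card ⟨fun a ha => ?_, fun hs => ?_⟩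
        · simp only [Finset.mem_filter, Finset.mem_univ, true_and] at ha ⊢
          omega
        · have := hs (Finset.mem_filter.2 ⟨Finset.mem_univ j, hjk⟩)
          simp at this
      simp only [Fin.mk.injEq] at h
      rcases lt_trichotomy (key j) (key k) with h' | h' | h'
      · have := hlt j k h'; omega
      · exact hk h'
      · have := hlt k j h'; omega))

theorem rankOfKey_val (key : Fin n → ℕ) (hk : Function.Injective key) (j : Fin n) :
    (rankOfKey key hk j).val = (Finset.univ.filter fun j' => key j' < key j).card := rfl

theorem rankOfKey_lt_iff (key : Fin n → ℕ) (hk : Function.Injective key) (j k : Fin n) :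
    (rankOfKey key hk j).val < (rankOfKey key hk k).val ↔ key j < key k := by
  have hmono : ∀ j k, key j ≤ key k →
      (rankOfKey key hk j).val ≤ (rankOfKey key hk k).val := by
    intro j k hjk
    rw [rankOfKey_val, rankOfKey_val]
    refine Finset.card_le_card fun a ha => ?_
    simp only [Finset.mem_filter, Finset.mem_univ, true_and] at ha ⊢
    omega
  constructor
  · intro h
    by_contra h'
    exact absurd (hmono k j (not_lt.1 h')) (not_le.2 h)
  · intro h
    refine lt_of_le_of_ne (hmono j k h.le) fun he => ?_
    have := (rankOfKey key hk).injective (Fin.val_injective he)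
    rw [this] at h
    exact lt_irrefl _ h

variable (I)

/-- The agent `u`, on a nontrivial cycle of `c`, prefers `i` to its predecessor. -/
def Courts (c : Equiv.Perm (Fin n)) (u i : Fin n) : Prop :=
  c u ≠ u ∧ I.rk u i < I.rk u (c⁻¹ u)

/-- `τ i` is the position in the list of `i` of the best `u < k` that courts `i`, and the last
position if there is none: in a stable partition that contains the nontrivial cycles of `c`,
the predecessor of `i` has to be at least that good. -/
def IsThreshold (c : Equiv.Perm (Fin n)) (k : ℕ) (τ : Fin n → ℕ) : Prop :=
  ∀ i, τ i ≤ n - 1 ∧ (∀ u : Fin n, u.val < k → I.Courts c u i → τ i ≤ I.rk i u) ∧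
    (τ i = n - 1 ∨ ∃ u : Fin n, u.val < k ∧ I.Courts c u i ∧ τ i = I.rk i u)

/-- The pairs that may be neighbours in a stable partition that contains the nontrivial cycles
of `c`: neighbours in such a cycle, or two agents outside that are above each other's
thresholds. -/
def Good (c : Equiv.Perm (Fin n)) (τ : Fin n → ℕ) (i j : Fin n) : Prop :=
  (c i ≠ i ∧ (c i = j ∨ c⁻¹ i = j)) ∨ (c i = i ∧ c j = j ∧ I.rk i j < τ i ∧ I.rk j i < τ j)

open Classical in
/-- The sort key of the instance in which every agent puts its good neighbours first. -/
noncomputable def goodKey (c : Equiv.Perm (Fin n)) (τ : Fin n → ℕ) (i j : Fin n) : ℕ :=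
  if I.Good c τ i j then I.rk i j else n + I.rk i j

variable {I} {c : Equiv.Perm (Fin n)} {τ : Fin n → ℕ}

theorem apply_inv_ne {c : Equiv.Perm (Fin n)} {i : Fin n} (h : c i ≠ i) : c (c⁻¹ i) ≠ c⁻¹ i := by
  have h1 : c (c⁻¹ i) = i := by simp
  rw [h1]
  intro h2
  rw [Equiv.Perm.eq_inv_iff_eq] at h2
  exact h h2

theorem Good.symm {i j : Fin n} (h : I.Good c τ i j) : I.Good c τ j i := by
  have hi : ∀ z, c⁻¹ (c z) = z := fun z => by simp
  have hi' : ∀ z, c (c⁻¹ z) = z := fun z => by simp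
  rcases h with ⟨h1, rfl | rfl⟩ | ⟨h1, h2, h3, h4⟩
  · exact Or.inl ⟨fun h => h1 (c.injective h), Or.inr (hi i)⟩
  · exact Or.inl ⟨apply_inv_ne h1, Or.inl (hi' i)⟩
  · exact Or.inr ⟨h2, h1, h4, h3⟩

theorem not_good_self (hτ : I.IsThreshold c n τ) (i : Fin n) : ¬ I.Good c τ i i := by
  rintro (⟨h1, h2 | h2⟩ | ⟨-, -, h3, -⟩)
  · exact h1 h2
  · rw [Equiv.Perm.inv_eq_iff_eq] at h2
    exact h1 h2.symm
  · have := (hτ i).1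
    rw [rk_self] at h3
    omega

theorem goodKey_injective (i : Fin n) : Function.Injective (I.goodKey c τ i) := by
  intro j k h
  have hj := I.rk_lt i j
  have hk := I.rk_lt i k
  unfold goodKey at h
  refine (rk_inj (I := I) (i := i)).1 ?_
  split_ifs at h <;> omega

theorem goodKey_le_self (hτ : I.IsThreshold c n τ) (i j : Fin n) :
    I.goodKey c τ i j ≤ I.goodKey c τ i i := by
  have h1 := not_good_self hτ i
  have h2 := rk_le_self (I := I) i j
  unfold goodKey
  rw [if_neg h1]
  split_ifs <;> omega

/-- The instance in which every agent moves its good neighbours to the front of its list. -/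
noncomputable def goodFirst (I : SRInstance n) (c : Equiv.Perm (Fin n)) (τ : Fin n → ℕ)
    (hτ : I.IsThreshold c n τ) : SRInstance n where
  rank i := rankOfKey (I.goodKey c τ i) (goodKey_injective i)
  self_last i j := by
    rw [Fin.le_def, ← not_lt, rankOfKey_lt_iff, not_lt]
    exact goodKey_le_self hτ i j

theorem goodFirst_rk_lt (hτ : I.IsThreshold c n τ) {i j k : Fin n} :
    (I.goodFirst c τ hτ).rk i j < (I.goodFirst c τ hτ).rk i k ↔
      I.goodKey c τ i j < I.goodKey c τ i k :=
  rankOfKey_lt_iff _ (goodKey_injective i) _ _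

theorem goodFirst_rk_le (hτ : I.IsThreshold c n τ) {i j k : Fin n} :
    (I.goodFirst c τ hτ).rk i j ≤ (I.goodFirst c τ hτ).rk i k ↔
      I.goodKey c τ i j ≤ I.goodKey c τ i k := by
  rw [← not_lt, goodFirst_rk_lt, not_lt]

/-- The good neighbours are an initial segment of the new list, in the original order. -/
theorem Good.of_key_le {i j k : Fin n} (h : I.Good c τ i k)
    (hle : I.goodKey c τ i j ≤ I.goodKey c τ i k) : I.Good c τ i j ∧ I.rk i j ≤ I.rk i k := by
  by_contra h'
  have hk := I.rk_lt i k
  unfold goodKey at hle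
  rw [if_pos h] at hle
  split_ifs at hle with h1
  · exact h' ⟨h1, hle⟩
  · omega

theorem goodKey_le_of_rk_le {i j k : Fin n} (h : I.rk i j ≤ I.rk i k) (hj : I.Good c τ i j) :
    I.goodKey c τ i j ≤ I.goodKey c τ i k := by
  have hk := I.rk_lt i j
  unfold goodKey
  rw [if_pos hj]
  split_ifs <;> omega

/-- What has to be checked for a stable partition `p` of the instance `goodFirst` in order to
decide whether the nontrivial cycles of `c` are part of a stable partition. -/
def Compatible (I : SRInstance n) (c : Equiv.Perm (Fin n)) (τ : Fin n → ℕ)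
    (p : Equiv.Perm (Fin n)) (i : Fin n) : Prop :=
  (c i ≠ i → I.rk i (c⁻¹ i) ≤ τ i ∧ I.rk i (c i) ≤ I.rk i (c⁻¹ i)) ∧
    (c i = i → I.Good c τ i (p⁻¹ i) ∨ τ i = n - 1)

open Classical in
/-- The good edges of `p` off the given cycles fill whole cycles of `p`. Together with the given
cycles, and with fixed points at the remaining agents, they form a stable partition. -/
theorem exists_stable_of_compatible (hτ : I.IsThreshold c n τ) {p : Equiv.Perm (Fin n)}
    (hp : (I.goodFirst c τ hτ).IsStablePartition p) (hc : ∀ i, I.Compatible c τ p i) :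
    ∃ q, I.IsStablePartition q ∧ ∀ i, c i ≠ i → q i = c i := by
  have hpi : ∀ z, p (p⁻¹ z) = z := fun z => by simp
  have hip : ∀ z, p⁻¹ (p z) = z := fun z => by simp
  have hci : ∀ z, c (c⁻¹ z) = z := fun z => by simp
  have hic : ∀ z, c⁻¹ (c z) = z := fun z => by simp
  have hfwd : ∀ z, I.Good c τ z (p⁻¹ z) → I.Good c τ z (p z) ∧ I.rk z (p z) ≤ I.rk z (p⁻¹ z) :=
    fun z hz => hz.of_key_le ((goodFirst_rk_le hτ).1 (hp.succ_le z))
  -- Good edges fill whole cycles of `p`.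
  have hbwd : ∀ z, I.Good c τ z (p z) → I.Good c τ z (p⁻¹ z) := by
    have hs : Set.SurjOn p {z | I.Good c τ z (p⁻¹ z)} {z | I.Good c τ z (p⁻¹ z)} := by
      refine ((Set.Finite.injOn_iff_bijOn_of_mapsTo (Set.toFinite _) fun z hz => ?_).1
        p.injective.injOn).surjOn
      have := (hfwd z hz).1.symm
      show I.Good c τ (p z) (p⁻¹ (p z))
      rwa [hip]
    intro z hz
    obtain ⟨y, hy, hyz⟩ := hs (show p z ∈ {z | I.Good c τ z (p⁻¹ z)} by
      show I.Good c τ (p z) (p⁻¹ (p z))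
      rw [hip]; exact hz.symm)
    rw [p.injective hyz] at hy
    exact hy
  have hout : ∀ i j, c i = i → I.Good c τ i j → c j = j ∧ I.rk i j < τ i := by
    rintro i j hi (⟨h, -⟩ | ⟨-, h1, h2, -⟩)
    · exact absurd hi h
    · exact ⟨h1, h2⟩
  let q : Equiv.Perm (Fin n) :=
    { toFun := fun z => if c z = z then (if I.Good c τ z (p z) then p z else z) else c z
      invFun := fun z => if c z = z then (if I.Good c τ z (p⁻¹ z) then p⁻¹ z else z) else c⁻¹ z
      left_inv := fun z => by
        by_cases h : c z = z
        · by_cases h' : I.Good c τ z (p z)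
          · have h1 := hout _ _ h h'
            simp only [h, h', if_true, h1.1, hip]
            rw [if_pos h'.symm]
          · have h1 : ¬ I.Good c τ z (p⁻¹ z) := fun h1 => h' (hfwd z h1).1
            simp only [h, h', if_true, if_false, h1]
        · have h1 : c (c z) ≠ c z := fun h1 => h (c.injective h1)
          simp only [h, h1, if_false, hic]
      right_inv := fun z => by
        by_cases h : c z = z
        · by_cases h' : I.Good c τ z (p⁻¹ z)
          · have h1 := hout _ _ h h'
            simp only [h, h', if_true, h1.1, hpi]
            rw [if_pos h'.symm]
          · have h1 : ¬ I.Good c τ z (p z) := fun h1 => h' (hbwd z h1)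
            simp only [h, h', if_true, if_false, h1]
        · have h1 := apply_inv_ne h
          rw [hci] at h1
          simp only [h, if_false, hci, h1] }
  have hq : ∀ z, q z = if c z = z then (if I.Good c τ z (p z) then p z else z) else c z :=
    fun z => rfl
  have hqi : ∀ z, q⁻¹ z = if c z = z then (if I.Good c τ z (p⁻¹ z) then p⁻¹ z else z) else c⁻¹ z :=
    fun z => rfl
  have hleτ : ∀ i, I.rk i (q⁻¹ i) ≤ τ i := by
    intro i
    rw [hqi]
    split_ifs with h h'
    · exact (hout i _ h h').2.le
    · rcases (hc i).2 h with h1 | h1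
      · exact absurd h1 h'
      · rw [rk_self, h1]
    · exact ((hc i).1 h).1
  refine ⟨q, isStablePartition_iff.2 ⟨fun z => ?_, fun i j hij => ?_⟩, fun i hi => ?_⟩
  · rw [hq, hqi]
    by_cases h : c z = z
    · by_cases h' : I.Good c τ z (p⁻¹ z)
      · have h1 := hfwd z h'
        simp only [h, h', h1.1, if_true, h1.2]
      · simp only [h, h', if_true, if_false]
        split_ifs
        · exact rk_le_self _ _
        · exact le_rfl
    · simp only [h, if_false]
      exact ((hc z).1 h).2
  · by_contra hji
    rw [not_le] at hji
    have hτi := hleτ i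
    have hτj := hleτ j
    by_cases hi : c i = i
    · by_cases hj : c j = j
      · have hg : I.Good c τ i j := Or.inr ⟨hi, hj, by omega, by omega⟩
        -- Both agents also prefer each other in the instance `goodFirst`.
        have key : ∀ i j, c i = i → I.Good c τ i j → I.rk i j < I.rk i (q⁻¹ i) →
            (I.goodFirst c τ hτ).rk i j < (I.goodFirst c τ hτ).rk i (p⁻¹ i) := by
          intro i j hi hg h
          rw [goodFirst_rk_lt, ← not_le]
          intro hle
          have h1 := hg.of_key_le hle
          rw [hqi, if_pos hi, if_pos h1.1] at h
          omega
        exact absurd (hp.not_block (key i j hi hg hij)) (not_le.2 (key j i hj hg.symm hji))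
      · have h1 := (hτ i).2.1 j j.isLt ⟨hj, by rwa [hqi, if_neg hj] at hji⟩
        omega
    · have h1 := (hτ j).2.1 i i.isLt ⟨hi, by rwa [hqi, if_neg hi] at hij⟩
      omega
  · rw [hq, if_neg hi]

/-- A stable partition that contains the nontrivial cycles of `c` is also stable in the instance
`goodFirst`, since all its edges are good. -/
theorem IsStablePartition.goodFirst_of_extends (hτ : I.IsThreshold c n τ)
    {q : Equiv.Perm (Fin n)} (hq : I.IsStablePartition q) (hqc : ∀ i, c i ≠ i → q i = c i) :
    (∀ i, q i ≠ i → I.Good c τ i (q⁻¹ i)) ∧ (I.goodFirst c τ hτ).IsStablePartition q := by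
  have hqi : ∀ z, q (q⁻¹ z) = z := fun z => by simp
  have hci : ∀ z, c (c⁻¹ z) = z := fun z => by simp
  have hqc' : ∀ i, c i ≠ i → q⁻¹ i = c⁻¹ i := fun i hi => by
    rw [Equiv.Perm.inv_eq_iff_eq, hqc _ (apply_inv_ne hi), hci]
  have hcq : ∀ i, c i = i → c (q⁻¹ i) = q⁻¹ i := fun i hi => by
    by_contra h
    have h1 := hqc _ h
    rw [hqi] at h1
    have h2 := h1.symm.trans hi.symm
    rw [c.injective h2] at h
    exact h hi
  have hτ' : ∀ i, c i = i → τ i = n - 1 ∨ I.rk i (q⁻¹ i) < τ i := by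
    intro i hi
    rcases (hτ i).2.2 with h | ⟨u, -, hu, h⟩
    · exact Or.inl h
    · right
      have h1 : I.rk u i < I.rk u (q⁻¹ u) := by rw [hqc' u hu.1]; exact hu.2
      rw [h]
      refine lt_of_le_of_ne (hq.not_block h1) fun he => ?_
      rw [rk_inj] at he
      have := hcq i hi
      rw [he] at this
      exact hu.1 this
  have hlt : ∀ i, c i = i → q i ≠ i → I.rk i (q⁻¹ i) < τ i := by
    intro i hi hqi'
    rcases hτ' i hi with h | h
    · rw [h, ← rk_self (I := I) i]
      refine rk_lt_self fun h1 => hqi' ?_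
      rw [Equiv.Perm.inv_eq_iff_eq] at h1
      exact h1.symm
    · exact h
  have hgood : ∀ i, q i ≠ i → I.Good c τ i (q⁻¹ i) := by
    intro i hi
    by_cases hi' : c i = i
    · refine Or.inr ⟨hi', hcq i hi', hlt i hi' hi, ?_⟩
      have h1 : q (q⁻¹ i) ≠ q⁻¹ i := apply_inv_ne hi
      have h2 := hlt _ (hcq i hi') h1
      have h3 := hq.succ_le (q⁻¹ i)
      rw [hqi] at h3
      omega
    · exact Or.inl ⟨hi', Or.inr (hqc' i hi').symm⟩
  have hgood' : ∀ i, q i ≠ i → I.Good c τ i (q i) := by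
    intro i hi
    have h1 := hgood (q i) fun h => hi (q.injective h)
    have h2 : q⁻¹ (q i) = i := by simp
    rw [h2] at h1
    exact h1.symm
  refine ⟨hgood, isStablePartition_iff.2 ⟨fun i => ?_, fun i j hij => ?_⟩⟩
  · rw [goodFirst_rk_le]
    by_cases h : q i = i
    · have h1 : q⁻¹ i = i := by rw [Equiv.Perm.inv_eq_iff_eq, h]
      rw [h, h1]
    · exact goodKey_le_of_rk_le (hq.succ_le i) (hgood' i h)
  · by_contra hji
    rw [not_le] at hji
    rw [goodFirst_rk_lt] at hij hji
    have key : ∀ i j, I.goodKey c τ i j < I.goodKey c τ i (q⁻¹ i) →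
        I.rk i j < I.rk i (q⁻¹ i) := by
      intro i j h
      by_cases hi : q i = i
      · have h1 : q⁻¹ i = i := by rw [Equiv.Perm.inv_eq_iff_eq, hi]
        rw [h1] at h ⊢
        exact rk_lt_self fun h2 => by rw [h2] at h; exact lt_irrefl _ h
      · have h1 := (hgood i hi).of_key_le h.le
        refine lt_of_le_of_ne h1.2 fun h2 => ?_
        rw [(rk_inj (I := I) (i := i)).1 h2] at h
        exact lt_irrefl _ h
    exact absurd (hq.not_block (key i j hij)) (not_le.2 (key j i hji))

/-- Whichever stable partition `p` of the instance `goodFirst` is found, it decides whether the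
nontrivial cycles of `c` are part of a stable partition of `I`. -/
theorem compatible_iff (hτ : I.IsThreshold c n τ) {p : Equiv.Perm (Fin n)}
    (hp : (I.goodFirst c τ hτ).IsStablePartition p) :
    (∀ i, I.Compatible c τ p i) ↔ ∃ q, I.IsStablePartition q ∧ ∀ i, c i ≠ i → q i = c i := by
  refine ⟨exists_stable_of_compatible hτ hp, ?_⟩
  rintro ⟨q, hq, hqc⟩ i
  have hci : ∀ z, c (c⁻¹ z) = z := fun z => by simp
  have hqc' : ∀ i, c i ≠ i → q⁻¹ i = c⁻¹ i := fun i hi => by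
    rw [Equiv.Perm.inv_eq_iff_eq, hqc _ (apply_inv_ne hi), hci]
  obtain ⟨hgood, hqJ⟩ := hq.goodFirst_of_extends hτ hqc
  refine ⟨fun hi => ⟨?_, ?_⟩, fun hi => ?_⟩
  · rw [← hqc' i hi]
    rcases (hτ i).2.2 with h | ⟨u, -, hu, h⟩
    · rw [h, ← rk_self (I := I) i]
      exact rk_le_self _ _
    · rw [h]
      refine hq.not_block ?_
      rw [hqc' u hu.1]
      exact hu.2
  · rw [← hqc' i hi, ← hqc i hi]
    exact hq.succ_le i
  · by_contra hcon
    push Not at hcon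
    obtain ⟨hbad, hlast⟩ := hcon
    -- The agent `i` is courted, so it is not fixed by `q`.
    have hqi : q i ≠ i := by
      rcases (hτ i).2.2 with h | ⟨u, -, hu, h⟩
      · exact absurd h hlast
      · intro h1
        have h2 : q⁻¹ i = i := by rw [Equiv.Perm.inv_eq_iff_eq, h1]
        have h3 : I.rk i (q⁻¹ i) ≤ I.rk i u := hq.not_block (by rw [hqc' u hu.1]; exact hu.2)
        rw [h2] at h3
        have h4 : u ≠ i := by rintro rfl; exact hu.1 hi
        exact absurd (rk_lt_self (I := I) h4) (not_lt.2 h3)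
    have h1 : i ∈ (I.goodFirst c τ hτ).predImproves p q := by
      show (I.goodFirst c τ hτ).rk i (q⁻¹ i) < (I.goodFirst c τ hτ).rk i (p⁻¹ i)
      rw [← not_le, goodFirst_rk_le]
      exact fun h => hbad ((hgood i hqi).of_key_le h).1
    have h2 := (hp.exists_preimage_predImproves hqJ h1).2
    have h3 := (hp.mem_predImproves_iff hqJ (v := p⁻¹ i)).1 (by
      have : p (p⁻¹ i) = i := by simp
      rwa [this])
    have hpi : p (p⁻¹ i) = i := by simp
    have hiq : q⁻¹ (q (p⁻¹ i)) = p⁻¹ i := by simp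
    rw [hpi, goodFirst_rk_lt] at h3
    have h4 : q (p⁻¹ i) ≠ p⁻¹ i := by
      intro h
      rw [h] at h2
      have h5 : (I.goodFirst c τ hτ).rk (p⁻¹ i) (q⁻¹ (p⁻¹ i)) <
        (I.goodFirst c τ hτ).rk (p⁻¹ i) (p⁻¹ (p⁻¹ i)) := h2
      have h6 : q⁻¹ (p⁻¹ i) = p⁻¹ i := by rw [Equiv.Perm.inv_eq_iff_eq, h]
      rw [h6] at h5
      exact absurd h5 (not_lt.2 (rk_le_self _ _))
    have h5 := hgood (q (p⁻¹ i)) fun h => h4 (q.injective h)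
    rw [hiq] at h5
    exact hbad (h5.symm.of_key_le h3.le).1.symm

end SRInstance

/-! ### Prestable permutations and rotations -/

namespace SRInstance

variable {n : ℕ} (I : SRInstance n)

/-- A permutation `f` is prestable if every agent `i` weakly prefers `f i` to `f⁻¹ i`, and every
agent `j` that `i` prefers to `f i` prefers `f⁻¹ j` to `i`. These permutations describe the
reduced preference tables of Irving's algorithm: `f i` is the first and `f⁻¹ i` the last agent in
the reduced list of `i`. -/
structure IsPrestable (f : Equiv.Perm (Fin n)) : Prop where
  succ_le : ∀ i, I.rk i (f i) ≤ I.rk i (f⁻¹ i)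
  above : ∀ i j, I.rk i j < I.rk i (f i) → I.rk j (f⁻¹ j) < I.rk j i

/-- `i` and `j` are in each other's reduced lists. -/
def InTable (f : Equiv.Perm (Fin n)) (i j : Fin n) : Prop :=
  I.rk i j ≤ I.rk i (f⁻¹ i) ∧ I.rk j i ≤ I.rk j (f⁻¹ j)

/-- `y` is the second agent in the reduced list of `x`. -/
def IsSecond (f : Equiv.Perm (Fin n)) (x y : Fin n) : Prop :=
  I.InTable f x y ∧ y ≠ f x ∧ ∀ j, I.InTable f x j → j ≠ f x → I.rk x y ≤ I.rk x j

/-- The reduced list of `x` contains an agent strictly between the first and the last. -/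
def IsLong (f : Equiv.Perm (Fin n)) (x : Fin n) : Prop :=
  ∃ j, I.rk x (f x) < I.rk x j ∧ I.rk x j < I.rk x (f⁻¹ x) ∧ I.rk j x ≤ I.rk j (f⁻¹ j)

variable {I} {f σ : Equiv.Perm (Fin n)}

theorem InTable.symm {i j : Fin n} (h : I.InTable f i j) : I.InTable f j i := ⟨h.2, h.1⟩

theorem IsPrestable.first_le (hf : I.IsPrestable f) {i j : Fin n} (h : I.InTable f i j) :
    I.rk i (f i) ≤ I.rk i j := by
  by_contra h'
  have := hf.above i j (not_le.1 h')
  exact absurd h.2 (not_le.2 this)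

theorem IsPrestable.first_lt_second (hf : I.IsPrestable f) {x y : Fin n} (h : I.IsSecond f x y) :
    I.rk x (f x) < I.rk x y :=
  lt_of_le_of_ne (hf.first_le h.1) fun he => h.2.1 (rk_inj.1 he).symm

/-- A prestable permutation whose reduced lists have at most two entries is a stable
partition. -/
theorem IsPrestable.isStablePartition (hf : I.IsPrestable f) (h : ∀ x, ¬ I.IsLong f x) :
    I.IsStablePartition f := by
  refine isStablePartition_iff.2 ⟨hf.succ_le, fun i j hij => ?_⟩
  by_contra hji
  rw [not_le] at hji
  have h1 : I.rk i (f i) ≤ I.rk i j := hf.first_le ⟨hij.le, hji.le⟩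
  rcases h1.lt_or_eq with h2 | h2
  · exact h i ⟨j, h2, hij, hji.le⟩
  · have h3 : f⁻¹ j = i := by
      rw [Equiv.Perm.inv_eq_iff_eq]
      exact (rk_inj.1 h2).symm
    rw [h3] at hji
    exact lt_irrefl _ hji

/-- `σ` moves along rotations: if it moves `x`, then the second agent in the list of `x` is the
first agent in the list of `σ x`. -/
def IsRotation (I : SRInstance n) (f σ : Equiv.Perm (Fin n)) : Prop :=
  ∀ x, σ x ≠ x → I.IsSecond f x (f (σ x))

/-- The obstruction to the elimination of `σ` at `x`: the list of `f x` consists of its first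
agent and `x`, so that the elimination cuts the list of `x` back to `f x`. -/
def IsBad (f σ : Equiv.Perm (Fin n)) (x : Fin n) : Prop :=
  σ (f x) ≠ f x ∧ f (σ (f x)) = x

theorem mul_inv_apply' (f σ : Equiv.Perm (Fin n)) (y : Fin n) :
    (f * σ)⁻¹ y = σ⁻¹ (f⁻¹ y) := by
  rw [mul_inv_rev, Equiv.Perm.mul_apply]

theorem IsRotation.second_inv (hσ : I.IsRotation f σ) {y : Fin n} (h : σ (f⁻¹ y) ≠ f⁻¹ y) :
    I.IsSecond f (σ⁻¹ (f⁻¹ y)) y := by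
  have h1 := hσ _ (apply_inv_ne h)
  have h2 : σ (σ⁻¹ (f⁻¹ y)) = f⁻¹ y := by simp
  have h3 : f (f⁻¹ y) = y := by simp
  rwa [h2, h3] at h1

theorem inv_fixed {y : Fin n} (h : σ y = y) : σ⁻¹ y = y := by
  rw [Equiv.Perm.inv_eq_iff_eq, h]

/-- The elimination of a rotation shortens lists only: the last agent gets no worse. -/
theorem IsRotation.last_le (hσ : I.IsRotation f σ) (y : Fin n) :
    I.rk y ((f * σ)⁻¹ y) ≤ I.rk y (f⁻¹ y) := by
  rw [mul_inv_apply']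
  by_cases h : σ (f⁻¹ y) = f⁻¹ y
  · rw [inv_fixed h]
  · exact (hσ.second_inv h).1.2

/-- The elimination of a rotation shortens lists only: the first agent gets no better. -/
theorem IsRotation.le_first (hf : I.IsPrestable f) (hσ : I.IsRotation f σ) (x : Fin n) :
    I.rk x (f x) ≤ I.rk x ((f * σ) x) := by
  rw [Equiv.Perm.mul_apply]
  by_cases h : σ x = x
  · rw [h]
  · exact (hf.first_lt_second (hσ x h)).le

theorem IsRotation.inTable (hσ : I.IsRotation f σ) {i j : Fin n}
    (h : I.InTable (f * σ) i j) : I.InTable f i j :=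
  ⟨h.1.trans (hσ.last_le i), h.2.trans (hσ.last_le j)⟩

theorem IsRotation.isLong (hf : I.IsPrestable f) (hσ : I.IsRotation f σ) {x : Fin n}
    (h : I.IsLong (f * σ) x) : I.IsLong f x := by
  obtain ⟨j, h1, h2, h3⟩ := h
  exact ⟨j, lt_of_le_of_lt (hσ.le_first hf x) h1, lt_of_lt_of_le h2 (hσ.last_le x),
    h3.trans (hσ.last_le j)⟩

/-- Unless there is an obstruction at `x`, the second agent in the list of `x` stays in it. -/
theorem IsSecond.le_new_last (hσ : I.IsRotation f σ) {x y : Fin n} (hx : I.IsSecond f x y)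
    (hb : ¬ IsBad f σ x) : I.rk x y ≤ I.rk x ((f * σ)⁻¹ x) := by
  rw [mul_inv_apply']
  by_cases h : σ (f⁻¹ x) = f⁻¹ x
  · rw [inv_fixed h]
    exact hx.1.1
  · refine hx.2.2 _ (hσ.second_inv h).1.symm fun he => hb ⟨?_, ?_⟩
    · rw [← he]
      exact apply_inv_ne h
    · rw [← he]
      simp

/-- The elimination of rotations: where `σ` moves `x`, the first agent of `x` is replaced by the
second. Without an obstruction the result is prestable again. -/
theorem IsPrestable.mul_rotation (hf : I.IsPrestable f) (hσ : I.IsRotation f σ)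
    (hb : ∀ x, σ x ≠ x → ¬ IsBad f σ x) : I.IsPrestable (f * σ) := by
  refine ⟨fun i => ?_, fun i j hij => ?_⟩
  · by_cases hi : σ i = i
    · rw [Equiv.Perm.mul_apply, hi, mul_inv_apply']
      by_cases h : σ (f⁻¹ i) = f⁻¹ i
      · rw [inv_fixed h]
        exact hf.succ_le i
      · exact hf.first_le (hσ.second_inv h).1.symm
    · exact (hσ i hi).le_new_last hσ (hb i hi)
  · by_cases hi : σ i = i
    · rw [Equiv.Perm.mul_apply, hi] at hij
      exact lt_of_le_of_lt (hσ.last_le j) (hf.above i j hij)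
    · rw [Equiv.Perm.mul_apply] at hij
      rcases lt_trichotomy (I.rk i j) (I.rk i (f i)) with h | h | h
      · exact lt_of_le_of_lt (hσ.last_le j) (hf.above i j h)
      · obtain rfl := rk_inj.1 h
        have h1 : f⁻¹ (f i) = i := by simp
        have h2 : σ (f⁻¹ (f i)) ≠ f⁻¹ (f i) := by rwa [h1]
        have h3 := (hσ.second_inv h2).1.2
        rw [mul_inv_apply']
        refine lt_of_le_of_ne (by rwa [h1] at h3 ⊢) fun h4 => hi ?_
        rw [rk_inj, h1, Equiv.Perm.inv_eq_iff_eq] at h4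
        exact h4.symm
      · refine lt_of_le_of_lt (hσ.last_le j) ?_
        by_contra h'
        have h1 : I.InTable f i j := ⟨hij.le.trans (hσ i hi).1.1, not_lt.1 h'⟩
        have h2 := (hσ i hi).2.2 j h1 fun he => by rw [he] at h; exact lt_irrefl _ h
        omega

/-- The part of the search path in front of the rotation survives its elimination. -/
theorem IsSecond.mul_rotation (hσ : I.IsRotation f σ) {x x' : Fin n}
    (hx : I.IsSecond f x (f x')) (h1 : σ x = x) (h2 : σ x' = x') (hb : ¬ IsBad f σ x) :
    I.IsSecond (f * σ) x ((f * σ) x') := by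
  have h3 : (f * σ) x' = f x' := by rw [Equiv.Perm.mul_apply, h2]
  have h4 : (f * σ) x = f x := by rw [Equiv.Perm.mul_apply, h1]
  have h5 : (f * σ)⁻¹ (f x') = x' := by rw [← h3]; simp
  have h6 : f⁻¹ (f x') = x' := by simp
  rw [h3]
  refine ⟨⟨hx.le_new_last hσ hb, ?_⟩, by rw [h4]; exact hx.2.1, fun j hj hne => ?_⟩
  · have := hx.1.2
    rw [h6] at this
    rwa [h5]
  · exact hx.2.2 j (hσ.inTable hj) (by rwa [h4] at hne)

/-- The obstruction propagates backwards along the search path, and all lists on the way have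
only two entries. -/
theorem IsBad.of_isSecond (hσ : I.IsRotation f σ) {w x : Fin n}
    (hw : I.IsSecond f w (f x)) (hb : IsBad f σ x) : f⁻¹ w = f x ∧ IsBad f σ w := by
  obtain ⟨h1, h2⟩ := hb
  -- An agent whose second and last agents coincide has only two agents in its list.
  have two : ∀ a b y, I.IsSecond f a y → f⁻¹ a = y → I.InTable f a b → b = f a ∨ b = y := by
    intro a b y ha hy hb
    by_cases hne : b = f a
    · exact Or.inl hne
    · right
      have h3 := ha.2.2 b hb hne
      have h4 := hb.1
      rw [hy] at h4
      exact rk_inj.1 (le_antisymm h4 h3)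
  have hinv : ∀ z, f⁻¹ (f z) = z := fun z => by simp
  have h3 : w = f (f x) := by
    have h4 := hσ _ h1
    rw [h2] at h4
    rcases two (f x) w x h4 (hinv x) hw.1.symm with h | h
    · exact h
    · exact absurd (by rw [h]) hw.2.1
  have h4 : f⁻¹ w = f x := by rw [h3, hinv]
  refine ⟨h4, ?_⟩
  have h5 : σ (f⁻¹ w) ≠ f⁻¹ w := by rwa [h4]
  have h6 := hσ.second_inv h5
  rw [h4] at h6
  have h7 : σ (σ⁻¹ (f x)) = f x := by simp
  have h8 : σ⁻¹ (f x) = f w := by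
    rcases two w _ (f x) hw h4 h6.1.symm with h | h
    · exact h
    · rw [Equiv.Perm.inv_eq_iff_eq] at h
      exact absurd h.symm h1
  refine ⟨?_, ?_⟩
  · rw [← h8]
    exact apply_inv_ne h1
  · rw [← h8, h7, h3]

/-- Since the search path starts in an agent with at least three agents in its list, the
obstruction does not occur at its later places. -/
theorem not_isBad_of_path (hσ : I.IsRotation f σ) {X : ℕ → Fin n} {m : ℕ}
    (hX : ∀ k < m, I.IsSecond f (X k) (f (X (k + 1)))) (h0 : I.IsLong f (X 0)) {k : ℕ}
    (hk : k < m) : ¬ IsBad f σ (X (k + 1)) := by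
  induction k with
  | zero =>
    intro hb
    have h1 := (IsBad.of_isSecond hσ (hX 0 hk) hb).1
    obtain ⟨j, h2, h3, h4⟩ := h0
    have h5 := (hX 0 hk).2.2 j ⟨h3.le, h4⟩ fun he => by rw [he] at h2; exact lt_irrefl _ h2
    rw [h1] at h3
    exact absurd h5 (not_le.2 h3)
  | succ k ih =>
    intro hb
    exact ih (by omega) (IsBad.of_isSecond hσ (hX _ hk) hb).2

/-- If the obstruction occurs at an agent that is not moved, its list shrinks to one entry. -/
theorem not_isBad_of_isLong {x : Fin n} (hx : σ x = x) (h : I.IsLong (f * σ) x) :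
    ¬ IsBad f σ x := by
  rintro ⟨-, h2⟩
  obtain ⟨j, h3, h4, -⟩ := h
  have h5 : (f * σ) x = f x := by rw [Equiv.Perm.mul_apply, hx]
  have h6 : (f * σ)⁻¹ x = f x := by
    rw [Equiv.Perm.inv_eq_iff_eq, Equiv.Perm.mul_apply, h2]
  rw [h5] at h3
  rw [h6] at h4
  omega

/-! ### The proposal sequence -/

/-- The invariant of the proposal sequence. Agent `i` has been rejected by the agents in the first
`F i` places of its list. `L j` is the place in the list of `j` of the proposer that `j` holds,
and `n` if there is none. The agents in `E` are held by the agent in place `F i` of their list. -/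
structure ProposalInv (I : SRInstance n) (F L : Fin n → ℕ) (E : Set (Fin n)) : Prop where
  F_lt : ∀ i, F i < n
  L_le : ∀ j, L j ≤ n
  passed : ∀ i j, I.rk i j < F i → L j < I.rk j i
  holds : ∀ j, L j < n → ∃ w, I.rk j w = L j ∧ w ∈ E ∧ I.rk w j = F w
  engaged : ∀ i ∈ E, ∀ j, I.rk i j = F i → L j = I.rk j i
  le : ∀ j, L j < n → F j ≤ L j

namespace ProposalInv

variable {F L : Fin n → ℕ} {E : Set (Fin n)} {i j w : Fin n}

theorem init (I : SRInstance n) : I.ProposalInv (fun _ => 0) (fun _ => n) ∅ where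
  F_lt i := i.pos
  L_le _ := le_rfl
  passed _ _ h := absurd h (Nat.not_lt_zero _)
  holds _ h := absurd h (lt_irrefl _)
  engaged _ h := absurd h (Set.notMem_empty _)
  le _ h := absurd h (lt_irrefl _)

/-- An agent that receives an acceptable proposal has not proposed beyond the proposer. -/
theorem F_le_of_accept (h : I.ProposalInv F L E) (hj : I.rk i j = F i) :
    F j ≤ I.rk j i := by
  by_contra h'
  have h1 := h.passed j i (not_le.1 h')
  rw [hj] at h1
  have h2 := h.le i (h1.trans (h.F_lt i))
  omega

/-- An agent `j` that holds no proposal accepts the one of `i`. -/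
theorem accept_free (h : I.ProposalInv F L E) (hj : I.rk i j = F i)
    (hfree : L j = n) : I.ProposalInv F (Function.update L j (I.rk j i)) (insert i E) := by
  have hr := I.rk_lt j i
  have hlt : I.rk j i < L j := by rw [hfree]; exact hr
  have hle : ∀ k, Function.update L j (I.rk j i) k ≤ L k := by
    intro k
    by_cases hk : k = j
    · subst hk; simpa using hlt.le
    · simp [hk]
  refine ⟨h.F_lt, fun k => (hle k).trans (h.L_le k), fun a b hab => ?_, fun k hk => ?_,
    fun a ha b hab => ?_, fun k hk => ?_⟩
  · exact lt_of_le_of_lt (hle b) (h.passed a b hab)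
  · by_cases hkj : k = j
    · subst hkj
      exact ⟨i, by simp, Set.mem_insert _ _, hj⟩
    · simp only [Function.update_of_ne hkj] at hk ⊢
      obtain ⟨w, h1, h2, h3⟩ := h.holds k hk
      exact ⟨w, h1, Set.mem_insert_of_mem _ h2, h3⟩
  · rcases ha with rfl | ha
    · have : b = j := (rk_inj (I := I) (i := a)).1 (hab.trans hj.symm)
      subst this
      simp
    · have h1 := h.engaged a ha b hab
      have hbj : b ≠ j := by
        rintro rfl
        have := I.rk_lt b a
        omega
      rwa [Function.update_of_ne hbj]
  · by_cases hkj : k = j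
    · subst hkj
      simpa using h.F_le_of_accept hj
    · simp only [Function.update_of_ne hkj] at hk ⊢
      exact h.le k hk

/-- The agent `j` accepts the proposal of `i` and rejects `w`, whose proposal it has held. -/
theorem accept_displace (h : I.ProposalInv F L E) (hi : i ∉ E) (hj : I.rk i j = F i)
    (hlt : I.rk j i < L j) (hw : I.rk j w = L j) :
    I.ProposalInv (Function.update F w (F w + 1)) (Function.update L j (I.rk j i))
      (insert i E \ {w}) ∧ w ≠ i ∧ w ∈ E := by
  have hLj : L j < n := by rw [← hw]; exact I.rk_lt j w
  obtain ⟨w', h1, hwE, hwj⟩ := h.holds j hLj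
  obtain rfl : w = w' := (rk_inj (I := I) (i := j)).1 (hw.trans h1.symm)
  have hwi : w ≠ i := by rintro rfl; exact hi hwE
  have hFj := h.F_le_of_accept hj
  have hwj' : w ≠ j := by
    rintro rfl
    omega
  have hFw : F w + 1 < n := by
    have h2 := rk_lt_self (I := I) hwj'.symm
    rw [rk_self] at h2
    omega
  have hle : ∀ k, Function.update L j (I.rk j i) k ≤ L k := by
    intro k
    by_cases hk : k = j
    · subst hk; simpa using hlt.le
    · simp [hk]
  refine ⟨⟨fun k => ?_, fun k => (hle k).trans (h.L_le k), fun a b hab => ?_, fun k hk => ?_,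
    fun a ha b hab => ?_, fun k hk => ?_⟩, hwi, hwE⟩
  · by_cases hk : k = w
    · subst hk; simpa using hFw
    · simpa [hk] using h.F_lt k
  · by_cases haw : a = w
    · subst haw
      rw [Function.update_self] at hab
      rcases Nat.lt_succ_iff_lt_or_eq.1 hab with h2 | h2
      · exact lt_of_le_of_lt (hle b) (h.passed a b h2)
      · obtain rfl : b = j := (rk_inj (I := I) (i := a)).1 (h2.trans hwj.symm)
        simpa [hw] using hlt
    · rw [Function.update_of_ne haw] at hab
      exact lt_of_le_of_lt (hle b) (h.passed a b hab)
  · by_cases hkj : k = j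
    · subst hkj
      exact ⟨i, by simp, ⟨Set.mem_insert _ _, hwi.symm⟩, by rwa [Function.update_of_ne hwi.symm]⟩
    · simp only [Function.update_of_ne hkj] at hk ⊢
      obtain ⟨v, h2, h3, h4⟩ := h.holds k hk
      have hvw : v ≠ w := by
        rintro rfl
        exact hkj ((rk_inj (I := I) (i := v)).1 (h4.trans hwj.symm))
      exact ⟨v, h2, ⟨Set.mem_insert_of_mem _ h3, hvw⟩, by rwa [Function.update_of_ne hvw]⟩
  · obtain ⟨ha, haw⟩ := ha
    rw [Function.update_of_ne haw] at hab
    rcases ha with rfl | ha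
    · have : b = j := (rk_inj (I := I) (i := a)).1 (hab.trans hj.symm)
      subst this
      simp
    · have h2 := h.engaged a ha b hab
      have hbj : b ≠ j := by
        rintro rfl
        exact haw ((rk_inj (I := I) (i := b)).1 (h2.symm.trans hw.symm))
      rwa [Function.update_of_ne hbj]
  · by_cases hkj : k = j
    · subst hkj
      rw [Function.update_of_ne hwj'.symm]
      simpa using hFj
    · rw [Function.update_of_ne hkj] at hk ⊢
      have h2 := h.le k hk
      by_cases hkw : k = w
      · subst hkw
        rw [Function.update_self]
        refine lt_of_le_of_ne h2 fun h3 => ?_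
        -- Otherwise `k` would be held by `j` and hold `j` as well.
        obtain ⟨v, h4, -, h5⟩ := h.holds k hk
        obtain rfl : v = j := (rk_inj (I := I) (i := k)).1 (by omega)
        omega
      · rwa [Function.update_of_ne hkw]

/-- The agent `j` prefers the proposal that it holds to the one of `i`. -/
theorem reject (h : I.ProposalInv F L E) (hi : i ∉ E) (hj : I.rk i j = F i)
    (hge : L j ≤ I.rk j i) : I.ProposalInv (Function.update F i (F i + 1)) L E := by
  have hLj : L j < n := lt_of_le_of_lt hge (I.rk_lt j i)
  obtain ⟨w, hw, hwE, hwj⟩ := h.holds j hLj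
  have hlt : L j < I.rk j i := by
    refine lt_of_le_of_ne hge fun he => hi ?_
    obtain rfl : w = i := (rk_inj (I := I) (i := j)).1 (hw.trans he)
    exact hwE
  have hFi : L i < n → F i < L i := by
    intro h1
    refine lt_of_le_of_ne (h.le i h1) fun h2 => ?_
    obtain ⟨v, h4, -, h5⟩ := h.holds i h1
    obtain rfl : v = j := (rk_inj (I := I) (i := i)).1 (by omega)
    have := h.le v hLj
    omega
  refine ⟨fun k => ?_, h.L_le, fun a b hab => ?_, fun k hk => ?_, fun a ha b hab => ?_,
    fun k hk => ?_⟩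
  · by_cases hk : k = i
    · subst hk
      rw [Function.update_self]
      by_cases hjk : j = k
      · subst hjk
        have := hFi hLj
        omega
      · have h2 := rk_lt_self (I := I) hjk
        rw [rk_self] at h2
        omega
    · simpa [hk] using h.F_lt k
  · by_cases hai : a = i
    · subst hai
      rw [Function.update_self] at hab
      rcases Nat.lt_succ_iff_lt_or_eq.1 hab with h2 | h2
      · exact h.passed a b h2
      · obtain rfl : b = j := (rk_inj (I := I) (i := a)).1 (h2.trans hj.symm)
        exact hlt
    · rw [Function.update_of_ne hai] at hab
      exact h.passed a b hab
  · obtain ⟨v, h1, h2, h3⟩ := h.holds k hk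
    have hvi : v ≠ i := by rintro rfl; exact hi h2
    exact ⟨v, h1, h2, by rwa [Function.update_of_ne hvi]⟩
  · have hai : a ≠ i := by rintro rfl; exact hi ha
    rw [Function.update_of_ne hai] at hab
    exact h.engaged a ha b hab
  · by_cases hki : k = i
    · subst hki
      rw [Function.update_self]
      exact hFi hk
    · rw [Function.update_of_ne hki]
      exact h.le k hk

/-- When all agents are engaged, the proposals form a prestable permutation. -/
theorem exists_prestable (h : I.ProposalInv F L Set.univ) :
    ∃ f, I.IsPrestable f ∧ (∀ i, F i = I.rk i (f i)) ∧ ∀ j, L j = I.rk j (f⁻¹ j) := by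
  have hex : ∀ i, ∃ j, I.rk i j = F i := fun i =>
    ⟨(I.rank i).symm ⟨F i, h.F_lt i⟩, by simp [rk]⟩
  choose t ht using hex
  have hL : ∀ i, L (t i) = I.rk (t i) i := fun i => h.engaged i trivial _ (ht i)
  have hinj : Function.Injective t := by
    intro a b hab
    have h1 := hL a
    rw [hab, hL b] at h1
    exact (rk_inj.1 h1).symm
  let f : Equiv.Perm (Fin n) := Equiv.ofBijective t (Finite.injective_iff_bijective.1 hinj)
  have hf : ∀ i, f i = t i := fun _ => rfl
  have hLf : ∀ j, L j = I.rk j (f⁻¹ j) := by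
    intro j
    have h1 := hL (f⁻¹ j)
    rw [← hf] at h1
    have h2 : f (f⁻¹ j) = j := by simp
    rwa [h2] at h1
  have hFf : ∀ i, F i = I.rk i (f i) := fun i => (ht i).symm
  refine ⟨f, ⟨fun i => ?_, fun i j hij => ?_⟩, hFf, hLf⟩
  · rw [← hFf, ← hLf]
    refine h.le i ?_
    rw [hLf]
    exact I.rk_lt _ _
  · rw [← hFf] at hij
    rw [← hLf]
    exact h.passed i j hij

end ProposalInv

end SRInstance

/-! ### Arrays that hold vectors and tables -/

section Arrays

variable {n : ℕ}

/-- The first `n` cells of the array hold the vector `v`. -/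
def IsVec (A : ℕ → ℕ) (v : Fin n → ℕ) : Prop := ∀ i : Fin n, A i = v i

/-- The first `n * n` cells of the array hold the table `M`, row by row. -/
def IsTable (A : ℕ → ℕ) (M : Fin n → Fin n → ℕ) : Prop := ∀ i j : Fin n, A (i * n + j) = M i j

theorem IsVec.update {A : ℕ → ℕ} {v : Fin n → ℕ} (h : IsVec A v) (i : Fin n) (x : ℕ) :
    IsVec (Function.update A i x) (Function.update v i x) := by
  intro j
  by_cases hj : j = i
  · subst hj; simp
  · rw [Function.update_of_ne hj, Function.update_of_ne (by simpa [Fin.val_inj] using hj)]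
    exact h j

theorem cell_lt {i j n : ℕ} (hi : i < n) (hj : j < n) : i * n + j < n * n := by
  have : (i + 1) * n ≤ n * n := Nat.mul_le_mul_right n hi
  rw [Nat.succ_mul] at this
  omega

theorem cell_inj {i j i' j' n : ℕ} (hj : j < n) (hj' : j' < n) :
    i * n + j = i' * n + j' ↔ i = i' ∧ j = j' := by
  refine ⟨fun h => ?_, by rintro ⟨rfl, rfl⟩; rfl⟩
  have hn : 0 < n := by omega
  have h1 : (i * n + j) / n = i := by
    rw [Nat.mul_comm, Nat.mul_add_div hn, Nat.div_eq_of_lt hj, Nat.add_zero]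
  have h2 : (i' * n + j') / n = i' := by
    rw [Nat.mul_comm, Nat.mul_add_div hn, Nat.div_eq_of_lt hj', Nat.add_zero]
  have h3 : i = i' := by rw [← h1, h, h2]
  subst h3
  exact ⟨rfl, by omega⟩

theorem sum_update_succ (v : Fin n → ℕ) (i : Fin n) :
    ∑ j, Function.update v i (v i + 1) j = (∑ j, v j) + 1 := by
  rw [Finset.sum_update_of_mem (Finset.mem_univ i), ← Finset.add_sum_erase _ v (Finset.mem_univ i)]
  rw [Finset.sdiff_singleton_eq_erase]
  ring

theorem sum_le_mul_self {v : Fin n → ℕ} {m : ℕ} (h : ∀ i, v i ≤ m) : ∑ j, v j ≤ n * m := by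
  calc ∑ j, v j ≤ ∑ _j : Fin n, m := Finset.sum_le_sum fun j _ => h j
    _ = n * m := by simp

end Arrays

namespace SRInstance

variable {n : ℕ} (I : SRInstance n)

/-- The array holds the preference lists of `I`, row by row. -/
def IsPref (A : ℕ → ℕ) : Prop := ∀ i j : Fin n, A (i * n + I.rk i j) = j

theorem exists_rk (i : Fin n) {k : ℕ} (hk : k < n) : ∃ j, I.rk i j = k :=
  ⟨(I.rank i).symm ⟨k, hk⟩, by simp [rk]⟩

end SRInstance

/-! ### The program for the proposal sequence -/

namespace RAM

infixr:67 " ;; " => Program.seq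

/-- Variable: the number of agents. -/
notation "vN" => (0 : ℕ)
/-- Variable: the agent whose turn it is in an outer loop. -/
notation "vI" => (1 : ℕ)
/-- Variable: the agent that proposes. -/
notation "vCur" => (2 : ℕ)
/-- Variable: the agent that receives a proposal. -/
notation "vJ" => (3 : ℕ)
/-- Variable: a position in a list. -/
notation "vR" => (4 : ℕ)
/-- Variable: the position of a rejected proposer. -/
notation "vOld" => (5 : ℕ)
/-- Variable: `1` as long as the innermost loop has to go on. -/
notation "vGo" => (6 : ℕ)
/-- Variable: the length of the search path. -/
notation "vDepth" => (7 : ℕ)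
/-- Variable: an agent on the search path. -/
notation "vX" => (8 : ℕ)
/-- Variable: the second agent in the list of `vX`. -/
notation "vY" => (9 : ℕ)
/-- Variable: the agent after `vX` on the search path. -/
notation "vNext" => (10 : ℕ)
/-- Array: preference lists of the instance to be solved. -/
notation "aPref" => (2 : ℕ)
/-- Array: positions in the preference lists of the instance to be solved. -/
notation "aRank" => (3 : ℕ)
/-- Array: the position of the last agent in each reduced list. -/
notation "aLast" => (4 : ℕ)
/-- Array: for every list, the position of the last proposal, and afterwards a position before that
of the second agent in the reduced list. -/
notation "aPtr" => (5 : ℕ)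
/-- Array: the search path. -/
notation "aStack" => (6 : ℕ)
/-- Array: `1` for the agents on the search path. -/
notation "aMark" => (7 : ℕ)

open RAM.Program RAM.Expr

/-- Initialisation: nobody holds a proposal. -/
def initProg : Program :=
  forLoop vI vN
    (store aLast (.var vI) (.var vN) ;;
    store aPtr (.var vI) 0 ;;
    store aMark (.var vI) 0)

/-- One proposal of agent `vCur`. -/
def proposeStep : Program :=
  assign vJ (.read aPref (idx (.var vCur) (.read aPtr (.var vCur)))) ;;
  assign vR (.read aRank (idx (.var vJ) (.var vCur))) ;;
  ite (.lt (.var vR) (.read aLast (.var vJ)))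
    (assign vOld (.read aLast (.var vJ)) ;;
    store aLast (.var vJ) (.var vR) ;;
    ite (.lt (.var vOld) (.var vN))
      (assign vCur (.read aPref (idx (.var vJ) (.var vOld))) ;;
      store aPtr (.var vCur) (.read aPtr (.var vCur) + 1))
      (assign vGo 0))
    (store aPtr (.var vCur) (.read aPtr (.var vCur) + 1))

/-- The agents start to propose one after the other; a rejected agent goes on immediately. -/
def proposeProg : Program :=
  forLoop vI vN
    (assign vCur (.var vI) ;; assign vGo 1 ;; loop (.var vGo) proposeStep)

variable {n W : ℕ} {J : SRInstance n} {s : State}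

theorem initProg_spec (hn : n < W) (h0 : s.var vN = n) :
    wp W initProg (fun s' t => IsVec (s'.arr aLast) (fun _ : Fin n => n) ∧
      IsVec (s'.arr aPtr) (fun _ : Fin n => 0) ∧ IsVec (s'.arr aMark) (fun _ : Fin n => 0) ∧
      t ≤ 17 * n + 6) s := by
  refine wp_mono (wp_forLoop_const (fun k s' => ∀ i : Fin n, i.val < k →
    s'.arr aLast i = n ∧ s'.arr aPtr i = 0 ∧ s'.arr aMark i = 0) 9 (by decide) (by decide)
    (by decide) h0 hn (fun i hi => absurd hi (Nat.not_lt_zero _)) ?_) ?_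
  · intro k s' hk hF hvk hI
    have h0' : s'.var vN = n := (hF.var _ (by decide)).trans h0
    refine wp_seq (wp_store ?_ ?_ ?_)
    · simp; omega
    · simp; omega
    refine wp_seq (wp_store ?_ ?_ ?_)
    · simp; omega
    · simp; omega
    refine wp_store ?_ ?_ ?_
    · simp; omega
    · simp; omega
    refine ⟨fun i hi => ?_, by simp⟩
    by_cases hik : i.val = k
    · simp [hvk, h0', hik]
    · have := hI i (by omega)
      simp [hvk, hik, this]
  · rintro s' t _ ⟨hI, -, ht⟩
    exact ⟨fun i => (hI i i.isLt).1, fun i => (hI i i.isLt).2.1, fun i => (hI i i.isLt).2.2,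
      by omega⟩

theorem proposeStep_spec (hW : n * n + n < W) {F L : Fin n → ℕ} {E : Set (Fin n)} {i : Fin n}
    (h0 : s.var vN = n) (hP : J.IsPref (s.arr aPref)) (hR : IsTable (s.arr aRank) J.rk)
    (hF : IsVec (s.arr aPtr) F) (hL : IsVec (s.arr aLast) L) (hi : s.var vCur = i)
    (hgo : s.var vGo = 1) (hiE : i ∉ E) (h : J.ProposalInv F L E) :
    wp W proposeStep (fun s' t => ∃ (F' L' : Fin n → ℕ) (E' : Set (Fin n)) (i' : Fin n),
      IsVec (s'.arr aPtr) F' ∧ IsVec (s'.arr aLast) L' ∧ J.ProposalInv F' L' E' ∧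
      insert i E = insert i' E' ∧ s'.var vCur = i' ∧ t ≤ 53 ∧
      ((s'.var vGo = 1 ∧ i' ∉ E' ∧ ∑ k, F' k = ∑ k, F k + 1) ∨
        (s'.var vGo = 0 ∧ i' ∈ E' ∧ F' = F))) s := by
  have hFi := h.F_lt i
  obtain ⟨j, hj⟩ := J.exists_rk i hFi
  have hPj : s.arr aPref (i * n + F i) = j := by rw [← hj]; exact hP i j
  have hil := i.isLt
  have hjl := j.isLt
  have hr := J.rk_lt j i
  have hLn := h.L_le j
  refine wp_seq (wp_assign ?_ ?_)
  · simp [hi, h0, hF i, hPj]; omega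
  simp only [eval_read, eval_idx, eval_var, hi, h0, hF i, hPj]
  refine wp_seq (wp_assign ?_ ?_)
  · simp [hi, h0, hR j i]; omega
  simp only [eval_read, eval_idx, eval_var, State.setVar_var, State.setVar_arr, hi, h0, hR j i,
    if_true, if_false, Nat.reduceEqDiff]
  refine wp_ite ?_ ?_
  · intro hlt
    simp [hL j] at hlt
    refine wp_seq (wp_assign ?_ ?_)
    · simp [hL j]; omega
    refine wp_seq (wp_store ?_ ?_ ?_)
    · simp; omega
    · simp; omega
    refine wp_ite ?_ ?_
    · intro hold
      simp [hL j, h0] at hold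
      obtain ⟨w, hw⟩ := J.exists_rk j hold
      have hPw : s.arr aPref (j * n + L j) = w := by rw [← hw]; exact hP j w
      have hFw : F w < n := h.F_lt w
      have hwl := w.isLt
      obtain ⟨h1, h2, h3⟩ := h.accept_displace hiE hj hlt hw
      refine wp_seq (wp_assign ?_ ?_)
      · simp [h0, hL j, hPw]; omega
      refine wp_store ?_ ?_ ?_
      · simp [h0, hL j, hPw]; omega
      · simp [h0, hL j, hPw, hF w]; omega
      refine ⟨_, _, _, w, ?_, ?_, h1, ?_, ?_, ?_, Or.inl ⟨?_, ?_, ?_⟩⟩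
      · simpa [h0, hL j, hPw, hF w] using hF.update w (F w + 1)
      · simpa using hL.update j (J.rk j i)
      · ext z
        simp only [Set.mem_insert_iff, Set.mem_sdiff, Set.mem_singleton_iff]
        by_cases hz : z = w
        · subst hz; simp [h3]
        · simp [hz]
      · simp [h0, hL j, hPw]
      · simp
      · simp [hgo]
      · simp
      · exact sum_update_succ F w
    · intro hold
      simp [hL j, h0] at hold
      have h1 := h.accept_free hj (by omega)
      refine wp_assign ?_ ?_
      · simp; omega
      refine ⟨_, _, _, i, ?_, ?_, h1, ?_, ?_, ?_, Or.inr ⟨?_, ?_, rfl⟩⟩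
      · simpa using hF
      · simpa using hL.update j (J.rk j i)
      · simp
      · simp [hi]
      · simp
      · simp
      · simp
  · intro hge
    simp [hL j] at hge
    have h1 := h.reject hiE hj hge
    refine wp_store ?_ ?_ ?_
    · simp [hi]; omega
    · simp [hi, hF i]; omega
    refine ⟨_, L, E, i, ?_, ?_, h1, rfl, ?_, ?_, Or.inl ⟨?_, hiE, ?_⟩⟩
    · simpa [hi, hF i] using hF.update i (F i + 1)
    · simpa using hL
    · simp [hi]
    · simp
    · simp [hgo]
    · exact sum_update_succ F i

theorem proposeProg_spec (hW : n * n + n < W) (h0 : s.var vN = n)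
    (hP : J.IsPref (s.arr aPref)) (hR : IsTable (s.arr aRank) J.rk)
    (hF : IsVec (s.arr aPtr) (fun _ : Fin n => 0)) (hL : IsVec (s.arr aLast) (fun _ : Fin n => n)) :
    wp W proposeProg (fun s' t => ∃ f, J.IsPrestable f ∧
      IsVec (s'.arr aPtr) (fun i => J.rk i (f i)) ∧
      IsVec (s'.arr aLast) (fun j => J.rk j (f⁻¹ j)) ∧ t ≤ 60 * (n * n) + 100 * n + 6) s := by
  have hsum : ∀ {F L : Fin n → ℕ} {E : Set (Fin n)}, J.ProposalInv F L E → ∑ k, F k ≤ n * n :=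
    fun h => sum_le_mul_self fun i => (h.F_lt i).le
  refine wp_mono (wp_forLoop_potential (fun k s' => ∃ F L : Fin n → ℕ,
    IsVec (s'.arr aPtr) F ∧ IsVec (s'.arr aLast) L ∧
      J.ProposalInv F L {i | i.val < k})
    (fun _ s' => 60 * (n * n - ∑ i : Fin n, s'.arr aPtr i)) (fun _ => 92) (by decide) (by decide)
    (by decide) h0 (by omega) ⟨_, _, by simpa using hF, by simpa using hL, ?_⟩ ?_) ?_
  · simpa using SRInstance.ProposalInv.init J
  · rintro k s' hk hFr hvk ⟨F, L, hF, hL, hinv⟩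
    have h0' : s'.var vN = n := (hFr.var _ (by decide)).trans h0
    have hP' : J.IsPref (s'.arr aPref) := by rw [hFr.arr _ (by decide)]; exact hP
    have hR' : IsTable (s'.arr aRank) J.rk := by rw [hFr.arr _ (by decide)]; exact hR
    refine wp_seq (wp_assign ?_ ?_)
    · simp; omega
    refine wp_seq (wp_assign ?_ ?_)
    · simp; omega
    simp only [eval_var, eval_one, hvk]
    refine wp_mono (wp_loop (fun s₁ => ∃ (F L : Fin n → ℕ) (E : Set (Fin n)) (i : Fin n),
        IsVec (s₁.arr aPtr) F ∧ IsVec (s₁.arr aLast) L ∧ J.ProposalInv F L E ∧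
        s₁.var vCur = i ∧ insert i E = {i | i.val < k + 1} ∧
        ((s₁.var vGo = 1 ∧ i ∉ E) ∨ (s₁.var vGo = 0 ∧ i ∈ E)))
      (fun s₁ => 60 * (n * n - ∑ i : Fin n, s₁.arr aPtr i) + 60 * s₁.var vGo) ?_ ?_) ?_
    · refine ⟨F, L, _, ⟨k, hk⟩, by simpa using hF, by simpa using hL, hinv, by simp, ?_, ?_⟩
      · ext z
        simp only [Set.mem_insert_iff, Set.mem_ofPred_eq, Fin.ext_iff]
        omega
      · left; simp
    · rintro s₁ hF₁ ⟨F, L, E, i, hF, hL, hinv, hi, hE, hgo⟩ he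
      simp only [eval_var] at he
      have hgo1 : s₁.var vGo = 1 := by rcases hgo with h | h <;> [exact h.1; exact absurd h.1 he]
      have hiE : i ∉ E := by rcases hgo with h | h <;> [exact h.2; exact absurd h.1 he]
      refine wp_mono (proposeStep_spec hW (J := J) (F := F) (L := L) (E := E) (i := i)
        ((hF₁.var _ (by decide)).trans (by simpa using h0')) ?_ ?_ hF hL hi hgo1 hiE hinv) ?_
      · rw [hF₁.arr _ (by decide)]; simpa using hP'
      · rw [hF₁.arr _ (by decide)]; simpa using hR'
      · rintro s₂ t - ⟨F', L', E', i', hF', hL', hinv', hE', hi', ht, hcase⟩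
        have e1 : ∑ i : Fin n, s₁.arr aPtr i = ∑ i, F i := Finset.sum_congr rfl fun i _ => hF i
        have e2 : ∑ i : Fin n, s₂.arr aPtr i = ∑ i, F' i := Finset.sum_congr rfl fun i _ => hF' i
        have := hsum hinv
        have := hsum hinv'
        refine ⟨⟨F', L', E', i', hF', hL', hinv', hi', hE'.symm.trans hE, ?_⟩, ?_⟩
        · rcases hcase with h | h
          · exact Or.inl ⟨h.1, h.2.1⟩
          · exact Or.inr ⟨h.1, h.2.1⟩
        · simp only [cost_var]
          rw [e1, e2, hgo1]
          rcases hcase with ⟨h1, -, h2⟩ | ⟨h1, -, h2⟩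
          · rw [h1]; omega
          · rw [h1, h2]; omega
    · rintro s₁ t - ⟨⟨F', L', E, i, hF', hL', hinv', hi, hE, hgo⟩, -, he, ht⟩
      simp only [eval_var] at he
      have hiE : i ∈ E := by
        rcases hgo with h | h <;> [exact absurd (h.1.symm.trans he) (by simp); exact h.2]
      rw [Set.insert_eq_of_mem hiE] at hE
      subst hE
      refine ⟨⟨F', L', by simpa using hF', by simpa using hL', hinv'⟩, ?_⟩
      simp [he] at ht ⊢
      omega
  · rintro s' t - ⟨⟨F, L, hF', hL', hinv⟩, -, ht⟩
    have huniv : {i : Fin n | i.val < n} = Set.univ := by ext z; simp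
    rw [huniv] at hinv
    obtain ⟨f, hf, h1, h2⟩ := hinv.exists_prestable
    refine ⟨f, hf, fun i => (hF' i).trans (h1 i), fun i => (hL' i).trans (h2 i), ?_⟩
    simp only [Finset.sum_const, Finset.card_range, smul_eq_mul] at ht
    have : 60 * (n * n - ∑ i : Fin n, (s.setVar vI 0).arr aPtr i) ≤ 60 * (n * n) :=
      Nat.mul_le_mul_left _ (Nat.sub_le _ _)
    omega

end RAM

/-! ### The search path for rotations -/

/-- The permutation that moves `X s ↦ X (s + 1) ↦ ⋯ ↦ X (m - 1) ↦ X s`. -/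
theorem exists_cycle_perm {α : Type*} [DecidableEq α] (X : ℕ → α) {s m : ℕ} (hsm : s < m)
    (hX : ∀ j < m, ∀ k < m, X j = X k → j = k) :
    ∃ σ : Equiv.Perm α, (∀ k, s ≤ k → k + 1 < m → σ (X k) = X (k + 1)) ∧
      σ (X (m - 1)) = X s ∧ ∀ z, (∀ k, s ≤ k → k < m → X k ≠ z) → σ z = z := by
  set l : List α := (List.range (m - s)).map fun i => X (s + i) with hl
  have hlen : l.length = m - s := by simp [hl]
  have hget : ∀ i (hi : i < l.length), l[i] = X (s + i) := by
    intro i hi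
    simp [hl]
  have hnd : l.Nodup := by
    refine List.Nodup.map_on ?_ List.nodup_range
    intro a ha b hb hab
    rw [List.mem_range] at ha hb
    have := hX _ (by omega) _ (by omega) hab
    omega
  have happ : ∀ i (hi : i < l.length), l.formPerm (X (s + i)) = X (s + (i + 1) % l.length) := by
    intro i hi
    rw [← hget i hi, List.formPerm_apply_getElem _ hnd, hget]
  refine ⟨l.formPerm, fun k hk hkm => ?_, ?_, fun z hz => ?_⟩
  · have h := happ (k - s) (by omega)
    rw [Nat.mod_eq_of_lt (by omega)] at h
    rwa [show s + (k - s) = k by omega, show s + (k - s + 1) = k + 1 by omega] at h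
  · have h := happ (m - 1 - s) (by omega)
    have h2 : (m - 1 - s + 1) % l.length = 0 := by
      have : m - 1 - s + 1 = l.length := by omega
      rw [this, Nat.mod_self]
    rwa [h2, Nat.add_zero, show s + (m - 1 - s) = m - 1 by omega] at h
  · refine List.formPerm_apply_of_notMem fun h => ?_
    obtain ⟨i, hi, rfl⟩ := List.mem_map.1 h
    rw [List.mem_range] at hi
    exact hz _ (by omega) (by omega) rfl

namespace SRInstance

variable {n : ℕ} (I : SRInstance n)

/-- The second agent in the reduced list of `x` is beyond position `G x`. -/
def PtrInv (f : Equiv.Perm (Fin n)) (G : Fin n → ℕ) : Prop :=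
  ∀ x, G x < n ∧ I.rk x (f x) ≤ G x ∧
    ∀ j, I.rk x (f x) < I.rk x j → I.rk x j ≤ G x → ¬ I.InTable f x j

/-- The pointer of `x` cannot be advanced any more. -/
def PtrStuck (f : Equiv.Perm (Fin n)) (G : Fin n → ℕ) (x : Fin n) : Prop :=
  ∀ y, I.rk x y = G x + 1 → G x + 1 < I.rk x (f⁻¹ x) → I.rk y x ≤ I.rk y (f⁻¹ y)

/-- `X 0, …, X (m - 1)` is a search path from `x₀`: the second agent of each is the first agent of
the next one, and its place is known for all of them but the last. -/
def IsPath (f : Equiv.Perm (Fin n)) (G : Fin n → ℕ) (X : ℕ → Fin n) (m : ℕ) (x₀ : Fin n) : Prop :=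
  (0 < m → X 0 = x₀) ∧ ∀ k, k + 1 < m →
    I.IsSecond f (X k) (f (X (k + 1))) ∧ G (X k) + 1 = I.rk (X k) (f (X (k + 1)))

variable {I} {f σ : Equiv.Perm (Fin n)} {G : Fin n → ℕ} {x y : Fin n}

theorem IsPrestable.inTable_last (hf : I.IsPrestable f) (x : Fin n) : I.InTable f x (f⁻¹ x) := by
  refine ⟨le_rfl, ?_⟩
  have := hf.succ_le (f⁻¹ x)
  have h : f (f⁻¹ x) = x := by simp
  rwa [h] at this

theorem IsLong.ne (h : I.IsLong f x) : f x ≠ f⁻¹ x := by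
  obtain ⟨j, h1, h2, -⟩ := h
  intro h3
  rw [h3] at h1
  omega

theorem IsSecond.ne_of_first (hf : I.IsPrestable f) (h : I.IsSecond f y (f x)) : f x ≠ f⁻¹ x := by
  intro h1
  have h2 : f (f x) = x := by rw [h1]; simp
  have h3 : f⁻¹ (f x) = x := by simp
  have h4 := hf.first_le h.1.symm
  have h5 := h.1.2
  rw [h3] at h5
  rw [h2] at h4
  have h6 := (rk_inj (I := I)).1 (le_antisymm h5 h4)
  rw [h6] at h
  exact h.2.1 rfl

theorem PtrInv.second_of_inTable (hf : I.IsPrestable f) (hG : I.PtrInv f G) (h : I.rk x y = G x + 1)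
    (hy : I.InTable f x y) : I.IsSecond f x y := by
  obtain ⟨-, h1, h2⟩ := hG x
  refine ⟨hy, fun he => by rw [he] at h; omega, fun j hj hne => ?_⟩
  by_contra h3
  rcases lt_trichotomy (I.rk x (f x)) (I.rk x j) with h4 | h4 | h4
  · exact h2 j h4 (by omega) hj
  · exact hne (rk_inj.1 h4).symm
  · exact absurd (hf.first_le hj) (not_le.2 h4)

/-- If the reduced list of `x` has at least two entries, then a pointer that cannot be advanced is
just before the second of them. -/
theorem PtrInv.exists_second (hf : I.IsPrestable f) (hG : I.PtrInv f G)
    (hst : I.PtrStuck f G x) (hx : f x ≠ f⁻¹ x) :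
    ∃ y, I.rk x y = G x + 1 ∧ I.IsSecond f x y := by
  obtain ⟨-, h1, h2⟩ := hG x
  have h3 : I.rk x (f x) < I.rk x (f⁻¹ x) :=
    lt_of_le_of_ne (hf.succ_le x) fun he => hx (rk_inj.1 he)
  have h4 : G x < I.rk x (f⁻¹ x) := by
    by_contra h4
    exact h2 _ h3 (not_lt.1 h4) (hf.inTable_last x)
  rcases Nat.lt_or_ge (G x + 1) (I.rk x (f⁻¹ x)) with h5 | h5
  · obtain ⟨y, hy⟩ := I.exists_rk x (h5.trans (I.rk_lt _ _))
    exact ⟨y, hy, hG.second_of_inTable hf hy ⟨by omega, hst y hy h5⟩⟩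
  · have h6 : I.rk x (f⁻¹ x) = G x + 1 := by omega
    exact ⟨_, h6, hG.second_of_inTable hf h6 (hf.inTable_last x)⟩

theorem PtrInv.isLong_iff (hG : I.PtrInv f G) (hst : I.PtrStuck f G x) :
    I.IsLong f x ↔ G x + 1 < I.rk x (f⁻¹ x) := by
  obtain ⟨-, h1, h2⟩ := hG x
  constructor
  · rintro ⟨j, h3, h4, h5⟩
    by_contra h6
    exact h2 j h3 (by omega) ⟨h4.le, h5⟩
  · intro h
    obtain ⟨y, hy⟩ := I.exists_rk x (h.trans (I.rk_lt _ _))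
    exact ⟨y, by omega, by omega, hst y hy h⟩

/-- The elimination of the rotation that closes a search path. -/
theorem IsPath.eliminate (hf : I.IsPrestable f) (hG : I.PtrInv f G) {X : ℕ → Fin n} {m s : ℕ}
    {x₀ : Fin n} (hX : I.IsPath f G X m x₀) (hinj : ∀ j < m, ∀ k < m, X j = X k → j = k)
    (hsm : s < m) (hlast : I.IsSecond f (X (m - 1)) (f (X s)))
    (hGlast : G (X (m - 1)) + 1 = I.rk (X (m - 1)) (f (X s))) (h0 : I.IsLong f x₀)
    (h1 : ∀ k, s ≤ k → k + 1 < m → σ (X k) = X (k + 1)) (h2 : σ (X (m - 1)) = X s)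
    (h3 : ∀ z, (∀ k, s ≤ k → k < m → X k ≠ z) → σ z = z) (G' : Fin n → ℕ)
    (hG' : ∀ k, s ≤ k → k < m → G' (X k) = G (X k) + 1)
    (hG'' : ∀ z, (∀ k, s ≤ k → k < m → X k ≠ z) → G' z = G z) :
    I.IsRotation f σ ∧ I.IsPrestable (f * σ) ∧ I.PtrInv (f * σ) G' ∧
      (∀ k, s ≤ k → k < m → G (X k) + 1 = I.rk (X k) (f (σ (X k)))) ∧
      (I.IsLong (f * σ) x₀ → I.IsPath (f * σ) G' X s x₀) := by
  have hmove : ∀ k, s ≤ k → k < m → I.IsSecond f (X k) (f (σ (X k))) ∧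
      G (X k) + 1 = I.rk (X k) (f (σ (X k))) := by
    intro k hk hkm
    rcases Nat.lt_or_ge (k + 1) m with h | h
    · rw [h1 k hk h]
      exact hX.2 k h
    · obtain rfl : k = m - 1 := by omega
      rw [h2]
      exact ⟨hlast, hGlast⟩
  have hmem : ∀ z, σ z ≠ z → ∃ k, s ≤ k ∧ k < m ∧ X k = z := by
    intro z hz
    by_contra h
    push Not at h
    exact hz (h3 z h)
  have hrot : I.IsRotation f σ := by
    intro z hz
    obtain ⟨k, hk, hkm, rfl⟩ := hmem z hz
    exact (hmove k hk hkm).1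
  have hX0 : X 0 = x₀ := hX.1 (by omega)
  have hbadpos : ∀ k, k + 1 < m → ¬ IsBad f σ (X (k + 1)) := fun k hk =>
    not_isBad_of_path hrot (m := m - 1) (fun j hj => (hX.2 j (by omega)).1)
      (by rw [hX0]; exact h0) (by omega)
  have hbad : ∀ z, σ z ≠ z → ¬ IsBad f σ z := by
    intro z hz hb
    -- The predecessor of `z` in the rotation would be bad too, and one of the two is not `X 0`.
    have h4 : σ (σ⁻¹ z) = z := by simp
    have h5 : σ (σ⁻¹ z) ≠ σ⁻¹ z := apply_inv_ne hz
    have h6 := hrot _ h5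
    rw [h4] at h6
    have h7 := (IsBad.of_isSecond hrot h6 hb).2
    obtain ⟨k, hk, hkm, hkz⟩ := hmem z hz
    obtain ⟨l, hl, hlm, hlz⟩ := hmem _ h5
    rcases Nat.eq_zero_or_pos k with rfl | hk0
    · rcases Nat.eq_zero_or_pos l with rfl | hl0
      · rw [hlz] at hkz
        rw [hkz] at h4
        exact hz h4
      · rw [← hlz, ← Nat.sub_add_cancel hl0] at h7
        exact hbadpos _ (by omega) h7
    · rw [← hkz, ← Nat.sub_add_cancel hk0] at hb
      exact hbadpos _ (by omega) hb
  have hnm : ∀ k < s, ∀ l, s ≤ l → l < m → X l ≠ X k := by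
    intro k hk l hl hlm he
    have := hinj _ hlm _ (by omega) he
    omega
  refine ⟨hrot, hf.mul_rotation hrot hbad, fun x => ?_, fun k hk hkm => (hmove k hk hkm).2,
    fun hlong => ⟨fun hs => hX0, fun k hk => ?_⟩⟩
  · by_cases hx : ∃ k, s ≤ k ∧ k < m ∧ X k = x
    · obtain ⟨k, hk, hkm, rfl⟩ := hx
      have h4 := (hmove k hk hkm).2
      rw [hG' k hk hkm, Equiv.Perm.mul_apply, h4]
      exact ⟨I.rk_lt _ _, le_rfl, fun j h5 h6 => absurd h5 (not_lt.2 h6)⟩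
    · push Not at hx
      rw [hG'' x hx, Equiv.Perm.mul_apply, h3 x hx]
      obtain ⟨h4, h5, h6⟩ := hG x
      exact ⟨h4, h5, fun j h7 h8 h9 => h6 j h7 h8 (hrot.inTable h9)⟩
  · have hk1 := hX.2 k (by omega)
    have h4 : σ (X k) = X k := h3 _ (hnm k (by omega))
    have h5 : σ (X (k + 1)) = X (k + 1) := h3 _ (hnm _ hk)
    refine ⟨hk1.1.mul_rotation hrot h4 h5 ?_, ?_⟩
    · rcases Nat.eq_zero_or_pos k with rfl | hk0
      · rw [hX0] at h4 ⊢
        exact not_isBad_of_isLong h4 hlong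
      · rw [← Nat.sub_add_cancel hk0]
        exact hbadpos _ (by omega)
    · rw [hG'' _ (hnm k (by omega)), Equiv.Perm.mul_apply, h5]
      exact hk1.2

end SRInstance

/-! ### The program for the elimination of rotations -/

namespace RAM

open RAM.Program RAM.Expr

/-- The agent in the place after the pointer in the list of `vX`. -/
def afterPtr : Expr := .read aPref (idx (.var vX) (.read aPtr (.var vX) + 1))

/-- Advance the pointer of `vX` to just before the second agent in its reduced list. -/
def scanProg : Program :=
  loop (.lt (.read aPtr (.var vX) + 1) (.read aLast (.var vX)) *
      .lt (.read aLast afterPtr) (.read aRank (idx afterPtr (.var vX))))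
    (store aPtr (.var vX) (.read aPtr (.var vX) + 1))

/-- Take the last agent off the search path and move it to its second agent. -/
def popStep : Program :=
  assign vDepth (.var vDepth - 1) ;;
  assign vX (.read aStack (.var vDepth)) ;;
  assign vY afterPtr ;;
  store aLast (.var vY) (.read aRank (idx (.var vY) (.var vX))) ;;
  store aPtr (.var vX) (.read aPtr (.var vX) + 1) ;;
  store aMark (.var vX) 0 ;;
  assign vGo (1 - .eq (.var vX) (.var vNext))

/-- Eliminate the rotation that the search path ends with and that contains `vNext`. -/
def popProg : Program :=
  assign vGo 1 ;; loop (.var vGo) popStep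

/-- Compute the next agent of the search path. -/
def nextProg : Program :=
  ite (.var vDepth)
    (assign vX (.read aStack (.var vDepth - 1)) ;;
    scanProg ;;
    assign vY afterPtr ;;
    assign vNext (.read aPref (idx (.var vY) (.read aLast (.var vY)))))
    (assign vNext (.var vI))

/-- Extend the search path by `vNext`, or eliminate the rotation if `vNext` is on it already. -/
def extendProg : Program :=
  ite (.read aMark (.var vNext)) popProg
    (store aStack (.var vDepth) (.var vNext) ;;
    store aMark (.var vNext) 1 ;;
    assign vDepth (.var vDepth + 1))

/-- Take everything off the search path. -/
def clearProg : Program :=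
  loop (.var vDepth)
    (assign vDepth (.var vDepth - 1) ;;
    store aMark (.read aStack (.var vDepth)) 0)

/-- Eliminate rotations until the reduced list of `vI` has at most two entries. -/
def searchProg : Program :=
  assign vDepth 0 ;;
  assign vX (.var vI) ;;
  scanProg ;;
  loop (.lt (.read aPtr (.var vI) + 1) (.read aLast (.var vI)))
    (nextProg ;; extendProg ;; assign vX (.var vI) ;; scanProg) ;;
  clearProg

/-- Compute a stable partition of the instance in `aPref` and `aRank`. Afterwards `aLast` holds
the position of the predecessor of each agent in its list. -/
def solveProg : Program :=
  initProg ;; proposeProg ;; forLoop vI vN searchProg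

variable {n W : ℕ} {J : SRInstance n} {s : State} {f σ : Equiv.Perm (Fin n)} {G : Fin n → ℕ}
  {X : ℕ → Fin n} {m : ℕ}

/-- The state represents the prestable permutation `f`, the pointers `G`, and the search path
`X 0, …, X (m - 1)`. -/
structure IsSearch (J : SRInstance n) (f : Equiv.Perm (Fin n)) (G : Fin n → ℕ) (X : ℕ → Fin n)
    (m : ℕ) (s : State) : Prop where
  prestable : J.IsPrestable f
  ptr : J.PtrInv f G
  var_n : s.var vN = n
  pref : J.IsPref (s.arr aPref)
  rank : IsTable (s.arr aRank) J.rk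
  arr_ptr : IsVec (s.arr aPtr) G
  arr_last : IsVec (s.arr aLast) fun j => J.rk j (f⁻¹ j)
  var_depth : s.var vDepth = m
  stack : ∀ k < m, s.arr aStack k = X k
  mark : ∀ k < m, s.arr aMark (X k) = 1
  unmarked : ∀ i : Fin n, (∀ k < m, X k ≠ i) → s.arr aMark i = 0
  inj : ∀ j < m, ∀ k < m, X j = X k → j = k

/-- The number of steps that the pointers may still make. -/
def slack (n : ℕ) (s : State) : ℕ := n * n - ∑ i : Fin n, s.arr aPtr i

theorem IsSearch.congr {s' : State} (h : IsSearch J f G X m s)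
    (harr : ∀ a ∈ [2, 3, 4, 5, 6, 7], s'.arr a = s.arr a)
    (hvar : ∀ x ∈ [0, 7], s'.var x = s.var x) : IsSearch J f G X m s' where
  prestable := h.prestable
  ptr := h.ptr
  var_n := (hvar _ (by decide)).trans h.var_n
  pref := by rw [harr _ (by decide)]; exact h.pref
  rank := by rw [harr _ (by decide)]; exact h.rank
  arr_ptr := by rw [harr _ (by decide)]; exact h.arr_ptr
  arr_last := by rw [harr _ (by decide)]; exact h.arr_last
  var_depth := (hvar _ (by decide)).trans h.var_depth
  stack := by rw [harr _ (by decide)]; exact h.stack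
  mark := by rw [harr _ (by decide)]; exact h.mark
  unmarked := by rw [harr _ (by decide)]; exact h.unmarked
  inj := h.inj

theorem IsSearch.depth_le (h : IsSearch J f G X m s) : m ≤ n := by
  have h1 : Function.Injective fun k : Fin m => X k := fun j k hjk =>
    Fin.ext (h.inj _ j.isLt _ k.isLt hjk)
  simpa using Fintype.card_le_of_injective _ h1

/-- The advance of a pointer by one place frees one unit of `slack`. -/
theorem slack_succ {G' : Fin n → ℕ} {s s' : State} {x : Fin n}
    (h : IsVec (s.arr aPtr) G') (h' : IsVec (s'.arr aPtr) (Function.update G' x (G' x + 1)))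
    (hlt : ∀ i, Function.update G' x (G' x + 1) i ≤ n) : slack n s' + 1 = slack n s := by
  unfold slack
  have h1 : ∑ i : Fin n, s.arr aPtr i = ∑ i, G' i := Finset.sum_congr rfl fun i _ => h i
  have h2 : ∑ i : Fin n, s'.arr aPtr i = ∑ i, Function.update G' x (G' x + 1) i :=
    Finset.sum_congr rfl fun i _ => h' i
  have h3 := sum_le_mul_self hlt
  rw [h1, h2]
  rw [sum_update_succ] at h3 ⊢
  omega

theorem slack_congr {s s' : State} (h : s'.arr aPtr = s.arr aPtr) : slack n s' = slack n s := by
  unfold slack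
  rw [h]

/-- The steps of a pointer are paid for by `slack`. -/
theorem scanProg_spec (hW : n * n + n < W) {x : Fin n} (h : IsSearch J f G X m s)
    (hx : s.var vX = x) :
    wp W scanProg (fun s' t => ∃ g, IsSearch J f (Function.update G x g) X m s' ∧
      J.PtrStuck f (Function.update G x g) x ∧ t + 1000 * slack n s' ≤ 1000 * slack n s + 60)
      s := by
  have hfr : ∀ {s'}, Frame scanProg s s' → s'.var vX = x := fun hF =>
    (hF.var _ (by decide)).trans hx
  have hxl := x.isLt
  refine wp_mono (wp_loop (fun s' => ∃ g, IsSearch J f (Function.update G x g) X m s')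
    (fun s' => 1000 * slack n s') ⟨G x, by simpa using h⟩ ?_) ?_
  · rintro s' hF ⟨g, hS⟩ he
    have hx' := hfr hF
    have hptr : s'.arr aPtr x = g := by simpa using hS.arr_ptr x
    have hlast := hS.arr_last x
    have hle := J.rk_lt x (f⁻¹ x)
    have h1 : g + 1 < J.rk x (f⁻¹ x) := by
      by_contra h1
      simp [-Equiv.Perm.coe_inv, hx', hptr, hlast, h1] at he
    obtain ⟨y, hy⟩ := J.exists_rk x (h1.trans hle)
    have hPy : s'.arr aPref (x * n + (g + 1)) = y := by rw [← hy]; exact hS.pref x y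
    have hRy := hS.rank y x
    have hLy := hS.arr_last y
    have h2 : J.rk y (f⁻¹ y) < J.rk y x := by
      by_contra h2
      simp [-Equiv.Perm.coe_inv, afterPtr, hx', hptr, hlast, hS.var_n, hPy, hRy, hLy, h2] at he
    have hvec : IsVec ((s'.setArr aPtr x (g + 1)).arr aPtr) (Function.update G x (g + 1)) := by
      simpa using hS.arr_ptr.update x (g + 1)
    have hptr' : J.PtrInv f (Function.update G x (g + 1)) := by
      intro z
      by_cases hz : z = x
      · subst hz
        obtain ⟨h3, h4, h5⟩ := hS.ptr z
        rw [Function.update_self] at h3 h4 h5 ⊢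
        refine ⟨by omega, by omega, fun j h6 h7 h8 => ?_⟩
        rcases Nat.le_succ_iff.1 h7 with h9 | h9
        · exact h5 j h6 h9 h8
        · obtain rfl : j = y := (SRInstance.rk_inj (I := J) (i := z)).1 (h9.trans hy.symm)
          exact absurd h8.2 (not_le.2 h2)
      · have := hS.ptr z
        rwa [Function.update_of_ne hz] at this ⊢
    refine wp_store ?_ ?_ ?_
    · simp [hx']; omega
    · simp [hx', hptr]; omega
    · simp only [eval_var, eval_add, eval_read, eval_one, hx', hptr]
      refine ⟨⟨g + 1, ⟨hS.prestable, hptr', ?_, ?_, ?_, hvec, ?_, ?_, ?_, ?_, ?_, hS.inj⟩⟩, ?_⟩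
      · simpa using hS.var_n
      · simpa using hS.pref
      · simpa using hS.rank
      · simpa using hS.arr_last
      · simpa using hS.var_depth
      · simpa using hS.stack
      · simpa using hS.mark
      · simpa using hS.unmarked
      · have := slack_succ (x := x) (s' := s'.setArr aPtr x (g + 1)) hS.arr_ptr
          (by simpa using hvec) (by simpa using fun i => (hptr' i).1.le)
        simp [afterPtr]
        omega
  · rintro s' t - ⟨⟨g, hS⟩, hF, he, ht⟩
    have hx' := hfr hF
    refine ⟨g, hS, fun y hy h1 => ?_, ?_⟩
    · rw [Function.update_self] at hy h1
      have hptr : s'.arr aPtr x = g := by simpa using hS.arr_ptr x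
      have hPy : s'.arr aPref (x * n + (g + 1)) = y := by rw [← hy]; exact hS.pref x y
      by_contra h2
      simp [-Equiv.Perm.coe_inv, afterPtr, hx', hptr, hS.arr_last x, hS.var_n, hPy,
        hS.rank y x, hS.arr_last y, h1,
        not_le.1 h2] at he
    · simp [afterPtr] at ht
      omega

/-- The elimination of a rotation advances the pointer of each of its agents, which pays for it. -/
theorem popProg_spec (hW : n * n + n < W) {r : ℕ} (h : IsSearch J f G X m s) (hr : r < m)
    (hnext : s.var vNext = X r) (hf' : J.IsPrestable (f * σ)) {G' : Fin n → ℕ}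
    (hptr' : J.PtrInv (f * σ) G')
    (hσ : ∀ k, r ≤ k → k < m → G (X k) + 1 = J.rk (X k) (f (σ (X k))))
    (hσ' : ∀ z, (∀ k, r ≤ k → k < m → X k ≠ z) → σ z = z)
    (hG' : ∀ k, r ≤ k → k < m → G' (X k) = G (X k) + 1)
    (hG'' : ∀ z, (∀ k, r ≤ k → k < m → X k ≠ z) → G' z = G z) :
    wp W popProg (fun s' t => IsSearch J (f * σ) G' X r s' ∧
      slack n s' + (m - r) = slack n s ∧ t + 100 * slack n s' ≤ 100 * slack n s + 10) s := by
  have hmn := h.depth_le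
  refine wp_seq (wp_assign ?_ ?_)
  · simp; have := (X 0).isLt; omega
  simp only [eval_one, cost_one]
  refine wp_mono (wp_loop (fun s' => ∃ d, r ≤ d ∧ d ≤ m ∧ s'.var vDepth = d ∧
      slack n s' + (m - d) = slack n s ∧ s'.var vGo = (if d = r then 0 else 1) ∧
      (∃ Gd, IsVec (s'.arr aPtr) Gd ∧ (∀ k, d ≤ k → k < m → Gd (X k) = G (X k) + 1) ∧
        (∀ z, (∀ k, d ≤ k → k < m → X k ≠ z) → Gd z = G z)) ∧
      (∀ k, d ≤ k → k < m → s'.arr aLast (f (σ (X k))) = J.rk (f (σ (X k))) (X k)) ∧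
      (∀ j, (∀ k, d ≤ k → k < m → f (σ (X k)) ≠ j) → s'.arr aLast j = J.rk j (f⁻¹ j)) ∧
      (∀ k < d, s'.arr aMark (X k) = 1) ∧
      ∀ i : Fin n, (∀ k < d, X k ≠ i) → s'.arr aMark i = 0)
    (fun s' => 100 * slack n s') ?_ ?_) ?_
  · refine ⟨m, hr.le, le_rfl, by simpa using h.var_depth, by simp [slack], by simp [hr.ne'],
      ⟨G, by simpa using h.arr_ptr, fun k h1 h2 => by omega, fun z _ => rfl⟩,
      fun k h1 h2 => by omega, fun j _ => by simpa using h.arr_last j, ?_, ?_⟩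
    · simpa using h.mark
    · simpa using h.unmarked
  · rintro s' hF ⟨d, hrd, hdm, hd, hsl0, hgo, ⟨Gd, hGd, hGd1, hGd2⟩, hL1, hL2, hM1, hM2⟩ he
    have hdr : d ≠ r := by
      rintro rfl
      simp [hgo] at he
    obtain ⟨d, rfl⟩ : ∃ d', d = d' + 1 := ⟨d - 1, by omega⟩
    have hrd' : r ≤ d := by omega
    have h0 : s'.var vN = n := (hF.var _ (by decide)).trans (by simpa using h.var_n)
    have hnext' : s'.var vNext = X r := (hF.var _ (by decide)).trans (by simpa using hnext)
    have hstack : s'.arr aStack d = X d := by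
      rw [hF.arr _ (by decide)]; simpa using h.stack d (by omega)
    have hpref : J.IsPref (s'.arr aPref) := by rw [hF.arr _ (by decide)]; simpa using h.pref
    have hrank : IsTable (s'.arr aRank) J.rk := by
      rw [hF.arr _ (by decide)]; simpa using h.rank
    have hXne : ∀ k, d + 1 ≤ k → k < m → X k ≠ X d := fun k h1 h2 h3 => by
      have := h.inj _ h2 _ (by omega) h3
      omega
    have hGX : Gd (X d) = G (X d) := hGd2 _ hXne
    set x := X d with hx
    set y := f (σ x) with hy
    have hq : G x + 1 = J.rk x y := hσ d hrd' (by omega)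
    have hptrx : s'.arr aPtr x = G x := by rw [hGd x, hGX]
    have hPy : s'.arr aPref (x * n + (G x + 1)) = y := by rw [hq]; exact hpref x _
    have hRy := hrank y x
    have hxl := x.isLt
    have hyl := y.isLt
    have h1 := J.rk_lt y x
    have h2 := J.rk_lt x y
    refine wp_seq (wp_assign ?_ ?_)
    · simp [hd]; omega
    refine wp_seq (wp_assign ?_ ?_)
    · simp [hd, hstack]; omega
    refine wp_seq (wp_assign ?_ ?_)
    · simp [afterPtr, hd, hstack, hptrx, h0, hPy]; omega
    refine wp_seq (wp_store ?_ ?_ ?_)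
    · simp [afterPtr, hd, hstack, hptrx, h0, hPy]; omega
    · simp [afterPtr, hd, hstack, hptrx, h0, hPy, hRy]; omega
    refine wp_seq (wp_store ?_ ?_ ?_)
    · simp [hd, hstack]; omega
    · simp [hd, hstack, hptrx]; omega
    refine wp_seq (wp_store ?_ ?_ ?_)
    · simp [hd, hstack]; omega
    · simp; omega
    refine wp_assign ?_ ?_
    · simp; omega
    have hvec : IsVec (Function.update (s'.arr aPtr) x (G x + 1))
        (Function.update Gd x (Gd x + 1)) := by
      rw [← hGX]; exact hGd.update x (Gd x + 1)
    have hlt : ∀ i, Function.update Gd x (Gd x + 1) i ≤ n := by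
      intro i
      by_cases hi : i = x
      · subst hi; rw [Function.update_self]; omega
      · rw [Function.update_of_ne hi]
        by_cases hi' : ∃ k, d + 1 ≤ k ∧ k < m ∧ X k = i
        · obtain ⟨k, h3, h4, rfl⟩ := hi'
          rw [hGd1 k h3 h4, hσ k (by omega) h4]
          exact (J.rk_lt _ _).le
        · push Not at hi'
          rw [hGd2 i hi']
          exact (h.ptr i).1.le
    have hsl : ∀ s'' : State, s''.arr aPtr = Function.update (s'.arr aPtr) x (G x + 1) →
        slack n s'' + 1 = slack n s' := fun s'' h' =>
      slack_succ (x := x) hGd (by rw [h']; exact hvec) hlt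
    have h4 : ∀ (s'' : State) (c : ℕ), s''.arr aPtr = Function.update (s'.arr aPtr) x (G x + 1) →
        c ≤ 100 → slack n s'' + (m - d) = slack n s ∧
          c + 100 * slack n s'' ≤ 100 * slack n s' := fun s'' c h' hc => by
      have := hsl s'' h'
      omega
    have h5 := fun s'' h' => (h4 s'' 0 h' (by omega)).1
    have h6 := fun s'' c h' hc => (h4 s'' c h' hc).2
    refine ⟨⟨d, hrd', by omega, by simp [hd], h5 _ ?_, ?_,
      ⟨Function.update Gd x (Gd x + 1), ?_, ?_, ?_⟩,
      ?_, ?_, ?_, ?_⟩, h6 _ _ ?_ ?_⟩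
    · simp [hd, hstack, hptrx]
    · by_cases hdr' : d = r
      · subst hdr'
        simp [hd, hstack, hnext', hx]
      · have h3 : X d ≠ X r := fun h3 => hdr' (h.inj _ (by omega) _ hr h3)
        have h4 : (X d).val ≠ (X r).val := fun h5 => h3 (Fin.ext h5)
        simp [hd, hstack, hnext', hx, hdr', h4]
    · simpa [hd, hstack, hptrx] using hvec
    · intro k hk hkm
      by_cases hkd : k = d
      · subst hkd; rw [← hx, Function.update_self, hGX]
      · rw [Function.update_of_ne (hXne k (by omega) hkm)]
        exact hGd1 k (by omega) hkm
    · intro z hz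
      rw [Function.update_of_ne (hz d le_rfl (by omega)).symm]
      exact hGd2 z fun k hk hkm => hz k (by omega) hkm
    · intro k hk hkm
      simp [afterPtr, hd, hstack, hptrx, h0, hPy, hRy]
      by_cases hkd : k = d
      · subst hkd; simp [← hx, ← hy]
      · have h3 : f (σ (X k)) ≠ y := fun h3 => hXne k (by omega) hkm (σ.injective (f.injective h3))
        rw [Function.update_of_ne (fun h4 => h3 (Fin.ext h4))]
        exact hL1 k (by omega) hkm
    · intro j hj
      have h3 : y ≠ j := hj d le_rfl (by omega)
      simp [afterPtr, hd, hstack, hptrx, h0, hPy, hRy]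
      rw [Function.update_of_ne (fun h4 => h3 (Fin.ext h4.symm))]
      exact hL2 j fun k hk hkm => hj k (by omega) hkm
    · intro k hk
      have h3 : X k ≠ x := fun h3 => by
        have := h.inj _ (by omega) _ (by omega) h3
        omega
      simp [hd, hstack]
      rw [Function.update_of_ne (fun h4 => h3 (Fin.ext h4))]
      exact hM1 k (by omega)
    · intro i hi
      simp [hd, hstack]
      by_cases hix : i = x
      · subst hix; simp
      · rw [Function.update_of_ne (fun h4 => hix (Fin.ext h4))]
        refine hM2 i fun k hk hki => ?_
        by_cases hkd : k = d
        · subst hkd; exact hix hki.symm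
        · exact hi k (by omega) hki
    · simp [hd, hstack, hptrx]
    · simp [afterPtr]
  · rintro s' t - ⟨⟨d, hrd, hdm, hd, hsl0, hgo, ⟨Gd, hGd, hGd1, hGd2⟩, hL1, hL2, hM1, hM2⟩,
      hF, he, ht⟩
    have hdr : d = r := by
      by_contra hdr
      simp [hgo, hdr] at he
    subst hdr
    have hGG : Gd = G' := by
      funext z
      by_cases hz : ∃ k, d ≤ k ∧ k < m ∧ X k = z
      · obtain ⟨k, h1, h2, rfl⟩ := hz
        rw [hGd1 k h1 h2, hG' k h1 h2]
      · push Not at hz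
        rw [hGd2 z hz, hG'' z hz]
    subst hGG
    refine ⟨⟨hf', hptr', ?_, ?_, ?_, hGd, fun j => ?_, hd, ?_, hM1, hM2,
      fun j hj k hk => h.inj j (by omega) k (by omega)⟩, hsl0, ?_⟩
    · exact (hF.var _ (by decide)).trans (by simpa using h.var_n)
    · rw [hF.arr _ (by decide)]; simpa using h.pref
    · rw [hF.arr _ (by decide)]; simpa using h.rank
    · show s'.arr aLast j = J.rk j ((f * σ)⁻¹ j)
      rw [SRInstance.mul_inv_apply']
      by_cases hj : ∃ k, d ≤ k ∧ k < m ∧ f (σ (X k)) = j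
      · obtain ⟨k, h1, h2, rfl⟩ := hj
        rw [hL1 k h1 h2]
        congr 1
        simp
      · push Not at hj
        rw [hL2 j hj]
        congr 1
        have h3 : σ (f⁻¹ j) = f⁻¹ j := by
          by_contra h3
          obtain ⟨k, h4, h5, h6⟩ : ∃ k, d ≤ k ∧ k < m ∧ X k = σ⁻¹ (f⁻¹ j) := by
            by_contra h4
            push Not at h4
            have h5 := hσ' _ h4
            have h6 : σ (σ⁻¹ (f⁻¹ j)) = f⁻¹ j := by simp
            rw [h6] at h5
            rw [← h5] at h6
            exact h3 h6
          exact hj k h4 h5 (by rw [h6]; simp)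
        rw [SRInstance.inv_fixed h3]
    · intro k hk
      rw [hF.arr _ (by decide)]; simpa using h.stack k (by omega)
    · have : slack n (s.setVar vGo 1) = slack n s := slack_congr (by simp)
      simp [this] at ht
      omega

end RAM

namespace RAM

open RAM.Program RAM.Expr

variable {n W : ℕ} {J : SRInstance n} {s : State} {f σ : Equiv.Perm (Fin n)} {G : Fin n → ℕ}
  {X : ℕ → Fin n} {m : ℕ} {x₀ : Fin n}

/-- The path is extended by the agent `nx` whose first agent is the second agent of its end. -/
theorem nextProg_spec (hW : n * n + n < W) (h : IsSearch J f G X m s) (hI : s.var vI = x₀)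
    (hpath : J.IsPath f G X m x₀) (hlong : J.IsLong f x₀) :
    wp W nextProg (fun s' t => ∃ (G' : Fin n → ℕ) (nx : Fin n), IsSearch J f G' X m s' ∧
      J.IsPath f G' X m x₀ ∧ s'.var vNext = nx ∧
      ((m = 0 ∧ nx = x₀) ∨ (0 < m ∧ J.IsSecond f (X (m - 1)) (f nx) ∧
        G' (X (m - 1)) + 1 = J.rk (X (m - 1)) (f nx))) ∧
      t + 1000 * slack n s' ≤ 1000 * slack n s + 100) s := by
  have hx₀ := x₀.isLt
  refine wp_ite ?_ ?_
  · intro hm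
    simp only [eval_var, h.var_depth] at hm
    set x := X (m - 1) with hx
    have hxl := x.isLt
    have hst : s.arr aStack (m - 1) = x := h.stack _ (by omega)
    refine wp_seq (wp_assign ?_ ?_)
    · simp [h.var_depth, hst]; omega
    simp only [eval_read, eval_sub, eval_var, eval_one, h.var_depth, hst]
    refine wp_seq (wp_mono (scanProg_spec hW (h.congr (s' := s.setVar vX x) (by simp) (by simp))
      (x := x) (by simp)) ?_)
    rintro s₁ t₁ hF₁ ⟨g, hS, hstuck, ht₁⟩
    have hx₁ : s₁.var vX = x := (hF₁.var _ (by decide)).trans (by simp)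
    -- Every agent on the search path has at least two agents in its list.
    have hne : f x ≠ f⁻¹ x := by
      rcases Nat.eq_zero_or_pos (m - 1) with h1 | h1
      · rw [hx, h1, hpath.1 (by omega)]
        exact hlong.ne
      · have h2 := (hpath.2 (m - 1 - 1) (by omega)).1
        rw [Nat.sub_add_cancel h1, ← hx] at h2
        exact h2.ne_of_first h.prestable
    obtain ⟨y, hy, hsec⟩ := hS.ptr.exists_second hS.prestable hstuck hne
    have hptr := hS.arr_ptr x
    have hPy : s₁.arr aPref (x * n + (Function.update G x g x + 1)) = y := by
      rw [← hy]; exact hS.pref x y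
    have hyl := y.isLt
    have hLy : s₁.arr aLast y = J.rk y (f⁻¹ y) := hS.arr_last y
    have hPn : s₁.arr aPref (y * n + J.rk y (f⁻¹ y)) = f⁻¹ y := hS.pref y _
    have hnl := (f⁻¹ y).isLt
    have hsl : slack n (s.setVar vX x) = slack n s := slack_congr (by simp)
    refine wp_seq (wp_assign ?_ ?_)
    · simp only [afterPtr, eval_read, eval_idx, eval_add, eval_var, eval_one, hx₁, hptr, hS.var_n,
        hPy]
      omega
    have hev : eval s₁ afterPtr = y := by
      simp only [afterPtr, eval_read, eval_idx, eval_add, eval_var, eval_one, hx₁, hptr, hS.var_n,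
        hPy]
    rw [hev]
    refine wp_assign ?_ ?_
    · simp [-Equiv.Perm.coe_inv, hLy, hS.var_n, hPn]; omega
    refine ⟨Function.update G x g, f⁻¹ y, hS.congr (by simp) (by simp), ⟨hpath.1, fun k hk => ?_⟩,
      ?_, Or.inr ⟨by omega, ?_, ?_⟩, ?_⟩
    · have h1 : X k ≠ x := fun h1 => by
        have := h.inj _ (by omega) _ (by omega) h1
        omega
      rw [Function.update_of_ne h1]
      exact hpath.2 k hk
    · simp [-Equiv.Perm.coe_inv, hLy, hS.var_n, hPn]
    · have : f (f⁻¹ y) = y := by simp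
      rwa [this]
    · have : f (f⁻¹ y) = y := by simp
      rw [this]
      exact hy.symm
    · have h3 : slack n ((s₁.setVar vY y).setVar vNext (eval (s₁.setVar vY y)
        (.read aPref (idx (.var vY) (.read aLast (.var vY)))))) = slack n s₁ :=
        slack_congr (by simp)
      rw [h3]
      rw [hsl] at ht₁
      simp [afterPtr]
      omega
  · intro hm
    simp only [eval_var, h.var_depth] at hm
    refine wp_assign ?_ ?_
    · simp [hI]; omega
    refine ⟨G, x₀, h.congr (by simp) (by simp), hpath, by simp [hI], Or.inl ⟨hm, rfl⟩, ?_⟩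
    have h3 : slack n (s.setVar vNext (eval s (.var vI))) = slack n s := slack_congr (by simp)
    rw [h3]
    simp
    omega

/-- A path that gets longer pays with the number `n - m` of places left on it. An elimination makes
it shorter by the length of the rotation, but advances as many pointers and so pays with `slack`.
The surplus of 260 units covers the other work of one iteration. -/
theorem extendProg_spec (hW : n * n + n < W) (h : IsSearch J f G X m s) {nx : Fin n}
    (hnext : s.var vNext = nx) (hpath : J.IsPath f G X m x₀) (hlong : J.IsLong f x₀)
    (hnx : (m = 0 ∧ nx = x₀) ∨ (0 < m ∧ J.IsSecond f (X (m - 1)) (f nx) ∧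
        G (X (m - 1)) + 1 = J.rk (X (m - 1)) (f nx))) :
    wp W extendProg (fun s' t => ∃ f' G' X' m', IsSearch J f' G' X' m' s' ∧
      (J.IsLong f' x₀ → J.IsPath f' G' X' m' x₀) ∧ (∀ x, J.IsLong f' x → J.IsLong f x) ∧
      t + 260 + 1000 * slack n s' + 300 * (n - m') ≤ 1000 * slack n s + 300 * (n - m)) s := by
  classical
  have hmn := h.depth_le
  have hnl := nx.isLt
  refine wp_ite ?_ ?_
  · intro hmark
    simp only [eval_read, eval_var, hnext] at hmark
    obtain ⟨r, hr, hrx⟩ : ∃ k < m, X k = nx := by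
      by_contra hcon
      push Not at hcon
      exact hmark (h.unmarked nx hcon)
    subst hrx
    obtain ⟨hm0, hsec, hGsec⟩ : 0 < m ∧ J.IsSecond f (X (m - 1)) (f (X r)) ∧
        G (X (m - 1)) + 1 = J.rk (X (m - 1)) (f (X r)) := by
      rcases hnx with h1 | h1
      · omega
      · exact h1
    obtain ⟨σ, h1, h2, h3⟩ := exists_cycle_perm X hr h.inj
    let G' : Fin n → ℕ := fun z => if ∃ k, r ≤ k ∧ k < m ∧ X k = z then G z + 1 else G z
    have hG' : ∀ k, r ≤ k → k < m → G' (X k) = G (X k) + 1 := fun k hk hkm =>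
      if_pos ⟨k, hk, hkm, rfl⟩
    have hG'' : ∀ z, (∀ k, r ≤ k → k < m → X k ≠ z) → G' z = G z := fun z hz =>
      if_neg (by push Not; exact hz)
    obtain ⟨hrot, hf', hptr', hq, hpath'⟩ := hpath.eliminate h.prestable h.ptr h.inj hr hsec hGsec
      hlong h1 h2 h3 G' hG' hG''
    refine wp_mono (popProg_spec hW h hr hnext hf' hptr' hq h3 hG' hG'') ?_
    rintro s' t - ⟨hS, hsl, ht⟩
    refine ⟨_, _, _, _, hS, hpath', fun x hx => hrot.isLong h.prestable hx, ?_⟩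
    simp
    omega
  · intro hmark
    simp only [eval_read, eval_var, hnext] at hmark
    have hnew : ∀ k < m, X k ≠ nx := by
      rintro k hk rfl
      rw [h.mark k hk] at hmark
      omega
    have hmn' : m < n := by
      have hinj : Function.Injective fun k : Fin (m + 1) => if k.val < m then X k else nx := by
        intro a b hab
        have ha := a.isLt
        have hb := b.isLt
        simp only at hab
        split_ifs at hab with h1 h2 h2
        · exact Fin.ext (h.inj _ h1 _ h2 hab)
        · exact absurd hab (hnew _ h1)
        · exact absurd hab.symm (hnew _ h2)
        · exact Fin.ext (by omega)
      have := Fintype.card_le_of_injective _ hinj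
      simp at this
      omega
    refine wp_seq (wp_store ?_ ?_ ?_)
    · simp [h.var_depth]; omega
    · simp [hnext]; omega
    refine wp_seq (wp_store ?_ ?_ ?_)
    · simp [hnext]; omega
    · simp; omega
    refine wp_assign ?_ ?_
    · simp [h.var_depth]; omega
    have hX : ∀ k < m, Function.update X m nx k = X k := fun k hk =>
      Function.update_of_ne (by omega) _ _
    have hXm : Function.update X m nx m = nx := by simp
    refine ⟨f, G, Function.update X m nx, m + 1, ⟨h.prestable, h.ptr, ?_, ?_, ?_, ?_, ?_, ?_,
      fun k hk => ?_, fun k hk => ?_, fun i hi => ?_, fun j hj k hk hjk => ?_⟩,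
      fun _ => ⟨fun _ => ?_, fun k hk => ?_⟩, fun x hx => hx, ?_⟩
    · simpa using h.var_n
    · simpa using h.pref
    · simpa using h.rank
    · simpa using h.arr_ptr
    · simpa using h.arr_last
    · simp [h.var_depth]
    · simp [h.var_depth, hnext]
      rcases Nat.lt_succ_iff_lt_or_eq.1 hk with h1 | rfl
      · rw [hX k h1, Function.update_of_ne (by omega)]
        exact h.stack k h1
      · simp
    · simp [h.var_depth, hnext]
      rcases Nat.lt_succ_iff_lt_or_eq.1 hk with h1 | rfl
      · rw [hX k h1, Function.update_of_ne (fun h2 => hnew k h1 (Fin.ext h2))]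
        exact h.mark k h1
      · simp
    · simp [h.var_depth, hnext]
      have h1 := hi m (by omega)
      rw [hXm] at h1
      rw [Function.update_of_ne (fun h2 => h1 (Fin.ext h2.symm))]
      refine h.unmarked i fun k hk => ?_
      have := hi k (by omega)
      rwa [hX k hk] at this
    · rcases Nat.lt_succ_iff_lt_or_eq.1 hj with h1 | rfl <;>
        rcases Nat.lt_succ_iff_lt_or_eq.1 hk with h2 | rfl
      · rw [hX j h1, hX k h2] at hjk
        exact h.inj j h1 k h2 hjk
      · rw [hX j h1, hXm] at hjk
        exact absurd hjk (hnew j h1)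
      · rw [hX k h2, hXm] at hjk
        exact absurd hjk.symm (hnew k h2)
      · rfl
    · rcases hnx with ⟨rfl, h1⟩ | ⟨h1, -⟩
      · rw [hXm, h1]
      · rw [hX 0 h1]
        exact hpath.1 h1
    · rcases Nat.lt_or_ge (k + 1) m with h1 | h1
      · rw [hX k (by omega), hX (k + 1) h1]
        exact hpath.2 k h1
      · obtain rfl : k = m - 1 := by omega
        rcases hnx with ⟨rfl, -⟩ | ⟨h2, h3⟩
        · omega
        · rw [hX _ (by omega), Nat.sub_add_cancel h2, hXm]
          exact h3
    · have h3 : ∀ s' : State, s'.arr aPtr = s.arr aPtr → slack n s' = slack n s := fun _ =>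
        slack_congr
      rw [h3 _ (by simp)]
      simp
      omega

theorem clearProg_spec (hW : n * n + n < W) (h : IsSearch J f G X m s) :
    wp W clearProg (fun s' t => IsSearch J f G X 0 s' ∧ slack n s' = slack n s ∧
      t ≤ 15 * n + 2) s := by
  have hmn := h.depth_le
  refine wp_mono (wp_loop (fun s' => ∃ d ≤ m, IsSearch J f G X d s') (fun s' => 15 * s'.var vDepth)
    ⟨m, le_rfl, h⟩ ?_) ?_
  · rintro s' hF ⟨d, hdm, hS⟩ he
    simp only [eval_var, hS.var_depth] at he
    obtain ⟨d, rfl⟩ : ∃ d', d = d' + 1 := ⟨d - 1, by omega⟩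
    have hxl := (X d).isLt
    have hst := hS.stack d (by omega)
    refine wp_seq (wp_assign ?_ ?_)
    · simp [hS.var_depth]; omega
    refine wp_store ?_ ?_ ?_
    · simp [hS.var_depth, hst]; omega
    · simp; omega
    refine ⟨⟨d, by omega, ⟨hS.prestable, hS.ptr, ?_, ?_, ?_, ?_, ?_, ?_,
      fun k hk => ?_, fun k hk => ?_, fun i hi => ?_, fun j hj k hk hjk => ?_⟩⟩, ?_⟩
    · simpa using hS.var_n
    · simpa using hS.pref
    · simpa using hS.rank
    · simpa using hS.arr_ptr
    · simpa using hS.arr_last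
    · simp [hS.var_depth]
    · simpa using hS.stack k (by omega)
    · simp [hS.var_depth, hst]
      have h1 : X k ≠ X d := fun h1 => by
        have := hS.inj _ (by omega) _ (by omega) h1
        omega
      rw [Function.update_of_ne (fun h2 => h1 (Fin.ext h2))]
      exact hS.mark k (by omega)
    · simp [hS.var_depth, hst]
      by_cases h1 : i = X d
      · subst h1; simp
      · rw [Function.update_of_ne (fun h2 => h1 (Fin.ext h2))]
        refine hS.unmarked i fun k hk => ?_
        rcases Nat.lt_succ_iff_lt_or_eq.1 hk with h2 | rfl
        · exact hi k h2
        · exact fun h3 => h1 h3.symm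
    · exact hS.inj j (by omega) k (by omega) hjk
    · simp [hS.var_depth]
      omega
  · rintro s' t - ⟨⟨d, hdm, hS⟩, hF, he, ht⟩
    simp only [eval_var, hS.var_depth] at he
    subst he
    refine ⟨hS, slack_congr (hF.arr _ (by decide)), ?_⟩
    simp [h.var_depth] at ht
    omega

/-- A search costs time `O(n)` beyond what the pointers pay for, and the lists that are short
already stay short. -/
theorem searchProg_spec (hW : n * n + n < W) (h : IsSearch J f G X 0 (s.setVar vDepth 0))
    (hI : s.var vI = x₀) :
    wp W searchProg (fun s' t => ∃ f' G' X', IsSearch J f' G' X' 0 s' ∧ ¬ J.IsLong f' x₀ ∧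
      (∀ x, J.IsLong f' x → J.IsLong f x) ∧
      t + 1000 * slack n s' ≤ 1000 * slack n s + (400 * n + 100)) s := by
  have hx₀ := x₀.isLt
  refine wp_seq (wp_assign (by simp; omega) ?_)
  refine wp_seq (wp_assign (by simp [hI]; omega) ?_)
  simp only [eval_zero, eval_var, State.setVar_var, hI, Nat.reduceEqDiff, if_false]
  have hS0 : IsSearch J f G X 0 ((s.setVar vDepth 0).setVar vX x₀) :=
    h.congr (by simp) (by simp)
  refine wp_seq (wp_mono (scanProg_spec hW hS0 (x := x₀) (by simp)) ?_)
  rintro s₁ t₁ hF₁ ⟨g, hS₁, hst₁, ht₁⟩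
  have hI₁ : s₁.var vI = x₀ := (hF₁.var _ (by decide)).trans (by simp [hI])
  have hsl0 : slack n ((s.setVar vDepth 0).setVar vX x₀) = slack n s := slack_congr (by simp)
  rw [hsl0] at ht₁
  refine wp_seq (wp_mono (wp_loop (fun s' => ∃ f' G' X' m', IsSearch J f' G' X' m' s' ∧
      J.PtrStuck f' G' x₀ ∧ (J.IsLong f' x₀ → J.IsPath f' G' X' m' x₀) ∧
      (∀ x, J.IsLong f' x → J.IsLong f x))
    (fun s' => 1000 * slack n s' + 300 * (n - s'.var vDepth)) ⟨f, _, X, 0, hS₁, hst₁,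
      fun _ => ⟨fun h => absurd h (lt_irrefl _), fun k hk => absurd hk (Nat.not_lt_zero _)⟩,
      fun x hx => hx⟩ ?_) ?_)
  · rintro s' hF ⟨f', G', X', m', hS, hst, hpath, hmono⟩ he
    have hI' : s'.var vI = x₀ := (hF.var _ (by decide)).trans hI₁
    have hlong : J.IsLong f' x₀ := by
      rw [hS.ptr.isLong_iff hst]
      by_contra hcon
      simp only [eval_lt, eval_add, eval_read, eval_var, eval_one, hI', hS.arr_ptr x₀,
        hS.arr_last x₀, hcon, if_false] at he
      exact he rfl
    have hd := hS.var_depth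
    refine wp_seq (wp_mono (nextProg_spec hW hS hI' (hpath hlong) hlong) ?_)
    rintro s₂ t₂ hF₂ ⟨G₂, nx, hS₂, hpath₂, hnx₂, hcase, ht₂⟩
    refine wp_seq (wp_mono (extendProg_spec hW hS₂ hnx₂ hpath₂ hlong hcase) ?_)
    rintro s₃ t₃ hF₃ ⟨f₃, G₃, X₃, m₃, hS₃, hpath₃, hmono₃, ht₃⟩
    have hI₃ : s₃.var vI = x₀ :=
      (hF₃.var _ (by decide)).trans ((hF₂.var _ (by decide)).trans hI')
    refine wp_seq (wp_assign (by simp [hI₃]; omega) ?_)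
    simp only [eval_var, hI₃]
    refine wp_mono (scanProg_spec hW (hS₃.congr (s' := s₃.setVar vX x₀) (by simp) (by simp))
      (x := x₀) (by simp)) ?_
    rintro s₄ t₄ - ⟨g₄, hS₄, hst₄, ht₄⟩
    have hsl₃ : slack n (s₃.setVar vX x₀) = slack n s₃ := slack_congr (by simp)
    rw [hsl₃] at ht₄
    refine ⟨⟨f₃, _, X₃, m₃, hS₄, hst₄, fun hl => ⟨(hpath₃ hl).1, fun k hk => ?_⟩,
      fun x hx => hmono x (hmono₃ x hx)⟩, ?_⟩
    · -- The pointer of an agent on the path is followed by its second agent already.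
      have h1 := (hpath₃ hl).2 k hk
      refine ⟨h1.1, ?_⟩
      by_cases hx : X₃ k = x₀
      · rw [hx] at h1 ⊢
        obtain ⟨y, hy, hy2⟩ := hS₄.ptr.exists_second hS₄.prestable hst₄ hl.ne
        rw [← hy]
        exact le_antisymm (hy2.2.2 _ h1.1.1 h1.1.2.1) (h1.1.2.2 _ hy2.1 hy2.2.1)
      · rw [Function.update_of_ne hx]
        exact h1.2
    · rw [hS₄.var_depth, hd]
      simp
      omega
  · rintro s₂ t₂ hF₂ ⟨⟨f', G', X', m', hS, hst, -, hmono⟩, -, he, ht⟩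
    have hI' : s₂.var vI = x₀ := (hF₂.var _ (by decide)).trans hI₁
    have hnl : ¬ J.IsLong f' x₀ := by
      rw [hS.ptr.isLong_iff hst]
      intro hcon
      simp only [eval_lt, eval_add, eval_read, eval_var, eval_one, hI', hS.arr_ptr x₀,
        hS.arr_last x₀, hcon, if_true] at he
      exact one_ne_zero he
    refine wp_mono (clearProg_spec hW hS) ?_
    rintro s₃ t₃ - ⟨hS₃, hsl₃, ht₃⟩
    refine ⟨f', G', X', hS₃, hnl, hmono, ?_⟩
    rw [hS₁.var_depth] at ht
    simp at ht ⊢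
    omega

/-- A stable partition is computed in quadratic time. -/
theorem solveProg_spec (hn : 0 < n) (hW : n * n + n < W) (h0 : s.var vN = n)
    (hP : J.IsPref (s.arr aPref)) (hR : IsTable (s.arr aRank) J.rk) :
    wp W solveProg (fun s' t => ∃ p, J.IsStablePartition p ∧
      IsVec (s'.arr aLast) (fun j => J.rk j (p⁻¹ j)) ∧ t ≤ 1500 * (n * n) + 250 * n + 20) s := by
  refine wp_seq (wp_mono (initProg_spec (n := n) (by omega) h0) ?_)
  rintro s₁ t₁ hF₁ ⟨hL₁, hG₁, hM₁, ht₁⟩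
  have h0₁ := (hF₁.var vN (by decide)).trans h0
  have hP₁ : J.IsPref (s₁.arr aPref) := by rw [hF₁.arr _ (by decide)]; exact hP
  have hR₁ : IsTable (s₁.arr aRank) J.rk := by rw [hF₁.arr _ (by decide)]; exact hR
  refine wp_seq (wp_mono (proposeProg_spec hW h0₁ hP₁ hR₁ hG₁ hL₁) ?_)
  rintro s₂ t₂ hF₂ ⟨f, hf, hG₂, hL₂, ht₂⟩
  have h0₂ := (hF₂.var vN (by decide)).trans h0₁
  have hM₂ : IsVec (s₂.arr aMark) (fun _ : Fin n => 0) := by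
    rw [hF₂.arr _ (by decide)]; exact hM₁
  have hptr : J.PtrInv f (fun i => J.rk i (f i)) := fun x =>
    ⟨J.rk_lt _ _, le_rfl, fun j h1 h2 => absurd h1 (not_lt.2 h2)⟩
  refine wp_mono (wp_forLoop_potential (fun k s' => ∃ f G X,
      IsSearch J f G X 0 (s'.setVar vDepth 0) ∧ ∀ x : Fin n, x.val < k → ¬ J.IsLong f x)
    (fun _ s' => 1000 * slack n s') (fun _ => 400 * n + 110) (by decide) (by decide)
    (by decide) h0₂ (by omega) ?_ ?_) ?_
  · have hX : ∃ X : ℕ → Fin n, True := ⟨fun _ => ⟨0, hn⟩, trivial⟩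
    obtain ⟨X, -⟩ := hX
    refine ⟨f, _, X, ⟨hf, hptr, by simpa using h0₂, ?_, ?_, by simpa using hG₂, by simpa using hL₂,
      by simp, fun k hk => absurd hk (Nat.not_lt_zero _), fun k hk => absurd hk (Nat.not_lt_zero _),
      fun i _ => by simpa using hM₂ i, fun j hj => absurd hj (Nat.not_lt_zero _)⟩,
      fun x hx => absurd hx (Nat.not_lt_zero _)⟩
    · simp only [State.setVar_arr]; rw [hF₂.arr _ (by decide)]; exact hP₁
    · simp only [State.setVar_arr]; rw [hF₂.arr _ (by decide)]; exact hR₁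
  · rintro k s' hk hF hvk ⟨f', G', X', hS, hshort⟩
    refine wp_mono (searchProg_spec hW hS (x₀ := ⟨k, hk⟩) hvk) ?_
    rintro s'' t - ⟨f'', G'', X'', hS'', hx, hmono, ht⟩
    refine ⟨⟨f'', G'', X'', hS''.congr (by simp) (by simp [hS''.var_depth]), fun x hxk => ?_⟩, ?_⟩
    · by_cases hxe : x = ⟨k, hk⟩
      · rw [hxe]; exact hx
      · have : x.val ≠ k := fun h => hxe (Fin.ext h)
        exact fun h => hshort x (by omega) (hmono x h)
    · have hsl : slack n (s''.setVar vI (k + 1)) = slack n s'' := slack_congr (by simp)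
      omega
  · rintro s' t - ⟨⟨f', G', X', hS, hshort⟩, -, ht⟩
    refine ⟨f', hS.prestable.isStablePartition fun x => hshort x x.isLt,
      by simpa using hS.arr_last, ?_⟩
    have h1 : slack n (s₂.setVar vI 0) ≤ n * n := Nat.sub_le _ _
    simp only [Finset.sum_const, Finset.card_range, smul_eq_mul] at ht
    have h2 : n * (400 * n + 110 + 8) = 400 * (n * n) + 118 * n := by ring
    rw [h2] at ht
    omega

end RAM

/-! ### The program that tests whether given cycles are part of a stable partition -/

namespace RAM

/-- Variable: the answer of a test. -/
notation "vOk" => (12 : ℕ)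
/-- Array: the given preference lists. -/
notation "aList" => (0 : ℕ)
/-- Array: positions in the given preference lists. -/
notation "aPos" => (1 : ℕ)
/-- Array: the successors in the cycles to be tested. -/
notation "aSucc" => (13 : ℕ)
/-- Array: the predecessors in the cycles to be tested. -/
notation "aPred" => (14 : ℕ)
/-- Array: `1` for the agents in the cycles to be tested. -/
notation "aIn" => (15 : ℕ)
/-- Array: the thresholds that belong to the cycles to be tested. -/
notation "aTau" => (17 : ℕ)

open RAM.Program RAM.Expr

theorem eval_eq_ne_zero {s : State} {e f : Expr} :
    (Expr.eq e f).eval s ≠ 0 ↔ e.eval s = f.eval s := by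
  simp

theorem eval_eq_eq_zero {s : State} {e f : Expr} :
    (Expr.eq e f).eval s = 0 ↔ e.eval s ≠ f.eval s := by
  simp

theorem eval_lt_ne_zero {s : State} {e f : Expr} :
    (Expr.lt e f).eval s ≠ 0 ↔ e.eval s < f.eval s := by
  simp

theorem eval_lt_eq_zero {s : State} {e f : Expr} :
    (Expr.lt e f).eval s = 0 ↔ f.eval s ≤ e.eval s := by
  simp

/-- The position in the given list of agent `e` of agent `f`. -/
def pos (e f : Expr) : Expr := .read aPos (idx e f)

@[simp] theorem eval_pos (s : State) (e f : Expr) :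
    (pos e f).eval s = s.arr aPos (e.eval s * s.var vN + f.eval s) := rfl

@[simp] theorem cost_pos (e f : Expr) : (pos e f).cost = e.cost + f.cost + 4 := by
  simp [pos]

/-- Compute the thresholds. -/
def thresholdProg : Program :=
  forLoop vI vN (store aTau (.var vI) (.var vN - 1)) ;;
  forLoop vX vN (ite (.read aIn (.var vX))
    (forLoop vI vN
      (ite (.lt (pos (.var vX) (.var vI)) (pos (.var vX) (.read aPred (.var vX))))
        (ite (.lt (pos (.var vI) (.var vX)) (.read aTau (.var vI)))
          (store aTau (.var vI) (pos (.var vI) (.var vX))) .skip)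
        .skip))
    .skip)

/-- Whether the agents `vI` and `vJ` are good neighbours. -/
def goodExpr : Expr :=
  .read aIn (.var vI) *
      .lt 0 (.eq (.read aSucc (.var vI)) (.var vJ) + .eq (.read aPred (.var vI)) (.var vJ)) +
    (1 - .read aIn (.var vI)) * (1 - .read aIn (.var vJ)) *
      .lt (pos (.var vI) (.var vJ)) (.read aTau (.var vI)) *
      .lt (pos (.var vJ) (.var vI)) (.read aTau (.var vJ))

/-- Go once through the given list of `vI`, and append the good (`b = 1`) or the other (`b = 0`)
agents in it to the new list. -/
def fillProg (b : Expr) : Program :=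
  forLoop vOld vN
    (assign vJ (.read aList (idx (.var vI) (.var vOld))) ;;
    ite (.eq goodExpr b)
      (store aPref (idx (.var vI) (.var vR)) (.var vJ) ;;
      store aRank (idx (.var vI) (.var vJ)) (.var vR) ;;
      assign vR (.var vR + 1))
      .skip)

/-- Write down the instance in which every agent puts its good neighbours first. -/
def buildProg : Program :=
  forLoop vI vN (assign vR 0 ;; fillProg 1 ;; fillProg 0)

/-- Compare the stable partition found with the cycles to be tested. -/
def compareProg : Program :=
  assign vOk 1 ;;
  forLoop vI vN
    (assign vJ (.read aPref (idx (.var vI) (.read aLast (.var vI)))) ;;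
    ite (.read aIn (.var vI))
      (ite (.lt (.read aTau (.var vI)) (pos (.var vI) (.read aPred (.var vI))) +
          .lt (pos (.var vI) (.read aPred (.var vI))) (pos (.var vI) (.read aSucc (.var vI))))
        (assign vOk 0) .skip)
      (ite (goodExpr + .eq (.read aTau (.var vI)) (.var vN - 1)) .skip (assign vOk 0)))

/-- Test whether the given cycles are part of a stable partition. -/
def testProg : Program := thresholdProg ;; buildProg ;; solveProg ;; compareProg

variable {n W : ℕ} {I : SRInstance n} {c : Equiv.Perm (Fin n)} {s : State}

/-- The state holds the preference lists of `I` and the positions in them. -/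
structure HasLists (I : SRInstance n) (s : State) : Prop where
  var_n : s.var vN = n
  list : I.IsPref (s.arr aList)
  rank : IsTable (s.arr aPos) I.rk

theorem HasLists.congr {s' : State} (h : HasLists I s) (h0 : s'.var vN = s.var vN)
    (h1 : s'.arr aList = s.arr aList) (h2 : s'.arr aPos = s.arr aPos) : HasLists I s' :=
  ⟨h0.trans h.var_n, by rw [h1]; exact h.list, by rw [h2]; exact h.rank⟩

open Classical in
/-- The state holds the nontrivial cycles of the permutation `c`. -/
structure HasCycles (c : Equiv.Perm (Fin n)) (s : State) : Prop where
  mem : IsVec (s.arr aIn) fun i => if c i = i then 0 else 1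
  succ : ∀ i, c i ≠ i → s.arr aSucc i = c i
  pred : ∀ i, c i ≠ i → s.arr aPred i = c⁻¹ i

theorem HasCycles.congr {s' : State} (h : HasCycles c s)
    (h1 : s'.arr aIn = s.arr aIn) (h2 : s'.arr aSucc = s.arr aSucc)
    (h3 : s'.arr aPred = s.arr aPred) : HasCycles c s' :=
  ⟨by rw [h1]; exact h.mem, by rw [h2]; exact h.succ, by rw [h3]; exact h.pred⟩

/-- The condition of `IsThreshold` for a single agent. -/
def IsThresholdAt (I : SRInstance n) (c : Equiv.Perm (Fin n)) (k : ℕ) (i : Fin n) (t : ℕ) : Prop :=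
  t ≤ n - 1 ∧ (∀ u : Fin n, u.val < k → I.Courts c u i → t ≤ I.rk i u) ∧
    (t = n - 1 ∨ ∃ u : Fin n, u.val < k ∧ I.Courts c u i ∧ t = I.rk i u)

/-- The agent `u` does not lower the threshold of `i`. -/
theorem IsThresholdAt.succ_of_not_courts {i u : Fin n} {t : ℕ} (h : IsThresholdAt I c u i t)
    (hu : I.Courts c u i → t ≤ I.rk i u) : IsThresholdAt I c (u + 1) i t := by
  refine ⟨h.1, fun w hw hc => ?_, h.2.2.imp_right ?_⟩
  · by_cases hwu : w = u
    · subst hwu; exact hu hc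
    · have : w.val ≠ u.val := fun h => hwu (Fin.ext h)
      exact h.2.1 w (by omega) hc
  · rintro ⟨w, hw, hc⟩
    exact ⟨w, by omega, hc⟩

/-- The agent `u` lowers the threshold of `i`. -/
theorem IsThresholdAt.succ_of_courts {i u : Fin n} {t : ℕ} (h : IsThresholdAt I c u i t)
    (hu : I.Courts c u i) (hlt : I.rk i u < t) : IsThresholdAt I c (u + 1) i (I.rk i u) := by
  refine ⟨by have := h.1; omega, fun w hw hc => ?_, .inr ⟨u, by omega, hu, rfl⟩⟩
  by_cases hwu : w = u
  · rw [hwu]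
  · have : w.val ≠ u.val := fun h => hwu (Fin.ext h)
    exact hlt.le.trans (h.2.1 w (by omega) hc)

theorem thresholdProg_spec (hW : n * n + n < W) (hI : HasLists I s) (hc : HasCycles c s) :
    wp W thresholdProg (fun s' t => ∃ τ, IsVec (s'.arr aTau) τ ∧ I.IsThreshold c n τ ∧
      t ≤ 60 * (n * n) + 50 * n + 20) s := by
  refine wp_seq (wp_mono (wp_forLoop_const (fun k s' => ∀ i : Fin n, i.val < k →
    s'.arr aTau i = n - 1) 5 (by decide) (by decide)
    (by decide) hI.var_n (by omega) (fun i hi => absurd hi (Nat.not_lt_zero _)) ?_) ?_)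
  · intro k s' hk hF hvk hInv
    have h0' : s'.var vN = n := (hF.var _ (by decide)).trans hI.var_n
    refine wp_store (by simp; omega) (by simp; omega) ⟨fun i hi => ?_, by simp⟩
    by_cases hik : i.val = k
    · simp [hvk, h0', hik]
    · have := hInv i (by omega)
      simp [hvk, hik, this]
  rintro s₁ t₁ hF₁ ⟨hτ₁, -, ht₁⟩
  refine wp_mono (wp_forLoop_const (fun k s' => ∃ τ : Fin n → ℕ, IsVec (s'.arr aTau) τ ∧
    ∀ i, IsThresholdAt I c k i (τ i)) (n * 46 + 20) (by decide) (by decide) (by decide)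
    ((hF₁.var _ (by decide)).trans hI.var_n) (by omega)
    ⟨fun _ => n - 1, fun i => by simpa using hτ₁ i i.isLt,
      fun i => ⟨le_rfl, fun u hu => absurd hu (Nat.not_lt_zero _), .inl rfl⟩⟩ ?_) ?_
  · rintro k s' hk hF hvk ⟨τ, hτ, hthr⟩
    have hI' : HasLists I s' := hI.congr
      ((hF.var _ (by decide)).trans (hF₁.var _ (by decide)))
      ((hF.arr _ (by decide)).trans (hF₁.arr _ (by decide)))
      ((hF.arr _ (by decide)).trans (hF₁.arr _ (by decide)))
    have hc' : HasCycles c s' := hc.congr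
      ((hF.arr _ (by decide)).trans (hF₁.arr _ (by decide)))
      ((hF.arr _ (by decide)).trans (hF₁.arr _ (by decide)))
      ((hF.arr _ (by decide)).trans (hF₁.arr _ (by decide)))
    obtain ⟨u, rfl⟩ : ∃ u : Fin n, u.val = k := ⟨⟨k, hk⟩, rfl⟩
    have hmem := hc'.mem u
    refine wp_ite ?_ ?_
    · intro he
      have hu : c u ≠ u := by
        intro h
        simp [hvk, hmem, h] at he
      refine wp_mono (wp_forLoop_const (fun j s'' => ∃ τ : Fin n → ℕ, IsVec (s''.arr aTau) τ ∧
        ∀ i : Fin n, IsThresholdAt I c (if i.val < j then u + 1 else u) i (τ i)) 38 (by decide)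
        (by decide) (by decide) hI'.var_n (by omega) ⟨τ, by simpa using hτ, by simpa using hthr⟩
        ?_) ?_
      · rintro j s'' hj hF'' hvj ⟨τ, hτ, hthr⟩
        have h0'' : s''.var vN = n := (hF''.var _ (by decide)).trans hI'.var_n
        have hu'' : s''.var vX = u := (hF''.var _ (by decide)).trans hvk
        have hR'' : IsTable (s''.arr aPos) I.rk := by
          rw [hF''.arr _ (by decide)]; exact hI'.rank
        have hpred : s''.arr aPred u = c⁻¹ u := by
          rw [hF''.arr _ (by decide)]; exact hc'.pred u hu
        obtain ⟨i, rfl⟩ : ∃ i : Fin n, i.val = j := ⟨⟨j, hj⟩, rfl⟩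
        have hi := hthr i
        rw [if_neg (lt_irrefl _)] at hi
        have hrest : ∀ t, IsThresholdAt I c (u + 1) i t → ∀ k : Fin n,
            IsThresholdAt I c (if k.val < i + 1 then u + 1 else u) k
              (Function.update τ i t k) := by
          intro t ht k
          by_cases hk : k = i
          · subst hk; simpa using ht
          · rw [Function.update_of_ne hk]
            have hk' : k.val ≠ i.val := fun h => hk (Fin.ext h)
            have h1 := hthr k
            by_cases hlt : k.val < i.val
            · rw [if_pos hlt] at h1
              rw [if_pos (by omega)]; exact h1
            · rw [if_neg hlt] at h1
              rw [if_neg (by omega)]; exact h1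
        have hcourts : I.Courts c u i ↔ I.rk u i < I.rk u (c⁻¹ u) :=
          ⟨fun h => h.2, fun h => ⟨hu, h⟩⟩
        have hri := hR'' i u
        have hrl := I.rk_lt i u
        refine wp_ite ?_ ?_
        · intro he
          simp only [eval_lt, eval_pos, eval_var, eval_read, hu'', hvj, h0'', hpred, hR'' u i,
            hR'' u (c⁻¹ u)] at he
          have hcu : I.Courts c u i := hcourts.2 (by by_contra h; rw [if_neg h] at he; exact he rfl)
          refine wp_ite ?_ ?_
          · intro he
            simp only [eval_lt, eval_pos, eval_var, eval_read, hu'', hvj, h0'', hri, hτ i] at he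
            have hlt : I.rk i u < τ i := by by_contra h; simp [h] at he
            refine wp_store ?_ ?_ ⟨⟨_, ?_, hrest _ (hi.succ_of_courts hcu hlt)⟩, ?_⟩
            · simp [hvj]; omega
            · simp [hvj, hu'', h0'', hri]; omega
            · simpa [hvj, hu'', h0'', hri] using hτ.update i (I.rk i u)
            · simp
          · intro he
            simp only [eval_lt, eval_pos, eval_var, eval_read, hu'', hvj, h0'', hri, hτ i] at he
            have hlt : τ i ≤ I.rk i u := by by_contra h; simp [not_le.1 h] at he
            refine wp_skip ⟨⟨_, ?_, hrest _ (hi.succ_of_not_courts fun _ => hlt)⟩, by simp⟩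
            rw [Function.update_eq_self]; simpa using hτ
        · intro he
          simp only [eval_lt, eval_pos, eval_var, eval_read, hu'', hvj, h0'', hpred, hR'' u i,
            hR'' u (c⁻¹ u)] at he
          have hcu : ¬ I.Courts c u i := by
            rw [hcourts]; intro h; rw [if_pos h] at he; exact one_ne_zero he
          refine wp_skip ⟨⟨_, ?_, hrest _ (hi.succ_of_not_courts fun h => absurd h hcu)⟩, by simp⟩
          rw [Function.update_eq_self]; simpa using hτ
      · rintro s'' t - ⟨⟨τ, hτ, hthr⟩, -, ht⟩
        refine ⟨⟨τ, by simpa using hτ, fun i => ?_⟩, by simp; omega⟩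
        have := hthr i
        rwa [if_pos i.isLt] at this
    · intro he
      have hu : c u = u := by
        by_contra h
        simp [hvk, hmem, h] at he
      exact wp_skip ⟨⟨τ, by simpa using hτ, fun i =>
        (hthr i).succ_of_not_courts fun h => absurd hu h.1⟩, by simp⟩
  · rintro s' t - ⟨⟨τ, hτ, hthr⟩, -, ht⟩
    refine ⟨τ, hτ, fun i => hthr i, ?_⟩
    have h1 : n * (n * 46 + 20 + 8) = 46 * (n * n) + 28 * n := by ring
    rw [h1] at ht
    omega

end RAM

namespace RAM

open RAM.Program RAM.Expr

variable {n W : ℕ} {I : SRInstance n} {c : Equiv.Perm (Fin n)} {s : State} {τ : Fin n → ℕ}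

open Classical in
theorem eval_goodExpr (hI : HasLists I s) (hc : HasCycles c s) (hτ : IsVec (s.arr aTau) τ)
    {i j : Fin n} (hi : s.var vI = i) (hj : s.var vJ = j) :
    goodExpr.eval s = if I.Good c τ i j then 1 else 0 := by
  have h1 := hc.mem i
  have h2 := hc.mem j
  have h3 := hI.rank i j
  have h4 := hI.rank j i
  have h5 := hc.succ i
  have h6 := hc.pred i
  have h7 := hI.var_n
  by_cases hci : c i = i
  · have h8 : I.Good c τ i j ↔ (c j = j ∧ I.rk i j < τ i ∧ I.rk j i < τ j) := by
      simp [SRInstance.Good, hci]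
    by_cases hcj : c j = j <;> by_cases h9 : I.rk i j < τ i <;> by_cases h10 : I.rk j i < τ j <;>
      simp [goodExpr, hi, hj, h7, h1, h2, h3, h4, hτ i, hτ j, hci, hcj, h8, h9, h10]
  · have h8 : I.Good c τ i j ↔ ((c i).val = j ∨ (c⁻¹ i).val = j) := by
      simp [SRInstance.Good, hci, Fin.val_inj]
    have h5' := h5 hci
    have h6' := h6 hci
    by_cases h9 : (c i).val = j <;> by_cases h10 : (c⁻¹ i).val = j <;>
      simp only [goodExpr, eval_add, eval_mul, eval_sub, eval_lt, eval_eq, eval_read, eval_var,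
        eval_zero, eval_one, h8, h9, h10, hi, hj, h1, h5', h6', hci] <;> simp

@[simp] theorem cost_goodExpr : goodExpr.cost = 44 := by
  simp [goodExpr]

/-- The new lists are filled in for the agents before `i`, and for `i` itself up to the key `m`. -/
def IsFilled (J : SRInstance n) (key : Fin n → Fin n → ℕ) (i m : ℕ) (s : State) : Prop :=
  ∀ i' j' : Fin n, (i'.val < i ∨ (i'.val = i ∧ key i' j' < m)) →
    s.arr aPref (i' * n + J.rk i' j') = j' ∧ s.arr aRank (i' * n + j') = J.rk i' j'

open Classical in
/-- One pass over the given list of `i` appends the agents with keys from `m` to `m + n - 1` in the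
order of their keys: the good neighbours for `m = 0`, the others for `m = n`. -/
theorem fillProg_spec (hW : n * n + n < W) (hI : HasLists I s) (hc : HasCycles c s)
    (hτ : IsVec (s.arr aTau) τ) (hthr : I.IsThreshold c n τ) {i : Fin n} (hi : s.var vI = i)
    {b : Expr} {m : ℕ} (hb : (∀ s, b.eval s = 1) ∧ m = 0 ∨ (∀ s, b.eval s = 0) ∧ m = n)
    (hbc : b.cost = 1)
    (hR : s.var vR = (Finset.univ.filter fun j => I.goodKey c τ i j < m).card)
    (hfill : IsFilled (I.goodFirst c τ hthr) (I.goodKey c τ) i m s) :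
    wp W (fillProg b) (fun s' t =>
      s'.var vR = (Finset.univ.filter fun j => I.goodKey c τ i j < m + n).card ∧
      IsFilled (I.goodFirst c τ hthr) (I.goodKey c τ) i (m + n) s' ∧ t ≤ 90 * n + 6) s := by
  have hil := i.isLt
  refine wp_mono (wp_forLoop_const (fun k s' =>
    s'.var vR = (Finset.univ.filter fun j => I.goodKey c τ i j < m + k).card ∧
    IsFilled (I.goodFirst c τ hthr) (I.goodKey c τ) i (m + k) s') 82 (by simp [writtenVars])
    (by simp [writtenVars])
    (by decide) hI.var_n (by omega) ⟨by simpa using hR, by simpa [IsFilled] using hfill⟩ ?_) ?_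
  · rintro k s' hk hF hvk ⟨hR', hfill'⟩
    have hI' : HasLists I s' := hI.congr (hF.var _ (by simp [writtenVars, forLoop]))
      (hF.arr _ (by simp [writtenArrs, forLoop])) (hF.arr _ (by simp [writtenArrs, forLoop]))
    have hc' : HasCycles c s' := hc.congr (hF.arr _ (by simp [writtenArrs, forLoop]))
      (hF.arr _ (by simp [writtenArrs, forLoop])) (hF.arr _ (by simp [writtenArrs, forLoop]))
    have hτ' : IsVec (s'.arr aTau) τ := by
      rw [hF.arr _ (by simp [writtenArrs, forLoop])]; exact hτ
    have hi' : s'.var vI = i := (hF.var _ (by simp [writtenVars, forLoop])).trans hi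
    have h0 := hI'.var_n
    obtain ⟨j, hj⟩ := I.exists_rk i hk
    have hjl := j.isLt
    have hread : s'.arr aList (i * n + k) = j := by rw [← hj]; exact hI'.list i j
    -- The agent `j` is the only one that can have the key `m + k`, and has it in the right pass.
    have hkeyj : I.goodKey c τ i j = m + k ↔ ((if I.Good c τ i j then 1 else 0) = b.eval
        (s'.setVar vJ j)) := by
      unfold SRInstance.goodKey
      rcases hb with ⟨hb, rfl⟩ | ⟨hb, rfl⟩ <;> rw [hb] <;> split_ifs <;> simp [hj] <;> omega
    have huniq : ∀ j', I.goodKey c τ i j' = m + k → j' = j := by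
      intro j' h
      have h1 := I.rk_lt i j'
      rw [← SRInstance.rk_inj (I := I) (i := i), hj]
      unfold SRInstance.goodKey at h
      rcases hb with ⟨hb, rfl⟩ | ⟨hb, rfl⟩ <;> split_ifs at h <;> omega
    refine wp_seq (wp_assign (by simp [hi', h0, hvk, hread]; omega) ?_)
    simp only [eval_read, eval_idx, eval_var, hi', h0, hvk, hread]
    have hI₁ : HasLists I (s'.setVar vJ j) := hI'.congr (by simp) rfl rfl
    have hg := eval_goodExpr (s := s'.setVar vJ j) hI₁
      (hc'.congr rfl rfl rfl) (by simpa using hτ') (i := i) (j := j) (by simpa using hi') (by simp)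
    refine wp_ite ?_ ?_
    · intro he
      rw [eval_eq_ne_zero, hg, ← hkeyj] at he
      have hkey := he
      have hpos : (I.goodFirst c τ hthr).rk i j = s'.var vR := by
        rw [hR', ← hkey]; rfl
      have hposlt := (I.goodFirst c τ hthr).rk_lt i j
      have hcell := cell_lt hil hposlt
      have hcell' := cell_lt hil hjl
      have hcard : (Finset.univ.filter fun j' => I.goodKey c τ i j' < m + (k + 1)).card =
          s'.var vR + 1 := by
        rw [hR', ← Finset.card_insert_of_notMem (a := j) (by simp [hkey])]
        congr 1
        ext j'
        simp only [Finset.mem_filter, Finset.mem_univ, true_and, Finset.mem_insert]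
        constructor
        · intro h
          by_cases h' : I.goodKey c τ i j' = m + k
          · exact .inl (huniq _ h')
          · right; omega
        · rintro (rfl | h) <;> omega
      refine wp_seq (wp_store ?_ ?_ ?_)
      · simp [hi', h0, ← hpos]; omega
      · simp; omega
      refine wp_seq (wp_store ?_ ?_ ?_)
      · simp [hi', h0]; omega
      · simp [← hpos]; omega
      refine wp_assign ?_ ⟨⟨?_, ?_⟩, ?_⟩
      · simp [← hpos]; omega
      · simpa using hcard.symm
      · intro i' j' hcond
        by_cases hij : i' = i ∧ j' = j
        · obtain ⟨rfl, rfl⟩ := hij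
          simp [hi', h0, hpos]
        · have hold : i'.val < i ∨ (i'.val = i ∧ I.goodKey c τ i' j' < m + k) := by
            refine hcond.imp_right fun h => ⟨h.1, ?_⟩
            have hii : i' = i := Fin.ext h.1
            subst hii
            have : I.goodKey c τ i' j' ≠ m + k := fun h => hij ⟨rfl, huniq _ h⟩
            have := h.2
            omega
          have h1 : ¬ (i'.val * n + (I.goodFirst c τ hthr).rk i' j' = i * n + s'.var vR) := by
            rw [← hpos, cell_inj ((I.goodFirst c τ hthr).rk_lt _ _) hposlt, Fin.val_inj]
            rintro ⟨rfl, h⟩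
            exact hij ⟨rfl, SRInstance.rk_inj.1 h⟩
          have h2 : ¬ (i'.val * n + j'.val = i * n + j) := by
            rw [cell_inj j'.isLt hjl, Fin.val_inj, Fin.val_inj]
            exact hij
          have := hfill' i' j' hold
          simp [hi', h0, h1, h2, this]
      · simp [hbc]
    · intro he
      rw [eval_eq_eq_zero, hg, Ne, ← hkeyj] at he
      have hkey := he
      have hkey' : ∀ j', I.goodKey c τ i j' ≠ m + k := fun j' h => hkey (by
        rwa [huniq j' h] at h)
      refine wp_skip ⟨⟨?_, ?_⟩, by simp [hbc]⟩
      · have : (Finset.univ.filter fun j' => I.goodKey c τ i j' < m + (k + 1)) =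
            Finset.univ.filter fun j' => I.goodKey c τ i j' < m + k := by
          ext j'
          simp only [Finset.mem_filter, Finset.mem_univ, true_and]
          have := hkey' j'
          omega
        rw [this]
        simpa using hR'
      · intro i' j' hcond
        refine hfill' i' j' (hcond.imp_right fun h => ⟨h.1, ?_⟩)
        have hii : i' = i := Fin.ext h.1
        subst hii
        have := hkey' j'
        have := h.2
        omega
  · rintro s' t - ⟨⟨h1, h2⟩, -, ht⟩
    exact ⟨h1, h2, by omega⟩

theorem buildProg_spec (hW : n * n + n < W) (hI : HasLists I s) (hc : HasCycles c s)
    (hτ : IsVec (s.arr aTau) τ) (hthr : I.IsThreshold c n τ) :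
    wp W buildProg (fun s' t => (I.goodFirst c τ hthr).IsPref (s'.arr aPref) ∧
      IsTable (s'.arr aRank) (I.goodFirst c τ hthr).rk ∧ t ≤ 180 * (n * n) + 30 * n + 6) s := by
  refine wp_mono (wp_forLoop_const (fun k s' =>
    IsFilled (I.goodFirst c τ hthr) (I.goodKey c τ) k 0 s') (180 * n + 20) (by decide) (by decide)
    (by decide) hI.var_n (by omega) ?_ ?_) ?_
  · rintro i' j' (h | h)
    · exact absurd h (Nat.not_lt_zero _)
    · exact absurd h.2 (Nat.not_lt_zero _)
  · rintro k s' hk hF hvk hfill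
    obtain ⟨i, rfl⟩ : ∃ i : Fin n, i.val = k := ⟨⟨k, hk⟩, rfl⟩
    have hI' : HasLists I (s'.setVar vR 0) := hI.congr (by simpa using hF.var _ (by decide))
      (hF.arr _ (by decide)) (hF.arr _ (by decide))
    have hc' : HasCycles c (s'.setVar vR 0) := hc.congr (hF.arr _ (by decide))
      (hF.arr _ (by decide)) (hF.arr _ (by decide))
    have hτ' : IsVec ((s'.setVar vR 0).arr aTau) τ := by
      rw [State.setVar_arr, hF.arr _ (by decide)]; exact hτ
    refine wp_seq (wp_assign (by simp; omega) ?_)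
    simp only [eval_zero, cost_zero]
    refine wp_seq (wp_mono (fillProg_spec hW hI' hc' hτ' hthr (i := i) (by simpa using hvk)
      (b := 1) (m := 0) (.inl ⟨fun _ => rfl, rfl⟩) rfl (by simp) hfill) ?_)
    rintro s₁ t₁ hF₁ ⟨hR₁, hfill₁, ht₁⟩
    rw [zero_add] at hR₁ hfill₁
    refine wp_mono (fillProg_spec hW
      (hI'.congr (hF₁.var _ (by decide)) (hF₁.arr _ (by decide)) (hF₁.arr _ (by decide)))
      (hc'.congr (hF₁.arr _ (by decide)) (hF₁.arr _ (by decide)) (hF₁.arr _ (by decide)))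
      (by rw [hF₁.arr _ (by decide)]; exact hτ') hthr (i := i)
      ((hF₁.var _ (by decide)).trans (by simpa using hvk))
      (b := 0) (m := n) (.inr ⟨fun _ => rfl, rfl⟩) rfl hR₁ hfill₁) ?_
    rintro s₂ t₂ hF₂ ⟨hR₂, hfill₂, ht₂⟩
    refine ⟨fun i' j' h => hfill₂ i' j' ?_, by omega⟩
    have h1 := I.rk_lt i' j'
    have h2 : I.goodKey c τ i' j' < n + n := by
      unfold SRInstance.goodKey
      split_ifs <;> omega
    omega
  · rintro s' t - ⟨h, -, ht⟩
    refine ⟨fun i j => (h i j (.inl i.isLt)).1, fun i j => (h i j (.inl i.isLt)).2, ?_⟩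
    have h1 : n * (180 * n + 20 + 8) = 180 * (n * n) + 28 * n := by ring
    rw [h1] at ht
    omega

open Classical in
theorem compareProg_spec (hn : 0 < n) (hW : n * n + n < W) (hI : HasLists I s)
    (hc : HasCycles c s) (hτ : IsVec (s.arr aTau) τ) (hthr : I.IsThreshold c n τ)
    {p : Equiv.Perm (Fin n)} (hP : (I.goodFirst c τ hthr).IsPref (s.arr aPref))
    (hL : IsVec (s.arr aLast) fun j => (I.goodFirst c τ hthr).rk j (p⁻¹ j)) :
    wp W compareProg (fun s' t => (s'.var vOk = 0 ↔ ¬ ∀ i, I.Compatible c τ p i) ∧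
      t ≤ 120 * n + 20) s := by
  refine wp_seq (wp_assign (by simp; omega) ?_)
  simp only [eval_one, cost_one]
  refine wp_mono (wp_forLoop_const (fun k s' =>
    (s'.var vOk = 0 ↔ ¬ ∀ i : Fin n, i.val < k → I.Compatible c τ p i)) 111 (by decide) (by decide)
    (by decide) (by simpa using hI.var_n) (by omega) (by simp) ?_) ?_
  · rintro k s' hk hF hvk hok
    obtain ⟨i, rfl⟩ : ∃ i : Fin n, i.val = k := ⟨⟨k, hk⟩, rfl⟩
    have hI' : HasLists I s' := hI.congr
      ((hF.var _ (by decide)).trans (by simp)) (hF.arr _ (by decide)) (hF.arr _ (by decide))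
    have hc' : HasCycles c s' := hc.congr (hF.arr _ (by decide))
      (hF.arr _ (by decide)) (hF.arr _ (by decide))
    have hτ' : IsVec (s'.arr aTau) τ := by rw [hF.arr _ (by decide)]; exact hτ
    have hL' := hL i
    have hP' := hP i (p⁻¹ i)
    rw [← State.setVar_arr s vOk 1, ← hF.arr _ (by decide)] at hL' hP'
    have h0 := hI'.var_n
    have hlt := (p⁻¹ i).isLt
    have hsucc : (∀ i' : Fin n, i'.val < i + 1 → I.Compatible c τ p i') ↔
        (∀ i' : Fin n, i'.val < i → I.Compatible c τ p i') ∧ I.Compatible c τ p i := by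
      refine ⟨fun h => ⟨fun i' hi' => h i' (by omega), h i (by omega)⟩, fun h i' hi' => ?_⟩
      by_cases hii : i' = i
      · rw [hii]; exact h.2
      · have : i'.val ≠ i.val := fun h => hii (Fin.ext h)
        exact h.1 i' (by omega)
    refine wp_seq (wp_assign (by simp [hvk, h0, hL', hP', -Equiv.Perm.coe_inv]; omega) ?_)
    simp only [eval_read, eval_idx, eval_var, hvk, h0, hL', hP']
    have hmem := hc'.mem i
    have hgood := eval_goodExpr (s := s'.setVar vJ (p⁻¹ i)) (hI'.congr (by simp) rfl rfl)
      (hc'.congr rfl rfl rfl) (by simpa using hτ') (i := i) (j := p⁻¹ i) (by simpa using hvk)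
      (by simp)
    -- Whether agent `i` passes is decided by the condition of one of the two branches.
    have hyes : I.Compatible c τ p i → ∀ t ≤ 110, wp W .skip (fun s'' t' =>
        ((s''.setVar vI (i + 1)).var vOk = 0 ↔
          ¬ ∀ i' : Fin n, i'.val < i + 1 → I.Compatible c τ p i') ∧ t + t' ≤ 111)
          (s'.setVar vJ (p⁻¹ i)) := fun h t ht => by
      refine wp_skip ⟨?_, by omega⟩
      rw [hsucc, and_iff_left h, ← hok]
      simp
    have hno : ¬ I.Compatible c τ p i → ∀ t ≤ 100, wp W (assign vOk 0) (fun s'' t' =>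
        ((s''.setVar vI (i + 1)).var vOk = 0 ↔
          ¬ ∀ i' : Fin n, i'.val < i + 1 → I.Compatible c τ p i') ∧ t + t' ≤ 111)
          (s'.setVar vJ (p⁻¹ i)) := fun h t ht => by
      refine wp_assign (by simp; omega) ⟨?_, by simp; omega⟩
      rw [hsucc]
      simp [h]
    refine wp_ite ?_ ?_
    · intro he
      have hci : c i ≠ i := by
        intro h
        simp [hvk, hmem, h] at he
      have hcomp : I.Compatible c τ p i ↔
          I.rk i (c⁻¹ i) ≤ τ i ∧ I.rk i (c i) ≤ I.rk i (c⁻¹ i) := by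
        simp [SRInstance.Compatible, hci]
      have hv : (Expr.lt (.read aTau (.var vI)) (pos (.var vI) (.read aPred (.var vI))) +
          .lt (pos (.var vI) (.read aPred (.var vI)))
            (pos (.var vI) (.read aSucc (.var vI)))).eval (s'.setVar vJ (p⁻¹ i)) =
          (if τ i < I.rk i (c⁻¹ i) then 1 else 0) +
            (if I.rk i (c⁻¹ i) < I.rk i (c i) then 1 else 0) := by
        simp [hvk, h0, hτ' i, hc'.pred i hci, hc'.succ i hci, hI'.rank i (c⁻¹ i),
          hI'.rank i (c i), -Equiv.Perm.coe_inv]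
      refine wp_ite ?_ ?_
      · intro he'
        rw [hv] at he'
        have hnc : ¬ I.Compatible c τ p i := by
          rw [hcomp]
          rintro ⟨h1, h2⟩
          rw [if_neg (not_lt.2 h1), if_neg (not_lt.2 h2)] at he'
          exact he' rfl
        exact wp_mono (hno hnc 100 le_rfl) fun s'' t _ h => ⟨h.1, by have := h.2; simp; omega⟩
      · intro he'
        rw [hv] at he'
        have hyc : I.Compatible c τ p i := by
          rw [hcomp]
          constructor <;> by_contra h <;> rw [not_le] at h <;> simp [h, -Equiv.Perm.coe_inv] at he'
        exact wp_mono (hyes hyc 110 le_rfl) fun s'' t _ h => ⟨h.1, by have := h.2; simp; omega⟩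
    · intro he
      have hci : c i = i := by
        by_contra h
        simp [hvk, hmem, h] at he
      have hcomp : I.Compatible c τ p i ↔ I.Good c τ i (p⁻¹ i) ∨ τ i = n - 1 := by
        simp [SRInstance.Compatible, hci]
      have hv : (goodExpr + .eq (.read aTau (.var vI)) (.var vN - 1)).eval (s'.setVar vJ (p⁻¹ i)) =
          (if I.Good c τ i (p⁻¹ i) then 1 else 0) + (if τ i = n - 1 then 1 else 0) := by
        rw [eval_add, hgood]
        simp [hvk, h0, hτ' i]
      refine wp_ite ?_ ?_
      · intro he'
        rw [hv] at he'
        have hyc : I.Compatible c τ p i := by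
          rw [hcomp]
          by_contra h
          rw [not_or] at h
          rw [if_neg h.1, if_neg h.2] at he'
          exact he' rfl
        exact wp_mono (hyes hyc 110 le_rfl) fun s'' t _ h => ⟨h.1, by have := h.2; simp; omega⟩
      · intro he'
        rw [hv] at he'
        have hnc : ¬ I.Compatible c τ p i := by
          rw [hcomp]
          rintro (h | h) <;> rw [if_pos h] at he' <;> omega
        exact wp_mono (hno hnc 100 le_rfl) fun s'' t _ h => ⟨h.1, by have := h.2; simp; omega⟩
  · rintro s' t - ⟨hok, -, ht⟩
    exact ⟨by simpa using hok, by omega⟩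

/-- The test decides whether the nontrivial cycles of `c` are part of a stable partition. -/
theorem testProg_spec (hn : 0 < n) (hW : n * n + n < W) (hI : HasLists I s)
    (hc : HasCycles c s) :
    wp W testProg (fun s' t =>
      (s'.var vOk ≠ 0 ↔ ∃ q, I.IsStablePartition q ∧ ∀ i, c i ≠ i → q i = c i) ∧
      t ≤ 2400 * (n * n)) s := by
  refine wp_seq (wp_mono (thresholdProg_spec hW hI hc) ?_)
  rintro s₁ t₁ hF₁ ⟨τ, hτ, hthr, ht₁⟩
  have hI₁ : HasLists I s₁ :=
    hI.congr (hF₁.var _ (by decide)) (hF₁.arr _ (by decide)) (hF₁.arr _ (by decide))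
  have hc₁ : HasCycles c s₁ :=
    hc.congr (hF₁.arr _ (by decide)) (hF₁.arr _ (by decide)) (hF₁.arr _ (by decide))
  refine wp_seq (wp_mono (buildProg_spec hW hI₁ hc₁ hτ hthr) ?_)
  rintro s₂ t₂ hF₂ ⟨hP, hR, ht₂⟩
  have hI₂ : HasLists I s₂ :=
    hI₁.congr (hF₂.var _ (by decide)) (hF₂.arr _ (by decide)) (hF₂.arr _ (by decide))
  have hc₂ : HasCycles c s₂ :=
    hc₁.congr (hF₂.arr _ (by decide)) (hF₂.arr _ (by decide)) (hF₂.arr _ (by decide))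
  refine wp_seq (wp_mono (solveProg_spec hn hW hI₂.var_n hP hR) ?_)
  rintro s₃ t₃ hF₃ ⟨p, hp, hL, ht₃⟩
  refine wp_mono (compareProg_spec hn hW
    (hI₂.congr (hF₃.var _ (by decide)) (hF₃.arr _ (by decide)) (hF₃.arr _ (by decide)))
    (hc₂.congr (hF₃.arr _ (by decide)) (hF₃.arr _ (by decide)) (hF₃.arr _ (by decide)))
    (τ := τ) (by rw [hF₃.arr _ (by decide), hF₂.arr _ (by decide)]; exact hτ) hthr (p := p)
    (by rw [hF₃.arr _ (by decide)]; exact hP) hL) ?_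
  rintro s₄ t₄ - ⟨hok, ht₄⟩
  refine ⟨?_, ?_⟩
  · rw [Ne, hok, not_not, SRInstance.compatible_iff hthr hp]
  · have : n ≤ n * n := Nat.le_mul_self n
    omega

end RAM

/-! ### Stable cycles as orbits -/

open Function

section Orbits

variable {α : Type*} {p : Equiv.Perm α} {v : ℕ → α} {M : ℕ}

theorem iterate_eq_of_step (hstep : ∀ k, k + 1 < M → p (v k) = v (k + 1)) {k : ℕ} (hk : k < M) :
    p^[k] (v 0) = v k := by
  induction k with
  | zero => rfl
  | succ k ih => rw [iterate_succ_apply', ih (by omega), hstep k hk]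

/-- If `p` maps `v 0 ↦ v 1 ↦ ⋯ ↦ v (M - 1) ↦ v 0` and these are distinct, they are an orbit. -/
theorem minimalPeriod_eq_of_step (hM : 0 < M) (hv : ∀ j < M, ∀ k < M, v j = v k → j = k)
    (hstep : ∀ k, k + 1 < M → p (v k) = v (k + 1)) (hlast : p (v (M - 1)) = v 0) :
    minimalPeriod p (v 0) = M := by
  have hper : p^[M] (v 0) = v 0 := by
    obtain ⟨m, rfl⟩ : ∃ m, M = m + 1 := ⟨M - 1, by omega⟩
    rw [iterate_succ_apply', iterate_eq_of_step hstep (by omega)]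
    exact hlast
  have hle : minimalPeriod p (v 0) ≤ M := IsPeriodicPt.minimalPeriod_le hM hper
  have hpos : 0 < minimalPeriod p (v 0) := IsPeriodicPt.minimalPeriod_pos hM hper
  by_contra hne
  have hlt : minimalPeriod p (v 0) < M := by omega
  have h := iterate_eq_of_step hstep hlt
  rw [iterate_minimalPeriod] at h
  have := hv _ hM _ hlt h
  omega

theorem periodicOrbit_eq_of_step (hM : 0 < M) (hv : ∀ j < M, ∀ k < M, v j = v k → j = k)
    (hstep : ∀ k, k + 1 < M → p (v k) = v (k + 1)) (hlast : p (v (M - 1)) = v 0) :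
    periodicOrbit p (v 0) = ((List.range M).map v : Cycle α) := by
  rw [periodicOrbit_def, minimalPeriod_eq_of_step hM hv hstep hlast]
  congr 1
  refine List.map_congr_left fun k hk => ?_
  exact iterate_eq_of_step hstep (List.mem_range.1 hk)

/-- A relation along a cycle that is given by an enumeration: the steps, and the closing one. -/
theorem chain_map_range_iff (r : α → α → Prop) (hM : 0 < M) :
    Cycle.Chain r ((List.range M).map v : Cycle α) ↔
      (∀ k, k + 1 < M → r (v k) (v (k + 1))) ∧ r (v (M - 1)) (v 0) := by
  obtain ⟨m, rfl⟩ : ∃ m, M = m + 1 := ⟨M - 1, by omega⟩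
  rw [← Cycle.map_coe, Cycle.chain_map, Cycle.chain_range_succ, and_comm]
  refine and_congr (forall_congr' fun k => ?_) Iff.rfl
  rw [Nat.add_lt_add_iff_right]

theorem mem_periodicPts_perm [Finite α] (p : Equiv.Perm α) (x : α) : x ∈ periodicPts p :=
  p.injective.mem_periodicPts x

theorem minimalPeriod_iterate [Finite α] (p : Equiv.Perm α) (x : α) (k : ℕ) :
    minimalPeriod p (p^[k] x) = minimalPeriod p x :=
  minimalPeriod_apply_iterate (mem_periodicPts_perm p x) k

end Orbits

namespace SRInstance

variable {n : ℕ} {I : SRInstance n} {p q : Equiv.Perm (Fin n)}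

theorem isCycleOf_periodicOrbit (p : Equiv.Perm (Fin n)) (x : Fin n) :
    IsCycleOf (periodicOrbit p x) p := by
  refine ⟨?_, nodup_periodicOrbit, ?_⟩
  · rw [Ne, periodicOrbit_eq_nil_iff_not_periodic_pt, not_not]
    exact mem_periodicPts_perm p x
  · rw [periodicOrbit_chain]
    exact fun k _ => (iterate_succ_apply' p k x).symm

/-- Every cycle of a permutation is the orbit of an agent. -/
theorem IsCycleOf.exists_eq_periodicOrbit {C : Cycle (Fin n)} (h : IsCycleOf C p) :
    ∃ x, C = periodicOrbit p x := by
  obtain ⟨h1, h2, h3⟩ := h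
  induction C using Quotient.inductionOn' with
  | h l =>
  change (l : Cycle (Fin n)) ≠ Cycle.nil at h1
  change Cycle.Nodup (l : Cycle (Fin n)) at h2
  change Cycle.Chain _ (l : Cycle (Fin n)) at h3
  rw [Cycle.nodup_coe_iff] at h2
  have hl : l ≠ [] := by simpa using h1
  have hpos := List.length_pos_iff.2 hl
  set v : ℕ → Fin n := fun k => l.getD k (l.head hl) with hv
  have hget : ∀ k (hk : k < l.length), v k = l[k] := fun k hk => by simp [hv, hk]
  have hlv : l = (List.range l.length).map v := by
    refine List.ext_getElem (by simp) fun k hk hk' => ?_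
    rw [List.getElem_map, List.getElem_range, hget k hk]
  rw [hlv] at h3
  rw [chain_map_range_iff _ hpos] at h3
  refine ⟨v 0, ?_⟩
  rw [periodicOrbit_eq_of_step hpos (fun j hj k hk hjk => ?_) h3.1 h3.2, ← hlv]
  · rfl
  · rw [hget j hj, hget k hk] at hjk
    exact (h2.getElem_inj_iff).1 hjk

theorem mem_SC_iff {C : Cycle (Fin n)} :
    C ∈ I.SC ↔ ∃ p, I.IsStablePartition p ∧ ∃ x, C = periodicOrbit p x := by
  refine exists_congr fun p => and_congr_right fun _ => ⟨fun h => h.exists_eq_periodicOrbit, ?_⟩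
  rintro ⟨x, rfl⟩
  exact isCycleOf_periodicOrbit p x

/-- Stable partitions agree on odd cycles. -/
theorem IsStablePartition.iterate_eq (hp : I.IsStablePartition p) (hq : I.IsStablePartition q)
    {x : Fin n} (hx : Odd (minimalPeriod p x)) (k : ℕ) : q^[k] x = p^[k] x := by
  induction k with
  | zero => rfl
  | succ k ih =>
    rw [iterate_succ_apply', iterate_succ_apply', ih]
    refine hp.eq_on_odd_cycle hq (m := minimalPeriod p x) hx ?_
    rw [← minimalPeriod_iterate p x k, ← Equiv.Perm.iterate_eq_pow, iterate_minimalPeriod]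

theorem IsStablePartition.minimalPeriod_eq (hp : I.IsStablePartition p)
    (hq : I.IsStablePartition q) {x : Fin n} (hx : Odd (minimalPeriod p x)) :
    minimalPeriod q x = minimalPeriod p x := by
  rw [minimalPeriod_eq_minimalPeriod_iff]
  intro k
  rw [IsPeriodicPt, IsFixedPt, hp.iterate_eq hq hx, IsPeriodicPt, IsFixedPt]

theorem IsStablePartition.periodicOrbit_eq (hp : I.IsStablePartition p)
    (hq : I.IsStablePartition q) {x : Fin n} (hx : Odd (minimalPeriod p x)) :
    periodicOrbit q x = periodicOrbit p x := by
  rw [periodicOrbit_def, periodicOrbit_def, hp.minimalPeriod_eq hq hx]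
  congr 1
  exact List.map_congr_left fun k _ => hp.iterate_eq hq hx k

theorem IsStablePartition.odd_iff (hp : I.IsStablePartition p) (hq : I.IsStablePartition q)
    {x : Fin n} : Odd (minimalPeriod q x) ↔ Odd (minimalPeriod p x) :=
  ⟨fun h => by rwa [hq.minimalPeriod_eq hp h], fun h => by rwa [hp.minimalPeriod_eq hq h]⟩

theorem IsStablePartition.even_iff (hp : I.IsStablePartition p) (hq : I.IsStablePartition q)
    {x : Fin n} : Even (minimalPeriod q x) ↔ Even (minimalPeriod p x) := by
  rw [← Nat.not_odd_iff_even, ← Nat.not_odd_iff_even, hp.odd_iff hq]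

theorem IsStablePartition.mem_oddAgents_iff (hp : I.IsStablePartition p) {x : Fin n} :
    x ∈ I.oddAgents ↔ Odd (minimalPeriod p x) := by
  constructor
  · rintro ⟨C, hC, hodd, hx⟩
    obtain ⟨q, hq, y, rfl⟩ := mem_SC_iff.1 hC
    rw [mem_periodicOrbit_iff (mem_periodicPts_perm q y)] at hx
    obtain ⟨k, rfl⟩ := hx
    rw [periodicOrbit_length, ← minimalPeriod_iterate q y k] at hodd
    exact (hq.odd_iff hp).2 hodd
  · intro h
    exact ⟨periodicOrbit p x, mem_SC_iff.2 ⟨p, hp, x, rfl⟩, by rwa [periodicOrbit_length],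
      self_mem_periodicOrbit (mem_periodicPts_perm p x)⟩

/-- The number `n₁` counts the agents on the even cycles of any stable partition. -/
theorem IsStablePartition.n₁_eq (hp : I.IsStablePartition p) :
    I.n₁ = (Finset.univ.filter fun x => Even (minimalPeriod p x)).card := by
  have h1 : I.oddAgents = ↑(Finset.univ.filter fun x => ¬ Even (minimalPeriod p x)) := by
    ext x
    rw [hp.mem_oddAgents_iff]
    simp
  have h2 := Finset.card_filter_add_card_filter_not (s := (Finset.univ : Finset (Fin n)))
    (fun x => Even (minimalPeriod p x))
  rw [n₁, n₂, h1, Set.ncard_coe_finset]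
  simp only [Finset.card_univ, Fintype.card_fin] at h2
  omega

/-- `{a, b}` is a pair of partners in a stable partition. -/
def StablePair (I : SRInstance n) (a b : Fin n) : Prop :=
  a ≠ b ∧ ∃ q, I.IsStablePartition q ∧ q a = b ∧ q b = a

theorem StablePair.symm {a b : Fin n} (h : I.StablePair a b) : I.StablePair b a :=
  ⟨h.1.symm, h.2.imp fun _ h => ⟨h.1, h.2.2, h.2.1⟩⟩

theorem minimalPeriod_eq_two {a b : Fin n} (hab : a ≠ b) (h1 : q a = b) (h2 : q b = a) :
    minimalPeriod q a = 2 := by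
  refine minimalPeriod_eq_of_step (v := fun k => if k = 0 then a else b) (by omega) ?_ ?_ ?_
  · intro j hj k hk hjk
    interval_cases j <;> interval_cases k <;> simp_all
  · intro k hk
    have : k = 0 := by omega
    simp [this, h1]
  · simp [h2]

theorem StablePair.even (hp : I.IsStablePartition p) {a b : Fin n} (h : I.StablePair a b) :
    Even (minimalPeriod p a) := by
  obtain ⟨hab, q, hq, h1, h2⟩ := h
  rw [hq.even_iff hp, minimalPeriod_eq_two hab h1 h2]
  exact even_two

/-- Neighbours on an even cycle are partners in another stable partition, which contains every
other edge of the cycle. -/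
theorem IsStablePartition.stablePair_apply (hp : I.IsStablePartition p) {a : Fin n}
    (ha : Even (minimalPeriod p a)) : I.StablePair a (p a) := by
  have hz : ∀ k : ℤ, (p ^ k) a = a → Even k := by
    intro k hk
    have h1 := (MulAction.zpow_smul_eq_iff_minimalPeriod_dvd (a := p) (b := a) (n := k)).1 hk
    exact (even_iff_two_dvd.2 ((Int.natCast_dvd_natCast.2 ha.two_dvd).trans h1))
  obtain ⟨q, hq, h1, h2⟩ := hp.exists_transposition hz
  refine ⟨fun h => ?_, q, hq, h1, h2⟩
  have := hz 1 (by simpa using h.symm)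
  simp at this

/-- Among the partners of `b` in stable partitions, `z` is the next better one after `a`. -/
def IsNext (I : SRInstance n) (b a z : Fin n) : Prop :=
  I.StablePair b z ∧ I.rk b z < I.rk b a ∧
    ∀ z', I.StablePair b z' → I.rk b z' < I.rk b a → I.rk b z' ≤ I.rk b z

theorem IsNext.unique {b a z z' : Fin n} (h : I.IsNext b a z) (h' : I.IsNext b a z') : z = z' :=
  rk_inj.1 (le_antisymm (h'.2.2 _ h.1 h.2.1) (h.2.2 _ h'.1 h'.2.1))

/-- On an even cycle of length greater than two, the predecessor of an agent determines its
successor. -/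
theorem IsStablePartition.isNext (hp : I.IsStablePartition p) {b : Fin n}
    (hb : Even (minimalPeriod p b)) (hne : p b ≠ p⁻¹ b) : I.IsNext b (p⁻¹ b) (p b) := by
  refine ⟨hp.stablePair_apply hb, lt_of_le_of_ne (hp.succ_le b) fun h => hne (rk_inj.1 h), ?_⟩
  rintro z ⟨hbz, q, hq, h1, h2⟩ hlt
  by_contra hlt'
  rw [not_le] at hlt'
  have := hp.pred_le_of_succ_lt hq (v := b) (by rwa [h1])
  rw [h1] at this
  omega

/-- `C` is a stable cycle, its least agent is `a`, and `b` comes after `a`. -/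
def IsStableCycle (I : SRInstance n) (C : Cycle (Fin n)) (a b : Fin n) : Prop :=
  ∃ p, I.IsStablePartition p ∧ C = periodicOrbit p a ∧ p a = b ∧ ∀ k, a ≤ p^[k] a

theorem exists_isStableCycle {C : Cycle (Fin n)} (h : C ∈ I.SC) : ∃ a b, I.IsStableCycle C a b := by
  obtain ⟨p, hp, x, rfl⟩ := mem_SC_iff.1 h
  obtain ⟨k, hk⟩ : ∃ k, ∀ j, p^[k] x ≤ p^[j] x := by
    obtain ⟨y, ⟨k, rfl⟩, hy⟩ := Set.exists_min_image (Set.range fun k => p^[k] x) id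
      (Set.toFinite _) ⟨_, 0, rfl⟩
    exact ⟨k, fun j => hy _ ⟨j, rfl⟩⟩
  refine ⟨p^[k] x, _, p, hp, (periodicOrbit_apply_iterate_eq (mem_periodicPts_perm p x) k).symm,
    rfl, fun j => ?_⟩
  rw [← iterate_add_apply]
  exact hk _

theorem IsStableCycle.mem_SC {C : Cycle (Fin n)} {a b : Fin n} (h : I.IsStableCycle C a b) :
    C ∈ I.SC := by
  obtain ⟨p, hp, hC, -⟩ := h
  exact mem_SC_iff.2 ⟨p, hp, a, hC⟩

/-- Least agent and second agent are determined by the cycle, so that enumeration by these pairs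
lists no cycle twice. -/
theorem IsStableCycle.unique {C : Cycle (Fin n)} {a b a' b' : Fin n}
    (h : I.IsStableCycle C a b) (h' : I.IsStableCycle C a' b') : a = a' ∧ b = b' := by
  obtain ⟨p, hp, hC, rfl, hmin⟩ := h
  obtain ⟨q, hq, hC', rfl, hmin'⟩ := h'
  have h1 : a ∈ C := hC ▸ self_mem_periodicOrbit (mem_periodicPts_perm p a)
  have h2 : a' ∈ C := hC' ▸ self_mem_periodicOrbit (mem_periodicPts_perm q a')
  rw [hC', mem_periodicOrbit_iff (mem_periodicPts_perm q a')] at h1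
  rw [hC, mem_periodicOrbit_iff (mem_periodicPts_perm p a)] at h2
  obtain ⟨j, hj⟩ := h1
  obtain ⟨k, hk⟩ := h2
  have haa : a = a' := le_antisymm (hk ▸ hmin k) (hj ▸ hmin' j)
  subst haa
  have h3 := (isCycleOf_periodicOrbit q a).2.2
  rw [← hC', hC, periodicOrbit_chain] at h3
  exact ⟨rfl, (h3 0 (minimalPeriod_pos_of_mem_periodicPts (mem_periodicPts_perm p a))).symm⟩

/-- The stable cycles with a length in `A` whose least agent `a` and whose second agent `b` are
lexicographically before `(k, j)`. -/
def cyclesBefore (I : SRInstance n) (A : Set ℕ) (k j : ℕ) : Set (Cycle (Fin n)) :=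
  {C | C.length ∈ A ∧ ∃ a b, I.IsStableCycle C a b ∧ (a.val < k ∨ a.val = k ∧ b.val < j)}

theorem cyclesBefore_zero (A : Set ℕ) : I.cyclesBefore A 0 0 = ∅ := by
  ext C
  simp [cyclesBefore]

theorem cyclesBefore_row (A : Set ℕ) (k : ℕ) :
    I.cyclesBefore A (k + 1) 0 = I.cyclesBefore A k n := by
  ext C
  refine and_congr_right fun _ => exists_congr fun a => exists_congr fun b =>
    and_congr_right fun _ => ?_
  have := b.isLt
  omega

theorem cyclesBefore_succ (A : Set ℕ) (x y : Fin n) : I.cyclesBefore A x (y + 1) =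
    I.cyclesBefore A x y ∪ {C | C.length ∈ A ∧ I.IsStableCycle C x y} := by
  ext C
  constructor
  · rintro ⟨hA, a, b, h, hab⟩
    by_cases h' : a = x ∧ b = y
    · obtain ⟨rfl, rfl⟩ := h'
      exact .inr ⟨hA, h⟩
    · rw [← Fin.val_inj, ← Fin.val_inj] at h'
      exact .inl ⟨hA, a, b, h, by omega⟩
  · rintro (⟨hA, a, b, h, hab⟩ | ⟨hA, h⟩)
    · exact ⟨hA, a, b, h, by omega⟩
    · exact ⟨hA, x, y, h, by omega⟩

theorem IsStableCycle.notMem_cyclesBefore {C : Cycle (Fin n)} {x y : Fin n}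
    (h : I.IsStableCycle C x y) (A : Set ℕ) : C ∉ I.cyclesBefore A x y := by
  rintro ⟨-, a, b, h', hab⟩
  obtain ⟨rfl, rfl⟩ := h.unique h'
  omega

theorem mem_cyclesBefore_all {A : Set ℕ} {C : Cycle (Fin n)} :
    C ∈ I.cyclesBefore A n 0 ↔ C ∈ I.SC ∧ C.length ∈ A := by
  constructor
  · rintro ⟨hA, a, b, h, -⟩
    exact ⟨h.mem_SC, hA⟩
  · rintro ⟨h, hA⟩
    obtain ⟨a, b, hab⟩ := exists_isStableCycle h
    exact ⟨hA, a, b, hab, .inl a.isLt⟩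

/-- A list of distinct agents is a stable cycle if and only if a stable partition extends the
permutation `c` that moves them cyclically and fixes all other agents. -/
theorem mem_SC_iff_exists_extends {c : Equiv.Perm (Fin n)} {v : ℕ → Fin n} {M : ℕ} (hM : 2 ≤ M)
    (hv : ∀ j < M, ∀ k < M, v j = v k → j = k) (hstep : ∀ k, k + 1 < M → c (v k) = v (k + 1))
    (hlast : c (v (M - 1)) = v 0) (hfix : ∀ z, (∀ k < M, v k ≠ z) → c z = z) :
    ((List.range M).map v : Cycle (Fin n)) ∈ I.SC ↔
      ∃ q, I.IsStablePartition q ∧ ∀ i, c i ≠ i → q i = c i := by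
  refine exists_congr fun q => and_congr_right fun _ => ?_
  have hM' : 0 < M := by omega
  constructor
  · rintro ⟨-, -, h⟩ i hi
    rw [chain_map_range_iff _ hM'] at h
    obtain ⟨k, hk, rfl⟩ : ∃ k < M, v k = i := by
      by_contra hcon
      push Not at hcon
      exact hi (hfix i hcon)
    by_cases hkM : k + 1 < M
    · rw [h.1 k hkM, hstep k hkM]
    · rw [show k = M - 1 by omega, h.2, hlast]
  · intro h
    have h1 : ∀ k, k + 1 < M → q (v k) = v (k + 1) := fun k hk => by
      rw [h _ _, hstep k hk]
      rw [hstep k hk]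
      exact fun heq => by have := hv _ hk _ (by omega) heq; omega
    have h2 : q (v (M - 1)) = v 0 := by
      rw [h _ _, hlast]
      rw [hlast]
      exact fun heq => by have := hv _ (by omega) _ (by omega) heq; omega
    rw [← periodicOrbit_eq_of_step hM' hv h1 h2]
    exact isCycleOf_periodicOrbit q _

/-! ### The output -/

/-- `out` lists the cycles in the set `S`, each of them exactly once, and nothing else. -/
def Lists (S : Set (Cycle (Fin n))) (out : List ℕ) : Prop :=
  ∃ L : List (List (Fin n)), out = encodeCycles L ∧
    (L.map fun l : List (Fin n) => (l : Cycle (Fin n))).Nodup ∧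
    ∀ C : Cycle (Fin n), C ∈ (L.map fun l : List (Fin n) => (l : Cycle (Fin n))) ↔ C ∈ S

theorem Lists.nil : Lists (∅ : Set (Cycle (Fin n))) [] := ⟨[], by simp [encodeCycles]⟩

theorem Lists.append {S : Set (Cycle (Fin n))} {out : List ℕ} (h : Lists S out) {l : List (Fin n)}
    (hl : (l : Cycle (Fin n)) ∉ S) :
    Lists (S ∪ {(l : Cycle (Fin n))}) (out ++ l.length :: l.map Fin.val) := by
  obtain ⟨L, rfl, hnd, hL⟩ := h
  refine ⟨L ++ [l], by simp [encodeCycles], ?_, fun C => ?_⟩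
  · rw [List.map_append, List.nodup_append]
    refine ⟨hnd, by simp, ?_⟩
    rintro C hC C' hC' rfl
    rw [List.map_singleton, List.mem_singleton] at hC'
    rw [hL, hC'] at hC
    exact hl hC
  · rw [List.map_append, List.mem_append, hL, List.map_singleton, List.mem_singleton]
    rfl

/-- In `ListsStableCycles` the coercion of the list of lists is elaborated through the list monad;
this agrees with the map of the coercion. -/
theorem Lists.listsStableCycles {I : SRInstance n} {out : List ℕ} (h : Lists I.SC out) :
    I.ListsStableCycles out := by
  obtain ⟨L, h1, h2, h3⟩ := h
  have hL : (L.map fun l : List (Fin n) => (l : Cycle (Fin n))) =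
      (List.map (fun l => l) do
        let a ← L
        pure (a : Cycle (Fin n))) := by
    simp [List.bind_eq_flatMap, List.map_eq_flatMap]
  exact ⟨L, h1, hL ▸ h2, hL ▸ h3⟩

end SRInstance

/-! ### The program for the odd cycles -/

namespace RAM

/-- Variable: the first agent of a cycle. -/
notation "vU" => (20 : ℕ)
/-- Variable: the second agent of a cycle. -/
notation "vV" => (21 : ℕ)
/-- Variable: the length of a cycle. -/
notation "vLen" => (22 : ℕ)
/-- Variable: the agent reached on a cycle. -/
notation "vC" => (23 : ℕ)
/-- Variable: the parity of the length of a cycle. -/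
notation "vPar" => (25 : ℕ)
/-- Variable: whether a cycle has no agent less than its first one. -/
notation "vMin" => (28 : ℕ)
/-- Array: `1` for the agents on even cycles. -/
notation "aEven" => (8 : ℕ)
/-- Array: `1` for the pairs of partners in stable partitions. -/
notation "aPair" => (11 : ℕ)

open RAM.Program RAM.Expr Function SRInstance

/-- Invert the preference lists, and make a copy of the instance. -/
def setupProg : Program :=
  forLoop vI vN (forLoop vJ vN
    (assign vX (.read aList (idx (.var vI) (.var vJ))) ;;
    store aPref (idx (.var vI) (.var vJ)) (.var vX) ;;
    store aRank (idx (.var vI) (.var vX)) (.var vJ) ;;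
    store aPos (idx (.var vI) (.var vX)) (.var vJ)))

/-- Write down the successors in the stable partition that was found. -/
def succProg : Program :=
  forLoop vI vN (store aSucc (.read aPref (idx (.var vI) (.read aLast (.var vI)))) (.var vI))

/-- Print the cycle of length `vLen` that starts with the agent `vC`. -/
def printProg : Program :=
  print (.var vLen) ;; forLoop vI vLen (print (.var vC) ;; assign vC (.read aSucc (.var vC)))

/-- Go once around the cycle of the agent `vU`. -/
def walkProg : Program :=
  assign vLen 1 ;; assign vPar 1 ;; assign vMin 1 ;; assign vC (.read aSucc (.var vU)) ;;
  loop (1 - .eq (.var vC) (.var vU))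
    (assign vMin (.var vMin * .lt (.var vU) (.var vC)) ;;
    assign vC (.read aSucc (.var vC)) ;;
    assign vPar (1 - .var vPar) ;;
    assign vLen (.var vLen + 1))

/-- Print the odd cycles of the stable partition that was found, and mark the other agents. -/
def oddProg : Program :=
  forLoop vU vN
    (walkProg ;;
    store aEven (.var vU) (1 - .var vPar) ;;
    ite (.var vPar * .var vMin) (assign vC (.var vU) ;; printProg) .skip)

variable {n W : ℕ} {I : SRInstance n} {s : State} {p : Equiv.Perm (Fin n)}

/-- The rows before `i` of the tables, and the first `m` positions of row `i`, are filled in. -/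
def IsSetUp (I : SRInstance n) (i m : ℕ) (s : State) : Prop :=
  ∀ i' j' : Fin n, (i'.val < i ∨ (i'.val = i ∧ I.rk i' j' < m)) →
    s.arr aPref (i' * n + I.rk i' j') = j' ∧ s.arr aRank (i' * n + j') = I.rk i' j' ∧
      s.arr aPos (i' * n + j') = I.rk i' j'

theorem setupProg_spec (hW : n * n + n < W) (h0 : s.var vN = n) (hP : I.IsPref (s.arr aList)) :
    wp W setupProg (fun s' t => HasLists I s' ∧ I.IsPref (s'.arr aPref) ∧
      IsTable (s'.arr aRank) I.rk ∧ t ≤ 60 * (n * n) + 20 * n + 10) s := by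
  refine wp_mono (wp_forLoop_const (fun k s' => IsSetUp I k 0 s') (50 * n + 6) (by decide)
    (by decide) (by decide) h0 (by omega) ?_ ?_) ?_
  · rintro i' j' (h | h)
    · exact absurd h (Nat.not_lt_zero _)
    · exact absurd h.2 (Nat.not_lt_zero _)
  · rintro k s' hk hF hvk hset
    obtain ⟨i, rfl⟩ : ∃ i : Fin n, i.val = k := ⟨⟨k, hk⟩, rfl⟩
    have h0' : s'.var vN = n := (hF.var _ (by decide)).trans h0
    refine wp_mono (wp_forLoop_const (fun m s' => IsSetUp I i m s') 42 (by decide)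
      (by decide) (by decide) h0' (by omega) hset ?_) ?_
    · rintro m s'' hm hF' hvm hset'
      have h0'' : s''.var vN = n := (hF'.var _ (by decide)).trans h0'
      have hi'' : s''.var vI = i := (hF'.var _ (by decide)).trans hvk
      obtain ⟨j, rfl⟩ := I.exists_rk i hm
      have hread : s''.arr aList (i * n + I.rk i j) = j := by
        rw [hF'.arr _ (by decide), hF.arr _ (by decide)]; exact hP i j
      have hjl := j.isLt
      have hc1 := cell_lt i.isLt hm
      have hc2 := cell_lt i.isLt hjl
      refine wp_seq (wp_assign (by simp [hi'', h0'', hvm, hread]; omega) ?_)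
      simp only [eval_read, eval_idx, eval_var, hi'', h0'', hvm, hread]
      refine wp_seq (wp_store (by simp [hi'', h0'', hvm]; omega) (by simp; omega) ?_)
      refine wp_seq (wp_store (by simp [hi'', h0'']; omega) (by simp [hvm]; omega) ?_)
      refine wp_store (by simp [hi'', h0'']; omega) (by simp [hvm]; omega) ⟨?_, by simp⟩
      intro i' j' hcond
      by_cases hij : i' = i ∧ j' = j
      · obtain ⟨rfl, rfl⟩ := hij
        simp [hi'', h0'', hvm]
      · have hold : i'.val < i ∨ (i'.val = i ∧ I.rk i' j' < I.rk i j) := by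
          refine hcond.imp_right fun h => ⟨h.1, ?_⟩
          have hii : i' = i := Fin.ext h.1
          subst hii
          have : I.rk i' j' ≠ I.rk i' j := fun h => hij ⟨rfl, rk_inj.1 h⟩
          have := h.2
          omega
        have h1 : ¬ (i'.val * n + I.rk i' j' = i * n + I.rk i j) := by
          rw [cell_inj (I.rk_lt _ _) hm, Fin.val_inj]
          rintro ⟨rfl, h⟩
          exact hij ⟨rfl, rk_inj.1 h⟩
        have h2 : ¬ (i'.val * n + j'.val = i * n + j) := by
          rw [cell_inj j'.isLt hjl, Fin.val_inj, Fin.val_inj]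
          exact hij
        have := hset' i' j' hold
        simp [hi'', h0'', hvm, h1, h2, this]
    · rintro s'' t - ⟨hset', -, ht⟩
      refine ⟨fun i' j' h => hset' i' j' ?_, by omega⟩
      have h1 := I.rk_lt i' j'
      omega
  · rintro s' t hF ⟨h, -, ht⟩
    refine ⟨⟨(hF.var _ (by decide)).trans h0, ?_, fun i j => (h i j (.inl i.isLt)).2.2⟩,
      fun i j => (h i j (.inl i.isLt)).1, fun i j => (h i j (.inl i.isLt)).2.1, ?_⟩
    · rw [hF.arr _ (by decide)]; exact hP
    · have h1 : n * (50 * n + 6 + 8) = 50 * (n * n) + 14 * n := by ring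
      rw [h1] at ht
      have : n ≤ n * n := Nat.le_mul_self n
      omega

theorem succProg_spec (hW : n * n + n < W) (h0 : s.var vN = n) (hP : I.IsPref (s.arr aPref))
    (hL : IsVec (s.arr aLast) fun j => I.rk j (p⁻¹ j)) :
    wp W succProg (fun s' t => IsVec (s'.arr aSucc) (fun i => (p i).val) ∧ t ≤ 30 * n + 10) s := by
  refine wp_mono (wp_forLoop_const (fun k s' => ∀ j : Fin n, j.val < k →
    s'.arr aSucc (p⁻¹ j : Fin n) = j) 12 (by decide)
    (by decide) (by decide) h0 (by omega) (fun i hi => absurd hi (Nat.not_lt_zero _)) ?_) ?_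
  · rintro k s' hk hF hvk hI
    obtain ⟨j, rfl⟩ : ∃ j : Fin n, j.val = k := ⟨⟨k, hk⟩, rfl⟩
    have h0' : s'.var vN = n := (hF.var _ (by decide)).trans h0
    have hL' := hL j
    have hP' := hP j (p⁻¹ j)
    rw [← hF.arr _ (by decide)] at hL' hP'
    have hlt := (p⁻¹ j).isLt
    refine wp_store (by simp [hvk, h0', hL', hP', -Equiv.Perm.coe_inv]; omega)
      (by simp [hvk]; omega) ⟨fun j' hj' => ?_, by simp⟩
    by_cases hjj : j' = j
    · subst hjj
      simp [hvk, h0', hL', hP', -Equiv.Perm.coe_inv]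
    · have h1 : ¬ (p⁻¹ j').val = (p⁻¹ j).val := by
        rw [Fin.val_inj]; exact fun h => hjj (p⁻¹.injective h)
      have h2 : j'.val ≠ j.val := fun h => hjj (Fin.ext h)
      have := hI j' (by omega)
      simp [hvk, h0', hL', hP', h1, this, -Equiv.Perm.coe_inv]
  · rintro s' t - ⟨h, -, ht⟩
    refine ⟨fun i => ?_, by omega⟩
    have := h (p i) (p i).isLt
    rwa [show p⁻¹ (p i) = i by simp] at this

theorem printProg_spec (hW : n * n + n < W) {v : ℕ → Fin n} {M : ℕ} (hM : M ≤ n)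
    (hlen : s.var vLen = M) (hv : s.var vC = v 0)
    (hsucc : ∀ k < M, s.arr aSucc (v k) = v (k + 1)) :
    wp W printProg (fun s' t =>
      s'.out = s.out ++ ((List.range M).map v).length :: ((List.range M).map v).map Fin.val ∧
      t ≤ 20 * n + 10) s := by
  refine wp_seq (wp_print (by simp [hlen]; omega) ?_)
  refine wp_mono (wp_forLoop_const (fun k s' => s'.var vC = v k ∧
    s'.out = s.out ++ M :: ((List.range k).map v).map Fin.val) 8 (by decide)
    (by decide) (by decide) (N := M) (by simpa using hlen) (by omega) (by simp [hv, hlen]) ?_) ?_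
  · rintro k s' hk hF hvk ⟨hv', hout⟩
    have h1 := (v k).isLt
    have h2 := (v (k + 1)).isLt
    have h3 : s'.arr aSucc (v k) = v (k + 1) := by
      rw [hF.arr _ (by decide)]; exact hsucc k hk
    refine wp_seq (wp_print (by simp [hv']; omega) ?_)
    refine wp_assign (by simp [hv', h3]; omega) ⟨⟨by simp [hv', h3], ?_⟩, by simp⟩
    simp [hout, hv', List.range_succ]
  · rintro s' t - ⟨⟨-, hout⟩, -, ht⟩
    refine ⟨by simpa using hout, ?_⟩
    have : M * (8 + 8) ≤ n * (8 + 8) := Nat.mul_le_mul_right _ hM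
    simp
    omega

theorem minimalPeriod_le_card (p : Equiv.Perm (Fin n)) (x : Fin n) : minimalPeriod p x ≤ n := by
  have := List.Nodup.length_le_card (l := (List.range (minimalPeriod p x)).map fun k => p^[k] x)
    (by simpa [periodicOrbit_def] using nodup_periodicOrbit (f := p) (x := x))
  simpa using this

open Classical in
/-- The walk around the cycle of `x` finds its length, the parity, and whether `x` is its least
agent. -/
theorem walkProg_spec (hW : n * n + n < W) (hp : IsVec (s.arr aSucc) fun i => (p i).val)
    {x : Fin n} (hx : s.var vU = x) :
    wp W walkProg (fun s' t => s'.var vLen = minimalPeriod p x ∧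
      s'.var vPar = minimalPeriod p x % 2 ∧
      s'.var vMin = (if ∀ k, x ≤ p^[k] x then 1 else 0) ∧ t ≤ 30 * n + 30) s := by
  have hpos := minimalPeriod_pos_of_mem_periodicPts (mem_periodicPts_perm p x)
  have hle := minimalPeriod_le_card p x
  have hxl := x.isLt
  have hpl := (p x).isLt
  refine wp_seq (wp_assign (by simp; omega) ?_)
  refine wp_seq (wp_assign (by simp; omega) ?_)
  refine wp_seq (wp_assign (by simp; omega) ?_)
  refine wp_seq (wp_assign (by simp [hx, hp x]; omega) ?_)
  simp only [eval_one, eval_read, eval_var, State.setVar_var, State.setVar_arr, hx, hp x,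
    Nat.reduceEqDiff, if_false]
  refine wp_mono (wp_loop (fun s' => ∃ m, 0 < m ∧ m ≤ minimalPeriod p x ∧ s'.var vLen = m ∧
    s'.var vC = p^[m] x ∧ s'.var vPar = m % 2 ∧
    s'.var vMin = (if ∀ k < m, x ≤ p^[k] x then 1 else 0))
    (fun s' => 30 * (minimalPeriod p x - s'.var vLen)) ⟨1, by simp; omega⟩ ?_) ?_
  · rintro s' hF ⟨m, hm, hmle, h1, h2, h3, h4⟩ he
    have hx' : s'.var vU = x := (hF.var _ (by decide)).trans (by simp [hx])
    have hp' : IsVec (s'.arr aSucc) fun i => (p i).val := by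
      rw [hF.arr _ (by decide)]; exact hp
    have hne : p^[m] x ≠ x := by
      intro h
      simp [h2, hx', h] at he
    have hlt : m < minimalPeriod p x := lt_of_le_of_ne hmle fun h => hne (by
      rw [h, iterate_minimalPeriod])
    have h5 := (p^[m] x).isLt
    have h6 := (p^[m + 1] x).isLt
    have h7 : s'.arr aSucc (p^[m] x : Fin n) = (p^[m + 1] x : Fin n) := by
      rw [iterate_succ_apply']; exact hp' _
    have hmin : (if ∀ k < m + 1, x ≤ p^[k] x then 1 else 0) =
        (if ∀ k < m, x ≤ p^[k] x then 1 else 0) * (if x.val < p^[m] x then 1 else 0) := by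
      have : (∀ k < m + 1, x ≤ p^[k] x) ↔ (∀ k < m, x ≤ p^[k] x) ∧ x.val < p^[m] x := by
        rw [← Fin.lt_def, lt_iff_le_and_ne]
        constructor
        · exact fun h => ⟨fun k hk => h k (by omega), h m (by omega), hne.symm⟩
        · rintro ⟨h, h', -⟩ k hk
          rcases Nat.lt_succ_iff_lt_or_eq.1 hk with hk | rfl
          · exact h k hk
          · exact h'
      by_cases ha : ∀ k < m, x ≤ p^[k] x <;> by_cases hb : x.val < p^[m] x <;>
        simp only [this, ha, hb, and_self, and_true, and_false, if_true, if_false,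
          mul_zero, mul_one]
    have hb1 : (if ∀ k < m + 1, x ≤ p^[k] x then 1 else 0) < W := by split_ifs <;> omega
    rw [hmin] at hb1
    refine wp_seq (wp_assign (by simpa only [eval_mul, eval_lt, eval_var, h4, hx', h2]
      using hb1) ?_)
    simp only [eval_mul, eval_lt, eval_var, h4, hx', h2]
    rw [← hmin]
    refine wp_seq (wp_assign (by simp [h2, h7]; omega) ?_)
    refine wp_seq (wp_assign (by simp; omega) ?_)
    refine wp_assign (by simp [h1]; omega) ⟨⟨m + 1, by omega, hlt, by simp [h1], ?_, ?_, ?_⟩, ?_⟩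
    · simp [h2, h7]
    · simp [h3]; omega
    · simp
    · simp [h1]; omega
  · rintro s' t hF ⟨⟨m, hm, hmle, h1, h2, h3, h4⟩, -, he, ht⟩
    have hx' : s'.var vU = x := (hF.var _ (by decide)).trans (by simp [hx])
    have heq : p^[m] x = x := by
      by_contra h
      rw [← Fin.val_inj] at h
      simp [h2, hx', h] at he
    have hmM : m = minimalPeriod p x := le_antisymm hmle (IsPeriodicPt.minimalPeriod_le hm heq)
    subst hmM
    refine ⟨h1, h3, ?_, ?_⟩
    · rw [h4]
      have : (∀ k < minimalPeriod p x, x ≤ p^[k] x) ↔ ∀ k, x ≤ p^[k] x := by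
        refine ⟨fun h k => ?_, fun h k _ => h k⟩
        rw [← iterate_mod_minimalPeriod_eq]
        exact h _ (Nat.mod_lt _ hpos)
      simp only [this]
    · simp at ht ⊢
      omega

open Classical in
theorem oddProg_spec (hW : n * n + n < W) (h0 : s.var vN = n) (hp : I.IsStablePartition p)
    (hs : IsVec (s.arr aSucc) fun i => (p i).val) (hout : s.out = []) :
    wp W oddProg (fun s' t => Lists (I.cyclesBefore {m | Odd m} n 0) s'.out ∧
      IsVec (s'.arr aEven) (fun i => if Even (minimalPeriod p i) then 1 else 0) ∧
      t ≤ 60 * (n * n) + 100 * n + 10) s := by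
  refine wp_mono (wp_forLoop_const (fun k s' => Lists (I.cyclesBefore {m | Odd m} k 0) s'.out ∧
    ∀ i : Fin n, i.val < k → s'.arr aEven i = if Even (minimalPeriod p i) then 1 else 0)
    (50 * n + 80) (by decide) (by decide) (by decide) h0 (by omega)
    ⟨by rw [cyclesBefore_zero]; simpa [hout] using Lists.nil,
      fun i hi => absurd hi (Nat.not_lt_zero _)⟩ ?_) ?_
  · rintro k s' hk hF hvk ⟨hlist, hev⟩
    obtain ⟨x, rfl⟩ : ∃ x : Fin n, x.val = k := ⟨⟨k, hk⟩, rfl⟩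
    have hs' : IsVec (s'.arr aSucc) fun i => (p i).val := by rw [hF.arr _ (by decide)]; exact hs
    refine wp_seq (wp_mono (walkProg_spec hW hs' hvk) ?_)
    rintro s₁ t₁ hF₁ ⟨hlen, hpar, hmin, ht₁⟩
    have hx₁ : s₁.var vU = x := (hF₁.var _ (by decide)).trans hvk
    have hout₁ : s₁.out = s'.out := hF₁.out rfl
    have hev₁ : s₁.arr aEven = s'.arr aEven := hF₁.arr _ (by decide)
    have hs₁ : IsVec (s₁.arr aSucc) fun i => (p i).val := by rw [hF₁.arr _ (by decide)]; exact hs'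
    have hparity : minimalPeriod p x % 2 = if Odd (minimalPeriod p x) then 1 else 0 := by
      split_ifs with h
      · exact Nat.odd_iff.1 h
      · exact Nat.even_iff.1 (Nat.not_odd_iff_even.1 h)
    have hpar' : 1 - s₁.var vPar = if Even (minimalPeriod p x) then 1 else 0 := by
      rw [hpar, hparity]
      by_cases h : Odd (minimalPeriod p x)
      · rw [if_pos h, if_neg (Nat.not_even_iff_odd.2 h)]
      · rw [if_neg h, if_pos (Nat.not_odd_iff_even.1 h)]
    refine wp_seq (wp_store (by simp [hx₁]; omega) (by simp; omega) ?_)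
    simp only [eval_var, eval_sub, eval_one, hpar', hx₁]
    -- The odd cycles whose least agent is `x`.
    have hset : I.cyclesBefore {m | Odd m} (x + 1) 0 = I.cyclesBefore {m | Odd m} x 0 ∪
        (if Odd (minimalPeriod p x) ∧ ∀ k, x ≤ p^[k] x then {periodicOrbit p x} else ∅) := by
      ext C
      constructor
      · rintro ⟨hodd, a, b, hC, hab⟩
        by_cases hax : a.val < x
        · exact .inl ⟨hodd, a, b, hC, .inl hax⟩
        · have : a = x := Fin.ext (by omega)
          subst this
          right
          obtain ⟨q, hq, rfl, -, hle⟩ := hC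
          have hodd' : Odd (minimalPeriod q a) := by simpa [periodicOrbit_length] using hodd
          have hodd'' := (hp.odd_iff hq).1 hodd'
          rw [if_pos ⟨hodd'', fun k => hp.iterate_eq hq hodd'' k ▸ hle k⟩]
          exact hp.periodicOrbit_eq hq hodd''
      · rintro (⟨hodd, a, b, hC, hab⟩ | hC)
        · exact ⟨hodd, a, b, hC, by omega⟩
        · split_ifs at hC with h
          · rw [Set.mem_singleton_iff] at hC
            subst hC
            exact ⟨by simpa [periodicOrbit_length] using h.1, x, p x, ⟨p, hp, rfl, rfl, h.2⟩,
              .inl (by omega)⟩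
          · exact absurd hC (Set.notMem_empty _)
    have hev' : ∀ s'' : State, s''.arr aEven = Function.update (s₁.arr aEven) x
        (if Even (minimalPeriod p x) then 1 else 0) → ∀ i : Fin n, i.val < x + 1 →
        s''.arr aEven i = if Even (minimalPeriod p i) then 1 else 0 := by
      intro s'' h i hi
      rw [h]
      by_cases hix : i = x
      · subst hix; simp
      · have h1 : i.val ≠ x.val := fun h => hix (Fin.ext h)
        rw [update_of_ne h1, hev₁]
        exact hev i (by omega)
    refine wp_ite ?_ ?_
    · intro he
      have hcond : Odd (minimalPeriod p x) ∧ ∀ k, x ≤ p^[k] x := by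
        by_contra hcon
        rw [not_and_or] at hcon
        rcases hcon with h | h
        · simp [hpar, hparity, h] at he
        · simp only [eval_mul, eval_var, State.setArr_var, hmin, if_neg h] at he
          exact he rfl
      refine wp_seq (wp_assign (by simp [hx₁]; omega) ?_)
      refine wp_mono (printProg_spec hW (v := fun k => p^[k] x) (minimalPeriod_le_card p x)
        (by simpa using hlen) (by simp [hx₁]) (fun k hk => ?_)) ?_
      · simpa [iterate_succ_apply' p] using hs₁ (p^[k] x)
      · rintro s₂ t₂ hF₂ ⟨hout₂, ht₂⟩
        refine ⟨⟨?_, ?_⟩, ?_⟩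
        · rw [State.setVar_out, hout₂, hset, if_pos hcond]
          refine Lists.append (by simpa [hout₁] using hlist) ?_
          rw [← periodicOrbit_def]
          exact fun h => IsStableCycle.notMem_cyclesBefore ⟨p, hp, rfl, rfl, hcond.2⟩ _
            (show _ ∈ I.cyclesBefore {m | Odd m} x (p x) from
              ⟨h.1, h.2.imp fun a => Exists.imp fun b h => ⟨h.1, by omega⟩⟩)
        · refine hev' _ ?_
          rw [State.setVar_arr, hF₂.arr _ (by decide)]
          simp
        · simp
          omega
    · intro he
      have hcond : ¬ (Odd (minimalPeriod p x) ∧ ∀ k, x ≤ p^[k] x) := by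
        rintro ⟨h1, h2⟩
        simp only [eval_mul, eval_var, State.setArr_var, hpar, hparity, hmin, if_pos h1,
          if_pos h2] at he
        omega
      refine wp_skip ⟨⟨?_, hev' _ (by simp)⟩, ?_⟩
      · rw [hset, if_neg hcond, Set.union_empty]
        simpa [hout₁] using hlist
      · simp
        omega
  · rintro s' t - ⟨⟨h1, h2⟩, -, ht⟩
    refine ⟨h1, fun i => h2 i i.isLt, ?_⟩
    have h3 : n * (50 * n + 80 + 8) = 50 * (n * n) + 88 * n := by ring
    rw [h3] at ht
    omega

end RAM

/-! ### The program for the pairs of partners -/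

namespace SRInstance

open Function

variable {n : ℕ} {I : SRInstance n}

theorem stablePair_iff_swap {x y : Fin n} (hxy : x ≠ y) :
    I.StablePair x y ↔
      ∃ q, I.IsStablePartition q ∧ ∀ i, Equiv.swap x y i ≠ i → q i = Equiv.swap x y i := by
  refine (and_iff_right hxy).trans (exists_congr fun q => and_congr_right fun _ => ?_)
  constructor
  · rintro ⟨h1, h2⟩ i hi
    by_cases hix : i = x
    · rw [hix, h1, Equiv.swap_apply_left]
    · by_cases hiy : i = y
      · rw [hiy, h2, Equiv.swap_apply_right]
      · exact absurd (Equiv.swap_apply_of_ne_of_ne hix hiy) hi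
  · intro h
    have h1 := h x
    have h2 := h y
    rw [Equiv.swap_apply_left] at h1
    rw [Equiv.swap_apply_right] at h2
    exact ⟨h1 hxy.symm, h2 hxy⟩

open Classical in
/-- The stable cycles of length two with least agent `x` and second agent `y`. -/
theorem setOf_isStableCycle_two (x y : Fin n) :
    {C | C.length ∈ ({2} : Set ℕ) ∧ I.IsStableCycle C x y} =
      if I.StablePair x y ∧ x < y then {(([x, y] : List (Fin n)) : Cycle (Fin n))} else ∅ := by
  ext C
  constructor
  · rintro ⟨h2, p, hp, rfl, rfl, hle⟩
    have hper : minimalPeriod p x = 2 := by simpa [periodicOrbit_length] using h2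
    have hpp : p (p x) = x := by
      have := iterate_minimalPeriod (f := p) (x := x)
      rwa [hper] at this
    have hne : x ≠ p x := by
      intro h
      have : minimalPeriod p x ≤ 1 := IsPeriodicPt.minimalPeriod_le one_pos h.symm
      omega
    rw [if_pos ⟨⟨hne, p, hp, rfl, hpp⟩, lt_of_le_of_ne (hle 1) hne⟩, periodicOrbit_def, hper]
    rfl
  · intro h
    split_ifs at h with hc
    · obtain ⟨⟨hne, q, hq, h1, h2⟩, hlt⟩ := hc
      rw [Set.mem_singleton_iff] at h
      subst h
      have hper := minimalPeriod_eq_two hne h1 h2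
      refine ⟨rfl, q, hq, ?_, h1, fun k => ?_⟩
      · rw [periodicOrbit_def, hper, ← h1]
        rfl
      · rw [← iterate_mod_minimalPeriod_eq, hper]
        rcases Nat.mod_two_eq_zero_or_one k with h | h <;> rw [h]
        · exact le_rfl
        · rw [iterate_one, h1]; exact hlt.le
    · exact absurd h (Set.notMem_empty _)

end SRInstance

namespace RAM

open RAM.Program RAM.Expr Function SRInstance

/-- Two nested loops over the same range, where only some pairs, those with `E k * E j ≠ 0`,
lead to expensive iterations. -/
theorem wp_forLoop_forLoop {W : ℕ} {P : Program} {s : State} {x y z N : ℕ}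
    (Inv : ℕ → ℕ → State → Prop) (E : ℕ → ℕ) (A B : ℕ)
    (hx : x ∉ P.writtenVars) (hy : y ∉ P.writtenVars) (hz : z ∉ P.writtenVars)
    (hxy : x ≠ y) (hzx : z ≠ x) (hzy : z ≠ y) (hN : s.var z = N) (hW : N < W)
    (h0 : Inv 0 0 s) (hset : ∀ k j s' u v, u = x ∨ u = y → Inv k j s' → Inv k j (s'.setVar u v))
    (hrow : ∀ k s', Inv k N s' → Inv (k + 1) 0 s')
    (hstep : ∀ k j s', k < N → j < N → Frame (.forLoop x z (.forLoop y z P)) s s' →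
      s'.var x = k → s'.var y = j → Inv k j s' →
      wp W P (fun s'' t => Inv k (j + 1) s'' ∧ t ≤ E k * E j * A + B) s') :
    wp W (.forLoop x z (.forLoop y z P)) (fun s' t => Inv N 0 s' ∧
      t ≤ (∑ k ∈ Finset.range N, E k) ^ 2 * A + N * N * (B + 8) + 14 * N + 6) s := by
  set S := ∑ k ∈ Finset.range N, E k with hS
  refine wp_mono (wp_forLoop (fun k s' => Inv k 0 s')
    (fun k => E k * S * A + N * (B + 8) + 6) ?_ ?_ hzx hN hW (hset _ _ _ _ _ (.inl rfl) h0) ?_) ?_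
  · simp [Program.forLoop, writtenVars, hx, hxy]
  · simp [Program.forLoop, writtenVars, hz, hzy]
  · intro k s' hk hF hvk hI
    have hz' : s'.var z = N := by
      rw [hF.var z (by simp [Program.forLoop, writtenVars, hz, hzx, hzy]), hN]
    refine wp_mono (wp_forLoop (fun j s'' => Inv k j s'') (fun j => E k * E j * A + B) hy hz hzy
      hz' hW (hset _ _ _ _ _ (.inr rfl) hI) ?_) ?_
    · intro j s'' hj hF' hvj hI'
      have hx' : s''.var x = k := by
        rw [hF'.var x (by simp [Program.forLoop, writtenVars, hx, hxy]), hvk]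
      refine wp_mono (hstep k j s'' hk hj (hF.trans (hF'.of_subset ?_ ?_ ?_)) hx' hvj hI') ?_
      · intro u; simp [Program.forLoop, writtenVars]; tauto
      · intro u; simp [Program.forLoop, writtenArrs]
      · simp [Program.forLoop, prints]
      · rintro s₃ t - ⟨h1, h2⟩
        exact ⟨hset _ _ _ _ _ (.inr rfl) h1, h2⟩
    · rintro s'' t - ⟨hI', -, ht⟩
      refine ⟨hset _ _ _ _ _ (.inl rfl) (hrow _ _ hI'), ht.trans_eq ?_⟩
      rw [Finset.sum_add_distrib, Finset.sum_add_distrib, ← Finset.sum_mul, ← Finset.mul_sum]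
      simp only [Finset.sum_const, Finset.card_range, smul_eq_mul]
      ring
  · rintro s' t - ⟨hI, -, ht⟩
    refine ⟨hI, ht.trans_eq ?_⟩
    simp only [Finset.sum_add_distrib, ← Finset.sum_mul, Finset.sum_const, Finset.card_range,
      smul_eq_mul, ← hS]
    ring

/-- There are no cycles to be tested yet. -/
def clearInProg : Program := forLoop vI vN (store aIn (.var vI) 0)

/-- The cycle to be tested is the transposition of `vU` and `vV`. -/
def swapProg : Program :=
  clearInProg ;;
  store aIn (.var vU) 1 ;; store aIn (.var vV) 1 ;;
  store aSucc (.var vU) (.var vV) ;; store aSucc (.var vV) (.var vU) ;;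
  store aPred (.var vU) (.var vV) ;; store aPred (.var vV) (.var vU)

/-- Find all pairs of partners in stable partitions, and print the stable cycles of length two. -/
def pairProg : Program :=
  forLoop vU vN (forLoop vV vN
    (ite (.read aEven (.var vU) * .read aEven (.var vV) * (1 - .eq (.var vU) (.var vV)))
      (swapProg ;; testProg ;;
      ite (.var vOk)
        (store aPair (idx (.var vU) (.var vV)) 1 ;;
        ite (.lt (.var vU) (.var vV))
          (print (1 + 1) ;; print (.var vU) ;; print (.var vV))
          .skip)
        .skip)
      .skip))

variable {n W : ℕ} {I : SRInstance n} {s : State} {p : Equiv.Perm (Fin n)}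

theorem clearInProg_spec (hW : n * n + n < W) (h0 : s.var vN = n) :
    wp W clearInProg (fun s' t => IsVec (s'.arr aIn) (fun _ : Fin n => 0) ∧ t ≤ 11 * n + 6) s := by
  refine wp_mono (wp_forLoop_const (fun k s' => ∀ i : Fin n, i.val < k → s'.arr aIn i = 0) 3
    (by decide) (by decide) (by decide) h0 (by omega)
    (fun i hi => absurd hi (Nat.not_lt_zero _)) ?_) ?_
  · intro k s' hk hF hvk hI
    refine wp_store (by simp; omega) (by simp; omega) ⟨fun i hi => ?_, by simp⟩
    by_cases hik : i.val = k
    · simp [hvk, hik]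
    · have := hI i (by omega)
      simp [hvk, hik, this]
  · rintro s' t - ⟨h, -, ht⟩
    exact ⟨fun i => h i i.isLt, by omega⟩

theorem swapProg_spec (hW : n * n + n < W) (h0 : s.var vN = n) {x y : Fin n} (hxy : x ≠ y)
    (hx : s.var vU = x) (hy : s.var vV = y) :
    wp W swapProg (fun s' t => HasCycles (Equiv.swap x y) s' ∧ t ≤ 11 * n + 30) s := by
  have hxl := x.isLt
  have hyl := y.isLt
  have hxy' : x.val ≠ y.val := fun h => hxy (Fin.ext h)
  refine wp_seq (wp_mono (clearInProg_spec hW h0) ?_)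
  rintro s₁ t₁ hF₁ ⟨hin, ht₁⟩
  have hx₁ : s₁.var vU = x := (hF₁.var _ (by decide)).trans hx
  have hy₁ : s₁.var vV = y := (hF₁.var _ (by decide)).trans hy
  refine wp_seq (wp_store (by simp [hx₁]; omega) (by simp; omega) ?_)
  refine wp_seq (wp_store (by simp [hy₁]; omega) (by simp; omega) ?_)
  refine wp_seq (wp_store (by simp [hx₁]; omega) (by simp [hy₁]; omega) ?_)
  refine wp_seq (wp_store (by simp [hy₁]; omega) (by simp [hx₁]; omega) ?_)
  refine wp_seq (wp_store (by simp [hx₁]; omega) (by simp [hy₁]; omega) ?_)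
  refine wp_store (by simp [hy₁]; omega) (by simp [hx₁]; omega) ⟨⟨?_, ?_, ?_⟩, ?_⟩
  · intro i
    by_cases hix : i = x
    · subst hix
      simp [hx₁, hy₁, hxy', hxy.symm]
    · by_cases hiy : i = y
      · subst hiy
        simp [hx₁, hy₁, hxy]
      · have h1 : i.val ≠ x := fun h => hix (Fin.ext h)
        have h2 : i.val ≠ y := fun h => hiy (Fin.ext h)
        have h3 := hin i
        simp [hx₁, hy₁, h1, h2, h3, Equiv.swap_apply_of_ne_of_ne hix hiy]
  · intro i hi
    by_cases hix : i = x
    · subst hix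
      simp [hx₁, hy₁, hxy']
    · by_cases hiy : i = y
      · subst hiy
        simp [hx₁, hy₁]
      · exact absurd (Equiv.swap_apply_of_ne_of_ne hix hiy) hi
  · intro i hi
    rw [Equiv.swap_inv]
    by_cases hix : i = x
    · subst hix
      simp [hx₁, hy₁, hxy']
    · by_cases hiy : i = y
      · subst hiy
        simp [hx₁, hy₁]
      · exact absurd (Equiv.swap_apply_of_ne_of_ne hix hiy) hi
  · simp
    omega

open Classical in
/-- `1` for the agents on even cycles. -/
noncomputable def evenWeight (p : Equiv.Perm (Fin n)) (k : ℕ) : ℕ :=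
  if h : k < n then if Even (minimalPeriod p ⟨k, h⟩) then 1 else 0 else 0

theorem evenWeight_val (p : Equiv.Perm (Fin n)) (x : Fin n) :
    evenWeight p x = if Even (minimalPeriod p x) then 1 else 0 := by
  simp [evenWeight]

theorem sum_evenWeight (hp : I.IsStablePartition p) :
    ∑ k ∈ Finset.range n, evenWeight p k = I.n₁ := by
  rw [hp.n₁_eq, Finset.card_filter, ← Fin.sum_univ_eq_sum_range]
  exact Finset.sum_congr rfl fun x _ => evenWeight_val p x

open Classical in
/-- The rows before `k` of the table of stable pairs, and the first `j` cells of row `k`, are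
filled in. -/
def HasPairs (I : SRInstance n) (k j : ℕ) (s : State) : Prop :=
  ∀ a b : Fin n, s.arr aPair (a * n + b) =
    if (a.val < k ∨ a.val = k ∧ b.val < j) ∧ I.StablePair a b then 1 else 0

theorem HasPairs.succ {x y : Fin n} {s' : State} (h : HasPairs I x y s)
    (h1 : I.StablePair x y → s'.arr aPair = update (s.arr aPair) (x * n + y) 1)
    (h2 : ¬ I.StablePair x y → s'.arr aPair = s.arr aPair) : HasPairs I x (y + 1) s' := by
  classical
  intro a b
  by_cases hab : a = x ∧ b = y
  · obtain ⟨rfl, rfl⟩ := hab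
    by_cases hp : I.StablePair a b
    · rw [h1 hp, update_self, if_pos ⟨by omega, hp⟩]
    · rw [h2 hp, h a b, if_neg fun h => hp h.2, if_neg fun h => hp h.2]
  · have hcell : a.val * n + b.val ≠ x * n + y := by
      rw [Ne, cell_inj b.isLt y.isLt, Fin.val_inj, Fin.val_inj]
      exact hab
    have hval : s'.arr aPair (a * n + b) = s.arr aPair (a * n + b) := by
      by_cases hp : I.StablePair x y
      · rw [h1 hp, update_of_ne hcell]
      · rw [h2 hp]
    rw [hval, h a b]
    rw [← Fin.val_inj, ← Fin.val_inj] at hab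
    have : (a.val < x ∨ a.val = x ∧ b.val < y) ↔ (a.val < x ∨ a.val = x ∧ b.val < y + 1) := by
      omega
    simp only [this]

open Classical in
/-- Two agents on even cycles form a stable pair if and only if their transposition passes the test;
other agents belong to no stable pair. -/
theorem pairProg_spec (hn : 0 < n) (hW : n * n + n < W) (hI : HasLists I s)
    (hp : I.IsStablePartition p)
    (hev : IsVec (s.arr aEven) fun i => if Even (minimalPeriod p i) then 1 else 0)
    (hzero : ∀ m, s.arr aPair m = 0) (hout : Lists (I.cyclesBefore {m | Odd m} n 0) s.out) :
    wp W pairProg (fun s' t =>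
      Lists (I.cyclesBefore {m | Odd m} n 0 ∪ I.cyclesBefore {2} n 0) s'.out ∧
      HasPairs I n 0 s' ∧ t ≤ I.n₁ ^ 2 * (2500 * (n * n)) + 60 * (n * n)) s := by
  refine wp_mono (wp_forLoop_forLoop (fun k j s' =>
    Lists (I.cyclesBefore {m | Odd m} n 0 ∪ I.cyclesBefore {2} k j) s'.out ∧ HasPairs I k j s')
    (evenWeight p) (2500 * (n * n)) 20 (by decide) (by decide) (by decide) (by decide) (by decide)
    (by decide) hI.var_n (by omega) ?_ ?_ ?_ ?_) ?_
  · refine ⟨by rwa [cyclesBefore_zero, Set.union_empty], fun a b => ?_⟩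
    rw [hzero, if_neg]
    rintro ⟨h, -⟩
    omega
  · exact fun k j s' u v _ h => h
  · rintro k s' ⟨h1, h2⟩
    refine ⟨by rwa [cyclesBefore_row], fun a b => ?_⟩
    rw [h2]
    have : (a.val < k ∨ a.val = k ∧ b.val < n) ↔ (a.val < k + 1 ∨ a.val = k + 1 ∧ b.val < 0) := by
      have := b.isLt
      omega
    simp only [this]
  · rintro k j s' hk hj hF hvk hvj ⟨hlist, hpairs⟩
    obtain ⟨x, rfl⟩ : ∃ x : Fin n, x.val = k := ⟨⟨k, hk⟩, rfl⟩
    obtain ⟨y, rfl⟩ : ∃ y : Fin n, y.val = j := ⟨⟨j, hj⟩, rfl⟩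
    have hI' : HasLists I s' :=
      hI.congr (hF.var _ (by decide)) (hF.arr _ (by decide)) (hF.arr _ (by decide))
    have hev' : IsVec (s'.arr aEven) fun i => if Even (minimalPeriod p i) then 1 else 0 := by
      rw [hF.arr _ (by decide)]; exact hev
    have hcell := cell_lt hk hj
    have hset := cyclesBefore_succ (I := I) {2} x y
    rw [setOf_isStableCycle_two] at hset
    rw [hset, ← Set.union_assoc]
    have hex := hev' x
    have hey := hev' y
    refine wp_ite ?_ ?_
    · intro he
      have hx : Even (minimalPeriod p x) := by
        by_contra h
        simp [hvk, hex, h] at he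
      have hy : Even (minimalPeriod p y) := by
        by_contra h
        simp [hvj, hey, h] at he
      have hxy : x ≠ y := by
        rintro rfl
        simp [hvk, hvj] at he
      rw [evenWeight_val, evenWeight_val, if_pos hx, if_pos hy]
      refine wp_seq (wp_mono (swapProg_spec hW hI'.var_n hxy hvk hvj) ?_)
      rintro s₁ t₁ hF₁ ⟨hc, ht₁⟩
      have hI₁ : HasLists I s₁ :=
        hI'.congr (hF₁.var _ (by decide)) (hF₁.arr _ (by decide)) (hF₁.arr _ (by decide))
      refine wp_seq (wp_mono (testProg_spec hn hW hI₁ hc) ?_)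
      rintro s₂ t₂ hF₂ ⟨hok, ht₂⟩
      rw [← stablePair_iff_swap hxy] at hok
      have h0₂ : s₂.var vN = n := (hF₂.var _ (by decide)).trans hI₁.var_n
      have hx₂ : s₂.var vU = x :=
        (hF₂.var _ (by decide)).trans ((hF₁.var _ (by decide)).trans hvk)
      have hy₂ : s₂.var vV = y :=
        (hF₂.var _ (by decide)).trans ((hF₁.var _ (by decide)).trans hvj)
      have hp₂ : s₂.arr aPair = s'.arr aPair :=
        (hF₂.arr _ (by decide)).trans (hF₁.arr _ (by decide))
      have ho₂ : s₂.out = s'.out := (hF₂.out rfl).trans (hF₁.out rfl)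
      have hnn : n ≤ n * n := Nat.le_mul_self n
      refine wp_ite ?_ ?_
      · intro he
        have hsp : I.StablePair x y := hok.1 he
        refine wp_seq (wp_store (by simp [h0₂, hx₂, hy₂]; omega) (by simp; omega) ?_)
        simp only [eval_idx, eval_var, eval_one, h0₂, hx₂, hy₂]
        refine wp_ite ?_ ?_
        · intro he
          have hlt : x < y := by simpa [hx₂, hy₂] using he
          refine wp_seq (wp_print (by simp; omega) ?_)
          refine wp_seq (wp_print (by simp [hx₂]; omega) ?_)
          refine wp_print (by simp [hy₂]; omega) ⟨⟨?_, ?_⟩, by simp; omega⟩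
          · rw [if_pos ⟨hsp, hlt⟩]
            have := hlist.append (l := [x, y]) (by
              rintro (h | h)
              · have h1 := h.1
                rw [Set.mem_ofPred_eq, Cycle.length_coe] at h1
                exact absurd (show Odd 2 from h1) (by decide)
              · have h1 : (([x, y] : List (Fin n)) : Cycle (Fin n)) ∈
                    {C : Cycle (Fin n) | C.length ∈ ({2} : Set ℕ) ∧ I.IsStableCycle C x y} := by
                  rw [setOf_isStableCycle_two, if_pos ⟨hsp, hlt⟩]; rfl
                exact h1.2.notMem_cyclesBefore _ h)
            simpa [ho₂, hx₂, hy₂] using this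
          · exact hpairs.succ (fun _ => by simp [hp₂]) fun h => absurd hsp h
        · intro he
          have hlt : ¬ x < y := by simpa [hx₂, hy₂] using he
          refine wp_skip ⟨⟨?_, ?_⟩, by simp; omega⟩
          · rw [if_neg fun h => hlt h.2, Set.union_empty]
            simpa [ho₂] using hlist
          · exact hpairs.succ (fun _ => by simp [hp₂]) fun h => absurd hsp h
      · intro he
        have hsp : ¬ I.StablePair x y := fun h => hok.2 h he
        refine wp_skip ⟨⟨?_, ?_⟩, by simp; omega⟩
        · rw [if_neg fun h => hsp h.1, Set.union_empty, ho₂]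
          exact hlist
        · exact hpairs.succ (fun h => absurd h hsp) fun _ => hp₂
    · intro he
      have hsp : ¬ I.StablePair x y := by
        intro h
        have hxy : x.val ≠ y.val := fun h' => h.1 (Fin.ext h')
        simp [hvk, hvj, hex, hey, h.even hp, h.symm.even hp, hxy] at he
      refine wp_skip ⟨⟨?_, ?_⟩, by simp⟩
      · rw [if_neg fun h => hsp h.1, Set.union_empty]
        exact hlist
      · exact hpairs.succ (fun h => absurd h hsp) fun _ => rfl
  · rintro s' t - ⟨⟨h1, h2⟩, ht⟩
    rw [sum_evenWeight hp] at ht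
    have : n ≤ n * n := Nat.le_mul_self n
    exact ⟨h1, h2, by omega⟩

end RAM

/-! ### Tracing long cycles -/

namespace SRInstance

open Function

variable {n : ℕ} {I : SRInstance n} {p : Equiv.Perm (Fin n)} {x y : Fin n} {v : ℕ → Fin n} {M : ℕ}

/-- The stable partition `p` has a cycle of even length other than two with least agent `x`, and
`y` comes after `x`. -/
def IsLongCycle (I : SRInstance n) (p : Equiv.Perm (Fin n)) (x y : Fin n) : Prop :=
  I.IsStablePartition p ∧ p x = y ∧ Even (minimalPeriod p x) ∧ minimalPeriod p x ≠ 2 ∧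
    ∀ k, x ≤ p^[k] x

/-- `v 0, …, v (M - 1)` are distinct agents, none of them less than `v 0 = x`. They start with
`x` and `y`, and every agent is followed by the next better partner after its predecessor. -/
structure IsTrace (I : SRInstance n) (x y : Fin n) (v : ℕ → Fin n) (M : ℕ) : Prop where
  two_le : 2 ≤ M
  zero : v 0 = x
  one : v 1 = y
  inj : ∀ j < M, ∀ k < M, v j = v k → j = k
  le : ∀ k < M, x ≤ v k
  next : ∀ k, k + 2 < M → I.IsNext (v (k + 1)) (v k) (v (k + 2))

theorem IsTrace.le_card (h : I.IsTrace x y v M) : M ≤ n := by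
  have := Fintype.card_le_of_injective (fun k : Fin M => v k) fun j k hjk =>
    Fin.ext (h.inj _ j.isLt _ k.isLt hjk)
  simpa using this

theorem IsLongCycle.isNext (hp : I.IsLongCycle p x y) (k : ℕ) :
    I.IsNext (p^[k + 1] x) (p^[k] x) (p^[k + 2] x) := by
  obtain ⟨hs, -, heven, hne, -⟩ := hp
  have hinv : p⁻¹ (p^[k + 1] x) = p^[k] x := by
    rw [iterate_succ_apply']; simp
  have h := hs.isNext (b := p^[k + 1] x) (by rwa [minimalPeriod_iterate]) (fun h => by
    rw [Equiv.Perm.eq_inv_iff_eq] at h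
    have h2 : minimalPeriod p (p^[k + 1] x) ∣ 2 := IsPeriodicPt.minimalPeriod_dvd h
    rw [minimalPeriod_iterate] at h2
    rcases (Nat.dvd_prime Nat.prime_two).1 h2 with h3 | h3
    · rw [h3] at heven
      exact absurd heven (by decide)
    · exact hne h3)
  rwa [hinv, ← iterate_succ_apply' p] at h

/-- A trace follows the long cycle that starts with `x` and `y`, if there is one. -/
theorem IsTrace.eq_iterate (h : I.IsTrace x y v M) (hp : I.IsLongCycle p x y) {k : ℕ}
    (hk : k < M) : v k = p^[k] x := by
  induction k using Nat.strong_induction_on with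
  | _ k ih =>
  rcases k with _ | _ | k
  · exact h.zero
  · rw [h.one]; exact hp.2.1.symm
  · refine (h.next k hk).unique ?_
    rw [ih (k + 1) (by omega) (by omega), ih k (by omega) (by omega)]
    exact hp.isNext k

theorem IsTrace.isNext (h : I.IsTrace x y v M) (hp : I.IsLongCycle p x y) :
    I.IsNext (v (M - 1)) (v (M - 2)) (p^[M] x) := by
  have h2 := h.two_le
  rw [h.eq_iterate hp (k := M - 1) (by omega), h.eq_iterate hp (k := M - 2) (by omega)]
  have := hp.isNext (M - 2)
  rwa [show M - 2 + 1 = M - 1 by omega, show M - 2 + 2 = M by omega] at this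

theorem IsTrace.extend (h : I.IsTrace x y v M) {z : Fin n}
    (hz : I.IsNext (v (M - 1)) (v (M - 2)) z) (hx : x ≤ z) (hnew : ∀ k < M, v k ≠ z) :
    I.IsTrace x y (update v M z) (M + 1) := by
  have h2 := h.two_le
  have hv : ∀ k < M, update v M z k = v k := fun k hk => update_of_ne (by omega) _ _
  refine ⟨by omega, by rw [hv 0 (by omega)]; exact h.zero, by rw [hv 1 (by omega)]; exact h.one,
    fun j hj k hk hjk => ?_, fun k hk => ?_, fun k hk => ?_⟩
  · rcases Nat.lt_succ_iff_lt_or_eq.1 hj with hj | rfl <;>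
      rcases Nat.lt_succ_iff_lt_or_eq.1 hk with hk | rfl
    · rw [hv j hj, hv k hk] at hjk
      exact h.inj j hj k hk hjk
    · rw [hv j hj, update_self] at hjk
      exact absurd hjk (hnew j hj)
    · rw [hv k hk, update_self] at hjk
      exact absurd hjk.symm (hnew k hk)
    · rfl
  · rcases Nat.lt_succ_iff_lt_or_eq.1 hk with hk | rfl
    · rw [hv k hk]; exact h.le k hk
    · rwa [update_self]
  · rw [hv k (by omega), hv (k + 1) (by omega)]
    rcases Nat.lt_succ_iff_lt_or_eq.1 hk with hk | rfl
    · rw [hv _ hk]; exact h.next k hk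
    · rw [update_self]; exact hz

/-- A trace can only follow a long cycle until this is closed. -/
theorem IsTrace.not_isLongCycle (h : I.IsTrace x y v M) {z : Fin n}
    (hz : I.IsNext (v (M - 1)) (v (M - 2)) z) (hx : z ≠ x) (hold : z < x ∨ ∃ k < M, v k = z) :
    ¬ I.IsLongCycle p x y := by
  intro hp
  have hpz : z = p^[M] x := hz.unique (h.isNext hp)
  rcases hold with hlt | ⟨k, hk, hkz⟩
  · rw [hpz] at hlt
    exact absurd hlt (not_lt.2 (hp.2.2.2.2 M))
  · rw [h.eq_iterate hp hk, hpz] at hkz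
    have hper : p^[M - k] x = x := by
      have : p^[k] (p^[M - k] x) = p^[k] x := by
        rw [← iterate_add_apply, hkz]
        congr 2
        omega
      exact p.injective.iterate k this
    have hk0 : k ≠ 0 := by
      rintro rfl
      exact hx (hpz.trans hkz.symm)
    rw [← h.eq_iterate hp (k := M - k) (by omega), ← h.zero] at hper
    have := h.inj _ (by omega) 0 (by omega) hper
    omega

open Classical in
/-- A closed trace is the only candidate for an even cycle that is longer than two and starts with
`x` and `y`. -/
theorem IsTrace.setOf_isStableCycle (h : I.IsTrace x y v M)
    (hclose : I.IsNext (v (M - 1)) (v (M - 2)) x) :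
    {C | C.length ∈ {m | Even m ∧ m ≠ 2} ∧ I.IsStableCycle C x y} =
      if ((List.range M).map v : Cycle (Fin n)) ∈ I.SC then
        {((List.range M).map v : Cycle (Fin n))} else ∅ := by
  have h2 := h.two_le
  have hM2 : M ≠ 2 := by
    rintro rfl
    have := hclose.2.1
    rw [show v (2 - 2) = x from h.zero] at this
    exact lt_irrefl _ this
  ext C
  constructor
  · rintro ⟨⟨heven, hne⟩, hC⟩
    have hSC := hC.mem_SC
    obtain ⟨p, hp, rfl, hy, hle⟩ := hC
    rw [periodicOrbit_length] at heven hne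
    have hlong : I.IsLongCycle p x y := ⟨hp, hy, heven, hne, hle⟩
    have hstep : ∀ k, k + 1 < M → p (v k) = v (k + 1) := fun k hk => by
      rw [h.eq_iterate hlong (by omega), h.eq_iterate hlong hk, iterate_succ_apply']
    have hlast : p (v (M - 1)) = v 0 := by
      rw [h.eq_iterate hlong (k := M - 1) (by omega), ← iterate_succ_apply' p, h.zero,
        show (M - 1).succ = M by omega]
      exact (h.isNext hlong).unique hclose
    have heq := periodicOrbit_eq_of_step (by omega) h.inj hstep hlast
    rw [h.zero] at heq
    rw [heq] at hSC ⊢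
    rw [if_pos hSC]
    rfl
  · intro hC
    split_ifs at hC with hSC
    · rw [Set.mem_singleton_iff] at hC
      subst hC
      obtain ⟨q, hq, -, -, hq'⟩ := hSC
      rw [chain_map_range_iff _ (by omega)] at hq'
      have hper := minimalPeriod_eq_of_step (by omega) h.inj hq'.1 hq'.2
      have heq := periodicOrbit_eq_of_step (by omega) h.inj hq'.1 hq'.2
      rw [h.zero] at hper heq
      have hxy : q x = y := by rw [← h.zero, ← h.one]; exact hq'.1 0 (by omega)
      have heven : Even M := by
        rw [← hper]
        have := hclose.1.symm
        exact this.even hq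
      refine ⟨⟨by simpa using heven, by simpa using hM2⟩, q, hq, heq.symm, hxy, fun k => ?_⟩
      rw [← iterate_mod_minimalPeriod_eq, hper]
      have hk : k % M < M := Nat.mod_lt _ (by omega)
      have := iterate_eq_of_step hq'.1 hk
      rw [h.zero] at this
      rw [this]
      exact h.le _ hk
    · exact absurd hC (Set.notMem_empty _)

theorem setOf_isStableCycle_eq_empty (h : ∀ p, ¬ I.IsLongCycle p x y) :
    {C | C.length ∈ {m | Even m ∧ m ≠ 2} ∧ I.IsStableCycle C x y} = ∅ := by
  rw [Set.eq_empty_iff_forall_notMem]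
  rintro C ⟨⟨heven, hne⟩, p, hp, rfl, hy, hle⟩
  rw [periodicOrbit_length] at heven hne
  exact h p ⟨hp, hy, heven, hne, hle⟩

theorem IsLongCycle.stablePair (hp : I.IsLongCycle p x y) : I.StablePair x y := by
  obtain ⟨hs, rfl, heven, -⟩ := hp
  exact hs.stablePair_apply heven

end SRInstance

/-! ### The program for the long even cycles -/

namespace RAM

/-- Variable: `1` as long as a cycle has to be traced further. -/
notation "vGoing" => (24 : ℕ)
/-- Variable: the next partner of an agent, or `n` if there is none. -/
notation "vZ" => (26 : ℕ)
/-- Variable: the position of the predecessor of an agent in its list. -/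
notation "vB" => (27 : ℕ)
/-- Variable: the predecessor of the agent reached on a cycle. -/
notation "vPrev" => (29 : ℕ)

open RAM.Program RAM.Expr Function SRInstance

/-- Find the next better partner of the agent `vC` after the agent `vPrev`. -/
def scanNextProg : Program :=
  assign vZ (.var vN) ;; assign vB (pos (.var vC) (.var vPrev)) ;;
  forLoop vR vB
    (assign vJ (.read aList (idx (.var vC) (.var vR))) ;;
    ite (.read aPair (idx (.var vC) (.var vJ))) (assign vZ (.var vJ)) .skip)

/-- One step on a long cycle. -/
def traceStep : Program :=
  scanNextProg ;;
  ite (.lt (.var vZ) (.var vN))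
    (ite (.eq (.var vZ) (.var vU))
      (store aSucc (.var vC) (.var vU) ;; store aPred (.var vU) (.var vC) ;;
      assign vOk 1 ;; assign vGoing 0)
      (ite (.read aIn (.var vZ) + .lt (.var vZ) (.var vU))
        (assign vGoing 0)
        (store aSucc (.var vC) (.var vZ) ;; store aPred (.var vZ) (.var vC) ;;
        store aIn (.var vZ) 1 ;; assign vPrev (.var vC) ;; assign vC (.var vZ) ;;
        assign vLen (.var vLen + 1))))
    (assign vGoing 0)

/-- Start to trace a long cycle with the agents `vU` and `vV`. -/
def traceInit : Program :=
  clearInProg ;;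
  store aIn (.var vU) 1 ;; store aIn (.var vV) 1 ;;
  store aSucc (.var vU) (.var vV) ;; store aPred (.var vV) (.var vU) ;;
  assign vPrev (.var vU) ;; assign vC (.var vV) ;; assign vLen (1 + 1) ;;
  assign vOk 0 ;; assign vGoing 1

/-- Print all even stable cycles of length greater than two. -/
def longProg : Program :=
  forLoop vU vN (forLoop vV vN
    (ite (.read aPair (idx (.var vU) (.var vV)) * .lt (.var vU) (.var vV))
      (traceInit ;; loop (.var vGoing) traceStep ;;
      ite (.var vOk)
        (testProg ;; ite (.var vOk) (assign vC (.var vU) ;; printProg) .skip)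
        .skip)
      .skip))

variable {n W : ℕ} {I : SRInstance n} {s : State} {p : Equiv.Perm (Fin n)} {x y : Fin n}
  {v : ℕ → Fin n} {M : ℕ}

theorem scanNextProg_spec (hW : n * n + n < W) (hI : HasLists I s) (hP : HasPairs I n 0 s)
    {a b : Fin n} (hb : s.var vC = b) (ha : s.var vPrev = a) :
    wp W scanNextProg (fun s' t => ((∃ z : Fin n, s'.var vZ = z ∧ I.IsNext b a z) ∨
      (s'.var vZ = n ∧ ∀ z, ¬ I.IsNext b a z)) ∧ t ≤ 40 * n + 20) s := by
  classical
  have h0 := hI.var_n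
  have hr := I.rk_lt b a
  have hba := hI.rank b a
  refine wp_seq (wp_assign (by simp [h0]; omega) ?_)
  refine wp_seq (wp_assign (by simp [h0, hb, ha, hba]; omega) ?_)
  simp only [eval_var, eval_pos, h0, State.setVar_var, State.setVar_arr, hb, ha, hba,
    Nat.reduceEqDiff, if_false]
  refine wp_mono (wp_forLoop_const (N := I.rk b a) (fun r s' =>
    (s'.var vZ = n ∧ ∀ z, I.StablePair b z → ¬ I.rk b z < r) ∨
    ∃ z : Fin n, s'.var vZ = z ∧ I.StablePair b z ∧ I.rk b z < r ∧
      ∀ z', I.StablePair b z' → I.rk b z' < r → I.rk b z' ≤ I.rk b z) 30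
    (by decide) (by decide) (by decide) (by simp) (by omega) (.inl ⟨by simp, by simp⟩) ?_) ?_
  · rintro r s' hrn hF hvr hInv
    obtain ⟨j, hj⟩ := I.exists_rk b (hrn.trans hr)
    have h0' : s'.var vN = n := (hF.var _ (by decide)).trans (by simp [h0])
    have hb' : s'.var vC = b := (hF.var _ (by decide)).trans (by simp [hb])
    have hread : s'.arr aList (b * n + r) = j := by
      rw [hF.arr _ (by decide), ← hj]; exact hI.list b j
    have hpair : s'.arr aPair (b * n + j) = if I.StablePair b j then 1 else 0 := by
      rw [hF.arr _ (by decide)]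
      have := hP b j
      simpa [b.isLt] using this
    have hjl := j.isLt
    refine wp_seq (wp_assign (by simp [hb', h0', hvr, hread]; omega) ?_)
    simp only [eval_read, eval_idx, eval_var, hb', h0', hvr, hread]
    have hlast : ∀ z, I.rk b z < r + 1 → I.rk b z < r ∨ z = j := by
      intro z hz
      rcases Nat.lt_succ_iff_lt_or_eq.1 hz with h | h
      · exact .inl h
      · exact .inr (rk_inj.1 (h.trans hj.symm))
    refine wp_ite ?_ ?_
    · intro he
      have hsp : I.StablePair b j := by
        by_contra h
        simp [hb', h0', hpair, h] at he
      refine wp_assign (by simp; omega) ⟨.inr ⟨j, by simp, hsp, by omega, fun z' _ hz' => by omega⟩,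
        by simp⟩
    · intro he
      have hsp : ¬ I.StablePair b j := by
        intro h
        simp [hb', h0', hpair, h] at he
      refine wp_skip ⟨?_, by simp⟩
      rcases hInv with ⟨h1, h2⟩ | ⟨z, h1, h2, h3, h4⟩
      · refine .inl ⟨by simpa using h1, fun z hz hlt => ?_⟩
        rcases hlast z hlt with h | rfl
        · exact h2 z hz h
        · exact hsp hz
      · refine .inr ⟨z, by simpa using h1, h2, by omega, fun z' hz' hlt => ?_⟩
        rcases hlast z' hlt with h | rfl
        · exact h4 z' hz' h
        · exact absurd hz' hsp
  · rintro s' t - ⟨hInv, -, ht⟩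
    refine ⟨?_, ?_⟩
    · rcases hInv with ⟨h1, h2⟩ | ⟨z, h1, h2, h3, h4⟩
      · exact .inr ⟨h1, fun z hz => h2 z hz.1 hz.2.1⟩
      · exact .inl ⟨z, h1, h2, h3, h4⟩
    · have : I.rk b a * (30 + 8) ≤ n * (30 + 8) := Nat.mul_le_mul_right _ hr.le
      simp
      omega

open Classical in
/-- The state holds the agents `v 0, …, v (M - 1)` as a part of the cycle to be tested. -/
structure HasTrace (v : ℕ → Fin n) (M : ℕ) (s : State) : Prop where
  mem : IsVec (s.arr aIn) fun z => if ∃ k < M, v k = z then 1 else 0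
  succ : ∀ k, k + 1 < M → s.arr aSucc (v k) = v (k + 1)
  pred : ∀ k, k + 1 < M → s.arr aPred (v (k + 1)) = v k

theorem HasTrace.congr {s' : State} (h : HasTrace v M s) (h1 : s'.arr aIn = s.arr aIn)
    (h2 : s'.arr aSucc = s.arr aSucc) (h3 : s'.arr aPred = s.arr aPred) : HasTrace v M s' :=
  ⟨by rw [h1]; exact h.mem, by rw [h2]; exact h.succ, by rw [h3]; exact h.pred⟩

theorem HasTrace.extend {s' : State} (h : HasTrace v M s) (hM : 0 < M) {z : Fin n}
    (hinj : ∀ j < M, ∀ k < M, v j = v k → j = k) (hnew : ∀ k < M, v k ≠ z)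
    (h1 : s'.arr aIn = update (s.arr aIn) z 1)
    (h2 : s'.arr aSucc = update (s.arr aSucc) (v (M - 1)) z)
    (h3 : s'.arr aPred = update (s.arr aPred) z (v (M - 1))) :
    HasTrace (update v M z) (M + 1) s' := by
  classical
  have hv : ∀ k < M, update v M z k = v k := fun k hk => update_of_ne (by omega) _ _
  have hne : ∀ k < M, (v k).val ≠ z := fun k hk h => hnew k hk (Fin.ext h)
  refine ⟨fun w => ?_, fun k hk => ?_, fun k hk => ?_⟩
  · rw [h1]
    by_cases hwz : w = z
    · subst hwz
      rw [update_self]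
      exact (if_pos ⟨M, by omega, update_self ..⟩).symm
    · rw [update_of_ne fun h => hwz (Fin.ext h), h.mem w]
      have : (∃ k < M, v k = w) ↔ ∃ k < M + 1, update v M z k = w := by
        constructor
        · rintro ⟨k, hk, rfl⟩
          exact ⟨k, by omega, hv k hk⟩
        · rintro ⟨k, hk, rfl⟩
          rcases Nat.lt_succ_iff_lt_or_eq.1 hk with hk | rfl
          · exact ⟨k, hk, (hv k hk).symm⟩
          · exact absurd (update_self ..) hwz
      simp only [this]
  · rw [h2, hv k (by omega)]
    rcases Nat.lt_succ_iff_lt_or_eq.1 hk with hk | hk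
    · rw [hv _ hk, update_of_ne, h.succ k hk]
      exact fun h => by have := hinj _ (by omega) _ (by omega) (Fin.ext h); omega
    · rw [hk, update_self, show k = M - 1 by omega, update_self]
  · rw [h3, hv k (by omega)]
    rcases Nat.lt_succ_iff_lt_or_eq.1 hk with hk | hk
    · rw [hv _ hk, update_of_ne (hne _ hk), h.pred k hk]
    · rw [hk, update_self, update_self, show k = M - 1 by omega]

/-- What is known when the tracing stops: the cycle has been closed, or there is none. -/
def IsTraceEnd (I : SRInstance n) (x y : Fin n) (v : ℕ → Fin n) (M : ℕ) (s : State) : Prop :=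
  (s.var vOk = 1 ∧ I.IsNext (v (M - 1)) (v (M - 2)) x ∧ s.arr aSucc (v (M - 1)) = x ∧
    s.arr aPred x = v (M - 1)) ∨ (s.var vOk = 0 ∧ ∀ p, ¬ I.IsLongCycle p x y)

/-- The state during the tracing of a long cycle that starts with `x` and `y`. -/
structure IsTracing (I : SRInstance n) (x y : Fin n) (v : ℕ → Fin n) (M : ℕ) (s : State) :
    Prop where
  trace : I.IsTrace x y v M
  hasTrace : HasTrace v M s
  var_prev : s.var vPrev = v (M - 2)
  var_c : s.var vC = v (M - 1)
  var_len : s.var vLen = M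

/-- A step extends the trace, closes it, or finds that it cannot be part of a long cycle. -/
theorem traceStep_spec (hW : n * n + n < W) (hI : HasLists I s) (hP : HasPairs I n 0 s)
    (hx : s.var vU = x) (h : IsTracing I x y v M s) (hgo : s.var vGoing = 1)
    (hok : s.var vOk = 0) :
    wp W traceStep (fun s' t => (∃ v' M', IsTracing I x y v' M' s' ∧
      ((s'.var vGoing = 1 ∧ s'.var vOk = 0 ∧ M' = M + 1) ∨
        (s'.var vGoing = 0 ∧ M' = M ∧ IsTraceEnd I x y v' M' s'))) ∧ t ≤ 40 * n + 60) s := by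
  classical
  have h2 := h.trace.two_le
  have hMn := h.trace.le_card
  have hxl := x.isLt
  refine wp_seq (wp_mono (scanNextProg_spec hW hI hP h.var_c h.var_prev) ?_)
  rintro s₁ t₁ hF₁ ⟨hnext, ht₁⟩
  have h0₁ : s₁.var vN = n := (hF₁.var _ (by decide)).trans hI.var_n
  have hx₁ : s₁.var vU = x := (hF₁.var _ (by decide)).trans hx
  have hok₁ : s₁.var vOk = 0 := (hF₁.var _ (by decide)).trans hok
  have hgo₁ : s₁.var vGoing = 1 := (hF₁.var _ (by decide)).trans hgo
  have h₁ : IsTracing I x y v M s₁ := ⟨h.trace,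
    h.hasTrace.congr (hF₁.arr _ (by decide)) (hF₁.arr _ (by decide)) (hF₁.arr _ (by decide)),
    (hF₁.var _ (by decide)).trans h.var_prev, (hF₁.var _ (by decide)).trans h.var_c,
    (hF₁.var _ (by decide)).trans h.var_len⟩
  have hc := h₁.var_c
  have hcl := (v (M - 1)).isLt
  have hdone : (∀ p, ¬ I.IsLongCycle p x y) → IsTracing I x y v M (s₁.setVar vGoing 0) ∧
      (((s₁.setVar vGoing 0).var vGoing = 1 ∧ (s₁.setVar vGoing 0).var vOk = 0 ∧ M = M + 1) ∨
        ((s₁.setVar vGoing 0).var vGoing = 0 ∧ M = M ∧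
          IsTraceEnd I x y v M (s₁.setVar vGoing 0))) := fun hno =>
    ⟨⟨h₁.trace, h₁.hasTrace.congr rfl rfl rfl, by simpa using h₁.var_prev, by simpa using h₁.var_c,
      by simpa using h₁.var_len⟩, .inr ⟨by simp, rfl, .inr ⟨by simpa using hok₁, hno⟩⟩⟩
  refine wp_ite ?_ ?_
  · intro he
    obtain ⟨z, hz, hzn⟩ : ∃ z : Fin n, s₁.var vZ = z ∧ I.IsNext (v (M - 1)) (v (M - 2)) z := by
      rcases hnext with h | ⟨h, -⟩
      · exact h
      · rw [eval_lt_ne_zero, eval_var, eval_var, h, h0₁] at he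
        exact absurd he (lt_irrefl _)
    have hzl := z.isLt
    refine wp_ite ?_ ?_
    · intro he
      have hzx : z = x := by
        rw [eval_eq_ne_zero, eval_var, eval_var, hz, hx₁] at he
        exact Fin.ext he
      subst hzx
      refine wp_seq (wp_store (by simp [hc]; omega) (by simp [hx₁]; omega) ?_)
      refine wp_seq (wp_store (by simp [hx₁]; omega) (by simp [hc]; omega) ?_)
      refine wp_seq (wp_assign (by simp; omega) ?_)
      refine wp_assign (by simp; omega) ⟨⟨v, M, ⟨h₁.trace, ⟨?_, fun k hk => ?_, fun k hk => ?_⟩,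
        by simpa using h₁.var_prev, by simpa using h₁.var_c, by simpa using h₁.var_len⟩,
        .inr ⟨by simp, rfl, .inl ⟨by simp, hzn, by simp [hc, hx₁], by simp [hc, hx₁]⟩⟩⟩,
        by simp; omega⟩
      · simpa using h₁.hasTrace.mem
      · have hne : (v k).val ≠ v (M - 1) := fun h => by
          have := h₁.trace.inj _ (by omega) _ (by omega) (Fin.ext h); omega
        simpa [hc, hx₁, hne] using h₁.hasTrace.succ k hk
      · have hne : (v (k + 1)).val ≠ z := fun h => by
          rw [Fin.val_inj, ← h₁.trace.zero] at h
          have := h₁.trace.inj _ (by omega) _ (by omega) h; omega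
        simpa [hc, hx₁, hne] using h₁.hasTrace.pred k hk
    · intro he
      have hzx : z ≠ x := by
        rw [eval_eq_eq_zero, eval_var, eval_var, hz, hx₁] at he
        exact fun h => he (by rw [h])
      have hmem := h₁.hasTrace.mem z
      have hsum : (Expr.read aIn (.var vZ) + .lt (.var vZ) (.var vU)).eval s₁ =
          (if ∃ k < M, v k = z then 1 else 0) + (if z < x then 1 else 0) := by
        simp [hz, hx₁, hmem]
      refine wp_ite ?_ ?_
      · intro he
        rw [hsum] at he
        have hold : z < x ∨ ∃ k < M, v k = z := by
          by_contra hcon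
          rw [not_or] at hcon
          rw [if_neg hcon.1, if_neg hcon.2] at he
          exact he rfl
        refine wp_assign (by simp; omega) ⟨⟨v, M, hdone fun p =>
          h₁.trace.not_isLongCycle hzn hzx hold⟩, by simp; omega⟩
      · intro he
        rw [hsum] at he
        have hold : ¬ z < x ∧ ¬ ∃ k < M, v k = z := by
          constructor <;> intro hcon <;> rw [if_pos hcon] at he <;> omega
        have hnew : ∀ k < M, v k ≠ z := fun k hk h => hold.2 ⟨k, hk, h⟩
        have htr := h₁.trace.extend hzn (not_lt.1 hold.1) hnew
        have hMn' := htr.le_card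
        refine wp_seq (wp_store (by simp [hc]; omega) (by simp [hz]; omega) ?_)
        refine wp_seq (wp_store (by simp [hz]; omega) (by simp [hc]; omega) ?_)
        refine wp_seq (wp_store (by simp [hz]; omega) (by simp; omega) ?_)
        refine wp_seq (wp_assign (by simp [hc]; omega) ?_)
        refine wp_seq (wp_assign (by simp [hz]; omega) ?_)
        refine wp_assign (by simp [h₁.var_len]; omega) ⟨⟨_, _, ⟨htr, h₁.hasTrace.extend (by omega)
          h₁.trace.inj hnew ?_ ?_ ?_, ?_, ?_, ?_⟩,
          .inl ⟨by simpa using hgo₁, by simpa using hok₁, rfl⟩⟩,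
          by simp; omega⟩
        · simp [hz]
        · simp [hz, hc]
        · simp [hz, hc]
        · have : update v M z (M + 1 - 2) = v (M - 1) := by
            rw [show M + 1 - 2 = M - 1 by omega, update_of_ne (by omega)]
          rw [this]
          simp [hc]
        · simp [hz]
        · simp [h₁.var_len]
  · intro he
    have hno : ∀ z, ¬ I.IsNext (v (M - 1)) (v (M - 2)) z := by
      rcases hnext with ⟨z, hz, -⟩ | ⟨-, h⟩
      · rw [eval_lt_eq_zero, eval_var, eval_var, hz, h0₁] at he
        exact absurd z.isLt (not_lt.2 he)
      · exact h
    exact wp_assign (by simp; omega) ⟨⟨v, M, hdone fun p hp => hno _ (h₁.trace.isNext hp)⟩,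
      by simp; omega⟩

theorem traceInit_spec (hW : n * n + n < W) (h0 : s.var vN = n) (hlt : x < y)
    (hx : s.var vU = x) (hy : s.var vV = y) :
    wp W traceInit (fun s' t => (∃ v M, IsTracing I x y v M s') ∧ s'.var vGoing = 1 ∧
      s'.var vOk = 0 ∧ t ≤ 11 * n + 50) s := by
  classical
  have hxl := x.isLt
  have hyl := y.isLt
  have hxy : x ≠ y := hlt.ne
  have hxy' : x.val ≠ y.val := fun h => hxy (Fin.ext h)
  refine wp_seq (wp_mono (clearInProg_spec hW h0) ?_)
  rintro s₁ t₁ hF₁ ⟨hin, ht₁⟩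
  have hx₁ : s₁.var vU = x := (hF₁.var _ (by decide)).trans hx
  have hy₁ : s₁.var vV = y := (hF₁.var _ (by decide)).trans hy
  refine wp_seq (wp_store (by simp [hx₁]; omega) (by simp; omega) ?_)
  refine wp_seq (wp_store (by simp [hy₁]; omega) (by simp; omega) ?_)
  refine wp_seq (wp_store (by simp [hx₁]; omega) (by simp [hy₁]; omega) ?_)
  refine wp_seq (wp_store (by simp [hy₁]; omega) (by simp [hx₁]; omega) ?_)
  refine wp_seq (wp_assign (by simp [hx₁]; omega) ?_)
  refine wp_seq (wp_assign (by simp [hy₁]; omega) ?_)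
  refine wp_seq (wp_assign (by simp; omega) ?_)
  refine wp_seq (wp_assign (by simp; omega) ?_)
  refine wp_assign (by simp; omega) ⟨⟨fun k => if k = 0 then x else y, 2,
    ⟨⟨le_rfl, rfl, rfl, ?_, ?_, fun k hk => by omega⟩,
      ⟨fun z => ?_, fun k hk => ?_, fun k hk => ?_⟩,
      by simp [hx₁], by simp [hy₁], by simp⟩⟩, by simp, by simp, by simp; omega⟩
  · intro j hj k hk hjk
    interval_cases j <;> interval_cases k <;> simp_all
  · intro k hk
    interval_cases k
    · exact le_rfl
    · exact hlt.le
  · have hex : (∃ k < 2, (if k = 0 then x else y) = z) ↔ (x = z ∨ y = z) := by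
      constructor
      · rintro ⟨k, hk, h⟩
        split_ifs at h
        · exact .inl h
        · exact .inr h
      · rintro (h | h)
        · exact ⟨0, by omega, h⟩
        · exact ⟨1, by omega, h⟩
    simp only [hex]
    by_cases hzx : z = x
    · subst hzx
      simp [hx₁, hy₁, hxy']
    · by_cases hzy : z = y
      · subst hzy
        simp [hx₁, hy₁]
      · have h1 : z.val ≠ x := fun h => hzx (Fin.ext h)
        have h2 : z.val ≠ y := fun h => hzy (Fin.ext h)
        have h3 := hin z
        simp [hx₁, hy₁, h1, h2, h3, Ne.symm hzx, Ne.symm hzy]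
  · have : k = 0 := by omega
    subst this
    simp [hx₁, hy₁]
  · have : k = 0 := by omega
    subst this
    simp [hx₁, hy₁]

/-- When a cycle is closed, the state holds it as a cycle to be tested. -/
theorem HasTrace.exists_hasCycles (h : HasTrace v M s) (htr : I.IsTrace x y v M)
    (h1 : s.arr aSucc (v (M - 1)) = x) (h2 : s.arr aPred x = v (M - 1)) :
    ∃ c : Equiv.Perm (Fin n), HasCycles c s ∧ ((∃ q, I.IsStablePartition q ∧
      ∀ i, c i ≠ i → q i = c i) ↔ ((List.range M).map v : Cycle (Fin n)) ∈ I.SC) := by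
  classical
  have hM := htr.two_le
  obtain ⟨c, hstep, hlast, hfix⟩ := exists_cycle_perm v (s := 0) (m := M) (by omega) htr.inj
  have hstep' : ∀ k, k + 1 < M → c (v k) = v (k + 1) := fun k hk => hstep k (Nat.zero_le _) hk
  have hfix' : ∀ z, (∀ k < M, v k ≠ z) → c z = z := fun z hz => hfix z fun k _ hk => hz k hk
  have hof : ∀ i, c i ≠ i → ∃ k < M, v k = i := fun i hi => by
    by_contra hcon
    push Not at hcon
    exact hi (hfix' i hcon)
  have hne : ∀ k < M, c (v k) ≠ v k := fun k hk heq => by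
    by_cases hkM : k + 1 < M
    · rw [hstep' k hkM] at heq
      have := htr.inj _ hkM _ hk heq
      omega
    · rw [show k = M - 1 by omega, hlast] at heq
      have := htr.inj _ (by omega) _ (by omega) heq
      omega
  refine ⟨c, ⟨fun i => ?_, fun i hi => ?_, fun i hi => ?_⟩,
    (mem_SC_iff_exists_extends hM htr.inj hstep' hlast hfix').symm⟩
  · rw [h.mem i]
    by_cases hi : ∃ k < M, v k = i
    · obtain ⟨k, hk, rfl⟩ := hi
      exact (if_pos ⟨k, hk, rfl⟩).trans (if_neg (hne k hk)).symm
    · exact (if_neg hi).trans (if_pos (hfix' i fun k hk heq => hi ⟨k, hk, heq⟩)).symm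
  · obtain ⟨k, hk, rfl⟩ := hof i hi
    by_cases hkM : k + 1 < M
    · rw [hstep' k hkM, h.succ k hkM]
    · rw [show k = M - 1 by omega, hlast, h1, htr.zero]
  · obtain ⟨k, hk, rfl⟩ := hof i hi
    rcases k with _ | k
    · rw [htr.zero, h2, Fin.val_inj, Equiv.Perm.eq_inv_iff_eq, hlast, htr.zero]
    · rw [h.pred k hk, Fin.val_inj, Equiv.Perm.eq_inv_iff_eq, hstep' k hk]

end RAM

namespace RAM

open RAM.Program RAM.Expr Function SRInstance

variable {n W : ℕ} {I : SRInstance n} {s : State} {p : Equiv.Perm (Fin n)} {x y : Fin n}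

/-- The tracing ends after at most `n` steps, since a trace consists of distinct agents. -/
theorem traceLoop_spec (hW : n * n + n < W) (hI : HasLists I s) (hP : HasPairs I n 0 s)
    (hx : s.var vU = x) (h : ∃ v M, IsTracing I x y v M s) (hgo : s.var vGoing = 1)
    (hok : s.var vOk = 0) :
    wp W (loop (.var vGoing) traceStep) (fun s' t => (∃ v M, IsTracing I x y v M s' ∧
      IsTraceEnd I x y v M s') ∧ t ≤ 40 * (n * n) + 70 * n + 10) s := by
  obtain ⟨v, M, h⟩ := h
  refine wp_mono (wp_loop (fun s' => ∃ v M, IsTracing I x y v M s' ∧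
    ((s'.var vGoing = 1 ∧ s'.var vOk = 0) ∨ (s'.var vGoing = 0 ∧ IsTraceEnd I x y v M s')))
    (fun s' => (40 * n + 70) * (n - s'.var vLen + s'.var vGoing)) ⟨v, M, h, .inl ⟨hgo, hok⟩⟩ ?_) ?_
  · rintro s' hF ⟨v, M, h, hcase⟩ he
    have hcase' : s'.var vGoing = 1 ∧ s'.var vOk = 0 := by
      rcases hcase with h | h
      · exact h
      · exact absurd h.1 he
    have hMn := h.trace.le_card
    refine wp_mono (traceStep_spec hW
      (hI.congr (hF.var _ (by decide)) (hF.arr _ (by decide)) (hF.arr _ (by decide)))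
      (by rw [HasPairs, hF.arr _ (by decide)]; exact hP) ((hF.var _ (by decide)).trans hx)
      h hcase'.1 hcase'.2) ?_
    rintro s'' t - ⟨⟨v', M', h', hcase''⟩, ht⟩
    have hMn' := h'.trace.le_card
    refine ⟨⟨v', M', h', ?_⟩, ?_⟩
    · rcases hcase'' with h | h
      · exact .inl ⟨h.1, h.2.1⟩
      · exact .inr ⟨h.1, h.2.2⟩
    · have hdec : n - s''.var vLen + s''.var vGoing + 1 = n - s'.var vLen + s'.var vGoing := by
        rw [h'.var_len, h.var_len, hcase'.1]
        rcases hcase'' with h | h <;> rw [h.1] <;> omega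
      rw [← hdec, Nat.mul_succ]
      simp
      omega
  · rintro s' t - ⟨⟨v', M', h', hcase⟩, -, he, ht⟩
    refine ⟨⟨v', M', h', ?_⟩, ?_⟩
    · rcases hcase with h | h
      · rw [eval_var, h.1] at he
        exact absurd he one_ne_zero
      · exact h.2
    · have h2 := h.trace.two_le
      have hle : n - s.var vLen + s.var vGoing ≤ n := by
        rw [h.var_len, hgo]
        have := h.trace.le_card
        omega
      have h3 : (40 * n + 70) * (n - s.var vLen + s.var vGoing) ≤ 40 * (n * n) + 70 * n := by
        calc _ ≤ (40 * n + 70) * n := Nat.mul_le_mul_left _ hle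
          _ = _ := by ring
      simp at ht
      omega

theorem longProg_spec (hn : 0 < n) (hW : n * n + n < W) (hI : HasLists I s)
    (hp : I.IsStablePartition p) (hP : HasPairs I n 0 s)
    (hout : Lists (I.cyclesBefore {m | Odd m} n 0 ∪ I.cyclesBefore {2} n 0) s.out) :
    wp W longProg (fun s' t => I.ListsStableCycles s'.out ∧
      t ≤ I.n₁ ^ 2 * (2700 * (n * n)) + 60 * (n * n)) s := by
  classical
  have hnn : n ≤ n * n := Nat.le_mul_self n
  refine wp_mono (wp_forLoop_forLoop (fun k j s' =>
    Lists (I.cyclesBefore {m | Odd m} n 0 ∪ I.cyclesBefore {2} n 0 ∪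
      I.cyclesBefore {m | Even m ∧ m ≠ 2} k j) s'.out)
    (evenWeight p) (2700 * (n * n)) 20 (by decide) (by decide) (by decide) (by decide) (by decide)
    (by decide) hI.var_n (by omega) ?_ ?_ ?_ ?_) ?_
  · rwa [cyclesBefore_zero, Set.union_empty]
  · exact fun k j s' u v _ h => h
  · rintro k s' h
    rwa [cyclesBefore_row]
  · rintro k j s' hk hj hF hvk hvj hlist
    obtain ⟨x, rfl⟩ : ∃ x : Fin n, x.val = k := ⟨⟨k, hk⟩, rfl⟩
    obtain ⟨y, rfl⟩ : ∃ y : Fin n, y.val = j := ⟨⟨j, hj⟩, rfl⟩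
    have hI' : HasLists I s' :=
      hI.congr (hF.var _ (by decide)) (hF.arr _ (by decide)) (hF.arr _ (by decide))
    have hP' : HasPairs I n 0 s' := by rw [HasPairs, hF.arr _ (by decide)]; exact hP
    have h0' := hI'.var_n
    have hpair : s'.arr aPair (x * n + y) = if I.StablePair x y then 1 else 0 := by
      have := hP' x y
      simpa [x.isLt] using this
    rw [cyclesBefore_succ, ← Set.union_assoc]
    have hempty : (∀ p, ¬ I.IsLongCycle p x y) → ∀ s'' : State, s''.out = s'.out →
        Lists (I.cyclesBefore {m | Odd m} n 0 ∪ I.cyclesBefore {2} n 0 ∪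
          I.cyclesBefore {m | Even m ∧ m ≠ 2} x y ∪ {C | C.length ∈ {m | Even m ∧ m ≠ 2} ∧
            I.IsStableCycle C x y}) s''.out := fun hno s'' ho => by
      rw [setOf_isStableCycle_eq_empty hno, Set.union_empty, ho]
      exact hlist
    refine wp_ite ?_ ?_
    · intro he
      have hsp : I.StablePair x y := by
        by_contra h
        simp [hvk, hvj, h0', hpair, h] at he
      have hlt : x < y := by
        by_contra h
        simp [hvk, hvj, h] at he
      rw [evenWeight_val, evenWeight_val, if_pos (hsp.even hp), if_pos (hsp.symm.even hp)]
      refine wp_seq (wp_mono (traceInit_spec (I := I) hW h0' hlt hvk hvj) ?_)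
      rintro s₁ t₁ hF₁ ⟨hex, hgo₁, hok₁, ht₁⟩
      have hI₁ : HasLists I s₁ :=
        hI'.congr (hF₁.var _ (by decide)) (hF₁.arr _ (by decide)) (hF₁.arr _ (by decide))
      have hx₁ : s₁.var vU = x := (hF₁.var _ (by decide)).trans hvk
      refine wp_seq (wp_mono (traceLoop_spec hW hI₁
        (by rw [HasPairs, hF₁.arr _ (by decide)]; exact hP') hx₁ hex hgo₁ hok₁) ?_)
      rintro s₂ t₂ hF₂ ⟨⟨v, M, htr, hend⟩, ht₂⟩
      have hI₂ : HasLists I s₂ :=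
        hI₁.congr (hF₂.var _ (by decide)) (hF₂.arr _ (by decide)) (hF₂.arr _ (by decide))
      have hx₂ : s₂.var vU = x := (hF₂.var _ (by decide)).trans hx₁
      have ho₂ : s₂.out = s'.out := (hF₂.out rfl).trans (hF₁.out rfl)
      have hM := htr.trace.two_le
      refine wp_ite ?_ ?_
      · intro he
        obtain ⟨-, hnext, hsucc, hpred⟩ : s₂.var vOk = 1 ∧ I.IsNext (v (M - 1)) (v (M - 2)) x ∧
            s₂.arr aSucc (v (M - 1)) = x ∧ s₂.arr aPred x = v (M - 1) := by
          rcases hend with h | h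
          · exact h
          · exact absurd h.1 he
        obtain ⟨c, hc, hciff⟩ := htr.hasTrace.exists_hasCycles htr.trace hsucc hpred
        rw [htr.trace.setOf_isStableCycle hnext]
        refine wp_seq (wp_mono (testProg_spec hn hW hI₂ hc) ?_)
        rintro s₃ t₃ hF₃ ⟨hok, ht₃⟩
        rw [hciff] at hok
        have hx₃ : s₃.var vU = x := (hF₃.var _ (by decide)).trans hx₂
        have hlen₃ : s₃.var vLen = M := (hF₃.var _ (by decide)).trans htr.var_len
        have ho₃ : s₃.out = s'.out := (hF₃.out rfl).trans ho₂
        refine wp_ite ?_ ?_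
        · intro he
          have hSC := hok.1 he
          rw [if_pos hSC]
          refine wp_seq (wp_assign (by simp [hx₃]; omega) ?_)
          -- The agent after the last one is `x`, the first one.
          have hmap : (List.range M).map (update v M x) = (List.range M).map v :=
            List.map_congr_left fun k hk => update_of_ne (List.mem_range.1 hk).ne _ _
          refine wp_mono (printProg_spec hW (v := update v M x) htr.trace.le_card
            (by simpa using hlen₃) ?_ fun k hk => ?_) ?_
          · rw [update_of_ne (by omega), htr.trace.zero]
            simp [hx₃]
          · rw [State.setVar_arr, hF₃.arr _ (by decide), update_of_ne (by omega)]
            by_cases hkM : k + 1 < M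
            · rw [update_of_ne (by omega)]
              exact htr.hasTrace.succ k hkM
            · rw [show k + 1 = M by omega, update_self, show k = M - 1 by omega]
              exact hsucc
          · rintro s₄ t₄ - ⟨ho₄, ht₄⟩
            rw [hmap, State.setVar_out, ho₃] at ho₄
            refine ⟨ho₄ ▸ hlist.append ?_, by simp; omega⟩
            have hmem : ((List.range M).map v : Cycle (Fin n)) ∈ {C : Cycle (Fin n) |
                C.length ∈ {m | Even m ∧ m ≠ 2} ∧ I.IsStableCycle C x y} := by
              rw [htr.trace.setOf_isStableCycle hnext, if_pos hSC]
              exact Set.mem_singleton _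
            rintro ((h | h) | h)
            · exact Nat.not_even_iff_odd.2 h.1 hmem.1.1
            · exact hmem.1.2 h.1
            · exact hmem.2.notMem_cyclesBefore _ h
        · intro he
          rw [if_neg fun h => hok.2 h he, Set.union_empty]
          exact wp_skip ⟨ho₃ ▸ hlist, by simp; omega⟩
      · intro he
        have hno : ∀ p, ¬ I.IsLongCycle p x y := by
          rcases hend with h | h
          · rw [eval_var, h.1] at he
            exact absurd he one_ne_zero
          · exact h.2
        exact wp_skip ⟨hempty hno _ ho₂, by simp; omega⟩
    · intro he
      refine wp_skip ⟨hempty (fun p hp => ?_) _ rfl, by simp⟩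
      have hsp := hp.stablePair
      have hlt : x < y := lt_of_le_of_ne (hp.2.1 ▸ hp.2.2.2.2 1) hsp.1
      simp [hvk, hvj, h0', hpair, hsp, hlt] at he
  · rintro s' t - ⟨h, ht⟩
    rw [sum_evenWeight hp] at ht
    refine ⟨?_, by omega⟩
    refine Lists.listsStableCycles ?_
    convert h using 1
    ext C
    simp only [Set.mem_union, mem_cyclesBefore_all, Set.mem_ofPred_eq, Set.mem_singleton_iff]
    constructor
    · intro hC
      by_cases h1 : Odd C.length
      · exact .inl (.inl ⟨hC, h1⟩)
      · by_cases h2 : C.length = 2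
        · exact .inl (.inr ⟨hC, h2⟩)
        · exact .inr ⟨hC, Nat.not_odd_iff_even.1 h1, h2⟩
    · tauto

end RAM

/-! ### The whole program -/

namespace RAM

open RAM.Program RAM.Expr Function SRInstance

variable {n W : ℕ} {I : SRInstance n} {s : State}

/-- The program that prints all stable cycles. -/
def stableCyclesProg : Program :=
  setupProg ;; solveProg ;; succProg ;; oddProg ;; pairProg ;; longProg

theorem stableCyclesProg_spec (hn : 0 < n) (hW : n * n + n < W) (h0 : s.var vN = n)
    (hP : I.IsPref (s.arr aList)) (hzero : ∀ m, s.arr aPair m = 0) (hout : s.out = []) :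
    wp W stableCyclesProg (fun s' t => I.ListsStableCycles s'.out ∧
      t ≤ I.n₁ ^ 2 * (5200 * (n * n)) + 3000 * (n * n)) s := by
  refine wp_seq (wp_mono (setupProg_spec hW h0 hP) ?_)
  rintro s₁ t₁ hF₁ ⟨hI₁, hP₁, hR₁, ht₁⟩
  refine wp_seq (wp_mono (solveProg_spec hn hW hI₁.var_n hP₁ hR₁) ?_)
  rintro s₂ t₂ hF₂ ⟨p, hp, hL, ht₂⟩
  have hI₂ : HasLists I s₂ :=
    hI₁.congr (hF₂.var _ (by decide)) (hF₂.arr _ (by decide)) (hF₂.arr _ (by decide))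
  refine wp_seq (wp_mono (succProg_spec hW hI₂.var_n
    (by rw [hF₂.arr _ (by decide)]; exact hP₁) hL) ?_)
  rintro s₃ t₃ hF₃ ⟨hS, ht₃⟩
  have hI₃ : HasLists I s₃ :=
    hI₂.congr (hF₃.var _ (by decide)) (hF₃.arr _ (by decide)) (hF₃.arr _ (by decide))
  have ho₃ : s₃.out = [] := ((hF₃.out rfl).trans (hF₂.out rfl)).trans ((hF₁.out rfl).trans hout)
  refine wp_seq (wp_mono (oddProg_spec hW hI₃.var_n hp hS ho₃) ?_)
  rintro s₄ t₄ hF₄ ⟨hL₄, hE₄, ht₄⟩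
  have hI₄ : HasLists I s₄ :=
    hI₃.congr (hF₄.var _ (by decide)) (hF₄.arr _ (by decide)) (hF₄.arr _ (by decide))
  have hzero₄ : ∀ m, s₄.arr aPair m = 0 := by
    rw [hF₄.arr _ (by decide), hF₃.arr _ (by decide), hF₂.arr _ (by decide),
      hF₁.arr _ (by decide)]
    exact hzero
  refine wp_seq (wp_mono (pairProg_spec hn hW hI₄ hp hE₄ hzero₄ hL₄) ?_)
  rintro s₅ t₅ hF₅ ⟨hL₅, hP₅, ht₅⟩
  have hI₅ : HasLists I s₅ :=
    hI₄.congr (hF₅.var _ (by decide)) (hF₅.arr _ (by decide)) (hF₅.arr _ (by decide))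
  refine wp_mono (longProg_spec hn hW hI₅ hp hP₅ hL₅) ?_
  rintro s₆ t₆ - ⟨hL₆, ht₆⟩
  refine ⟨hL₆, ?_⟩
  have h1 : n ≤ n * n := Nat.le_mul_self n
  have h2 : I.n₁ ^ 2 * (5200 * (n * n)) =
      I.n₁ ^ 2 * (2500 * (n * n)) + I.n₁ ^ 2 * (2700 * (n * n)) := by ring
  omega

end RAM

namespace SRInstance

theorem isPref_prefTable {n : ℕ} (I : SRInstance n) : I.IsPref I.prefTable := by
  intro i j
  have hr := I.rk_lt i j
  have hn : 0 < n := i.pos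
  have hdiv : (i * n + I.rk i j) / n = i := by
    rw [Nat.mul_comm, Nat.mul_add_div hn, Nat.div_eq_of_lt hr, Nat.add_zero]
  have hmod : (i * n + I.rk i j) % n = I.rk i j := by
    rw [Nat.mul_comm, Nat.mul_add_mod, Nat.mod_eq_of_lt hr]
  unfold prefTable
  rw [dif_pos ⟨by rw [hdiv]; exact i.isLt, by rw [hmod]; exact hr⟩]
  simp only [hdiv, hmod, Fin.eta]
  rw [Fin.val_inj, Equiv.symm_apply_eq]
  exact Fin.ext rfl

end SRInstance

theorem mainTheorem5 :
    ∃ (P : RAM.Program) (c d : ℕ), ∀ n : ℕ, 0 < n → Even n → ∀ I : SRInstance n,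
      ∃ (t : ℕ) (s : RAM.State),
        RAM.Exec (n ^ d) P I.initState t s ∧
        I.ListsStableCycles s.out ∧
        (0 < I.n₁ → t ≤ c * (I.n₁ ^ 2 * (n ^ 2 + I.n₁))) ∧
        (I.n₁ = 0 → t ≤ c * n ^ 2) ∧
        t ≤ c * n ^ 4 := by
  refine ⟨RAM.stableCyclesProg, 8200, 3, fun n hn heven I => ?_⟩
  -- Parity excludes `n = 1`, for which every word bound `n ^ d` would be `1`.
  have h2 : 2 ≤ n := by
    obtain ⟨m, rfl⟩ := heven
    omega
  have hW : n * n + n < n ^ 3 := by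
    calc n * n + n < n * n + n * n := by nlinarith
      _ = 2 * (n * n) := by ring
      _ ≤ n * (n * n) := Nat.mul_le_mul_right _ h2
      _ = n ^ 3 := by ring
  obtain ⟨t, s, hE, hL, ht⟩ := RAM.stableCyclesProg_spec (I := I) (s := I.initState) hn hW rfl
    I.isPref_prefTable (fun _ => rfl) rfl
  have hle : I.n₁ ≤ n := Nat.sub_le _ _
  refine ⟨t, s, hE, hL, fun hpos => ?_, fun hzero => ?_, ?_⟩
  · have h1 : 1 * (n * n) ≤ I.n₁ ^ 2 * (n * n) :=
      Nat.mul_le_mul_right _ (Nat.one_le_pow _ _ hpos)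
    calc t ≤ 8200 * (I.n₁ ^ 2 * (n * n)) := by linarith
      _ ≤ 8200 * (I.n₁ ^ 2 * (n ^ 2 + I.n₁)) := by
        gcongr
        rw [sq]
        omega
  · rw [hzero] at ht
    nlinarith
  · have h1 : I.n₁ ^ 2 * (n * n) ≤ n ^ 2 * (n * n) :=
      Nat.mul_le_mul_right _ (Nat.pow_le_pow_left hle 2)
    have h3 : 1 * (n * n) ≤ n ^ 2 * (n * n) :=
      Nat.mul_le_mul_right _ (Nat.one_le_pow _ _ hn)
    calc t ≤ 8200 * (n ^ 2 * (n * n)) := by linarith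
      _ = 8200 * n ^ 4 := by ring
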